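/- Let $(B,h,J)$ be a toric Kähler surface in symplectic coordinates $(x_i,\phi^i)$, $i=1,2$: $x=(x_1,x_2)$ are the moment maps of the toric Killing fields $m_i=\partial_{\phi^i}$, ranging over a connected open set $U\subset\mathbb R^2$, and $$h=G^{ij}\,dx_i\,dx_j+G_{ij}\,d\phi^i d\phi^j,\qquad G^{ij}=\frac{\partial^2 g}{\partial x_i\partial x_j},\qquad J=dx_i\wedge d\phi^i,$$ where $g$ is a smooth function on $U$ with positive definite Hessian and $(G_{ij})$ is the inverse of $(G^{ij})$. Write $\langle\alpha,\beta\rangle=\alpha_1\beta_2-\alpha_2\beta_1$. Suppose that $(B,h,J)$ is separable with respect to orthogonal coordinates $(\xi_0,\eta_0)$, that is, $\xi_0,\eta_0$ are smooth torus-invariant functions with everywhere independent differentials and $d\xi_0\cdot d\eta_0=0$, and $\partial_{\xi_0}^2x_i=\partial_{\eta_0}^2x_i=0$ for $i=1,2$. (a) After affine changes of each of the two coordinates, and possibly exchanging them, one obtains coordinates $(\xi,\eta)$ for which $$x_i=c_i+a_i\xi+\tilde a_i(\xi+\eta)+b_i\xi\eta$$ with constants of one of the following canonical types: product-toric (PT),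 $b=0$ and $\langle a,\tilde a\rangle\ne0$; Calabi-toric (CT), $\tilde a=0$ and $\langle a,b\rangle\neq0$; ortho-toric (OT), $a=0$ and $\langle\tilde a,b\rangle\ne0$. (b) For every such choice of $(\xi,\eta)$ and constants, put $(\psi,\varphi)=((a_i+\tilde a_i)\phi^i,\ \tilde a_i\phi^i)$ in the case PT, $(a_i\phi^i,\ b_i\phi^i)$ in the case CT, $(\tilde a_i\phi^i,\ b_i\phi^i)$ in the case OT, and $$\Psi_*=\begin{cases}d\big(\xi\,d\psi-\eta\,d\varphi\big)&\text{PT},\\ d\big(\xi^2(d\psi+\eta\,d\varphi)\big)&\text{CT},\\ d\Big(\frac{\xi^3}{\xi-\eta}(d\psi+\eta\,d\varphi)-\frac{\eta^3}{\xi-\eta}(d\psi+\xi\,d\varphi)\Big)&\text{OT}.\end{cases}$$ Then $\Psi_*$ is a Hamiltonian 2-form, it is separable with respect to $(\xi_0,\eta_0)$, and it is not a constant multiple of $J$. A 2-form $\Psi$ on $B$ is both Hamiltonian and separable with respect to $(\xi_0,\eta_0)$ if and only if $$\Psi=\gamma J+\delta\Psi_*$$ for some real constants $\gamma,\delta$,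 and these are then unique. In particular, modulo the multiples of $J$, the space of such 2-forms is one-dimensional. Here a Hamiltonian 2-form is a smooth closed $J$-invariant 2-form $\Psi$ with $$\nabla_a\Psi_{bc}=\tfrac23\big((\partial_a\sigma)J_{bc}-J_{a[b}\partial_{c]}\sigma-h_{a[b}J_{c]}{}^{d}\partial_d\sigma\big),\qquad\sigma=\tfrac14\Psi_{ab}J^{ab},$$ where $\nabla$ is the Levi-Civita connection of $h$ and the brackets denote antisymmetrisation with weight $\tfrac12$. A 2-form $\Psi$ is separable with respect to $(\xi_0,\eta_0)$ if it is smooth, closed, torus-invariant, satisfies $m_1^\flat\wedge m_2^\flat\wedge\Psi=0$, and has torus-invariant moment maps $\mu_i$ (that is, $\iota_{m_i}\Psi=-d\mu_i$) with $\langle\partial_{\xi_0}x,\partial_{\xi_0}\mu\rangle=0=\langle\partial_{\eta_0}x,\partial_{\eta_0}\mu\rangle$. -/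

import Mathlib

open scoped ContDiff Matrix

noncomputable section

/-- The space of symplectic coordinates `(x₁, x₂, φ¹, φ²)`: the index `Sum.inl i` is `xᵢ`, the index
`Sum.inr i` is the angle `φⁱ`. -/
abbrev SymplSpace : Type := Fin 2 ⊕ Fin 2 → ℝ

/-- Differential 2-forms in these coordinates. -/
abbrev TwoForm : Type := SymplSpace → SymplSpace [⋀^Fin 2]→L[ℝ] ℝ

/-- The coordinate vector `∂/∂zᵃ`. -/
def coordVec {ι : Type} [DecidableEq ι] (a : ι) : ι → ℝ := Pi.single a 1

/-- The partial derivative `∂f/∂zᵃ`. -/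
def pderiv {ι : Type} [Fintype ι] [DecidableEq ι] (a : ι) (f : (ι → ℝ) → ℝ) (z : ι → ℝ) : ℝ :=
  fderiv ℝ f z (coordVec a)

/-- The orbit-space projection `(x, φ) ↦ x`. -/
def momentMap (p : SymplSpace) : Fin 2 → ℝ := fun i => p (Sum.inl i)

/-- The translation of the angles by `t`, that is, the torus action. -/
def torusTranslate (t : Fin 2 → ℝ) (p : SymplSpace) : SymplSpace := p + Sum.elim (fun _ => 0) t

/-- The coordinate 1-form `dxᵢ`. -/
def dx (i : Fin 2) : SymplSpace →L[ℝ] ℝ := ContinuousLinearMap.proj (Sum.inl i)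

/-- The coordinate 1-form `dφⁱ`. -/
def dphi (i : Fin 2) : SymplSpace →L[ℝ] ℝ := ContinuousLinearMap.proj (Sum.inr i)

/-- The 1-form `kᵢ dφⁱ` with constant coefficients. -/
def dangle (k : Fin 2 → ℝ) : SymplSpace →L[ℝ] ℝ := ∑ i, k i • dphi i

/-- The torus generator `mᵢ = ∂/∂φⁱ`. -/
def torusField (i : Fin 2) : SymplSpace := coordVec (Sum.inr i)

/-- `α ∧ β = α ⊗ β - β ⊗ α` for covectors. -/
def wedge (α β : SymplSpace →L[ℝ] ℝ) : SymplSpace [⋀^Fin 2]→L[ℝ] ℝ :=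
  ContinuousMultilinearMap.alternatization
    ((ContinuousMultilinearMap.mkPiAlgebra ℝ (Fin 2) ℝ).compContinuousLinearMap ![α, β])

theorem wedge_apply (α β : SymplSpace →L[ℝ] ℝ) (v w : SymplSpace) :
    wedge α β ![v, w] = α v * β w - α w * β v := by
  have hu : (Finset.univ : Finset (Equiv.Perm (Fin 2))) = {1, Equiv.swap 0 1} := by decide
  have hne : (1 : Equiv.Perm (Fin 2)) ≠ Equiv.swap 0 1 := by decide
  rw [wedge, ContinuousMultilinearMap.alternatization_apply_apply, hu, Finset.sum_pair hne]
  simp [Fin.prod_univ_two]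
  ring

/-- The exterior derivative of a 1-form. -/
def dOneForm (θ : SymplSpace → SymplSpace →L[ℝ] ℝ) : TwoForm :=
  extDeriv fun p => ContinuousAlternatingMap.ofSubsingleton ℝ SymplSpace ℝ (0 : Fin 1) (θ p)

/-- The components `Ψ_{ab}` of a 2-form. -/
def formComp (Ψ : TwoForm) (a b : Fin 2 ⊕ Fin 2) (p : SymplSpace) : ℝ := Ψ p ![coordVec a, coordVec b]

/-- The value of the 4-form `2 (α ∧ β ∧ Ψ)` on four vectors. -/
def wedgeFour (α β : SymplSpace → ℝ) (Ψ : SymplSpace [⋀^Fin 2]→L[ℝ] ℝ) (v : Fin 4 → SymplSpace) :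
    ℝ :=
  ∑ s : Equiv.Perm (Fin 4), ((Equiv.Perm.sign s : ℤ) : ℝ) *
    (α (v (s 0)) * β (v (s 1)) * Ψ ![v (s 2), v (s 3)])

/-! Hamiltonian 2-forms on a Kähler surface given by the components `h_{ab}` of its metric and its
Kähler form `J` in coordinates on `B`. -/

section Hamiltonian

/-- The field of matrices `(h_{ab})` of a metric. -/
abbrev MetricField : Type := SymplSpace → Matrix (Fin 2 ⊕ Fin 2) (Fin 2 ⊕ Fin 2) ℝ

/-- The Christoffel symbol `Γᶜ_{ab}` of the Levi-Civita connection. -/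
def christoffel (h : MetricField) (c a b : Fin 2 ⊕ Fin 2) (p : SymplSpace) : ℝ :=
  (1 / 2) * ∑ d, (h p)⁻¹ c d *
    (pderiv a (fun q => h q b d) p + pderiv b (fun q => h q a d) p - pderiv d (fun q => h q a b) p)

/-- The component `∇ₐΨ_{bc}` of the covariant derivative of a 2-form. -/
def covDeriv (h : MetricField) (Ψ : TwoForm) (a b c : Fin 2 ⊕ Fin 2) (p : SymplSpace) : ℝ :=
  pderiv a (formComp Ψ b c) p - ∑ d, christoffel h d a b p * formComp Ψ d c p
    - ∑ d, christoffel h d a c p * formComp Ψ b d p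

/-- `J_c^d = J_{ce} h^{ed}`. -/
def raiseSecond (h : MetricField) (J : TwoForm) (c d : Fin 2 ⊕ Fin 2) (p : SymplSpace) : ℝ :=
  ∑ e, formComp J c e p * (h p)⁻¹ e d

/-- The complex structure `I^a_b = h^{ac} J_{cb}` acting on tangent vectors. -/
def complexStructure (h : MetricField) (J : TwoForm) (p : SymplSpace) (v : SymplSpace) :
    SymplSpace :=
  fun a => ∑ b, (∑ c, (h p)⁻¹ a c * formComp J c b p) * v b

/-- `σ = (1/4) Ψ_{ab} J^{ab}`. -/
def formTrace (h : MetricField) (J Ψ : TwoForm) (p : SymplSpace) : ℝ :=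
  (1 / 4) * ∑ a, ∑ b, formComp Ψ a b p * ∑ c, ∑ d, (h p)⁻¹ a c * (h p)⁻¹ b d * formComp J c d p

/-- Closed, `J`-invariant 2-forms on `B` with
`∇ₐΨ_{bc} = (2/3) (∂ₐσ J_{bc} - J_{a[b}∂_{c]}σ - h_{a[b}J_{c]}^d ∂_dσ)`, where the brackets denote
antisymmetrisation with weight one half. -/
structure IsHamiltonianTwoForm (B : Set SymplSpace) (h : MetricField) (J Ψ : TwoForm) : Prop where
  smooth : ContDiffOn ℝ ∞ Ψ B
  closed : ∀ p ∈ B, extDeriv Ψ p = 0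
  invariant : ∀ p ∈ B, ∀ v w : SymplSpace,
    Ψ p ![complexStructure h J p v, complexStructure h J p w] = Ψ p ![v, w]
  equation : ∀ p ∈ B, ∀ a b c : Fin 2 ⊕ Fin 2,
    covDeriv h Ψ a b c p = (2 / 3) *
      (pderiv a (formTrace h J Ψ) p * formComp J b c p
        - (1 / 2) * (formComp J a b p * pderiv c (formTrace h J Ψ) p
            - formComp J a c p * pderiv b (formTrace h J Ψ) p)
        - (1 / 2) * (h p a b * (∑ d, raiseSecond h J c d p * pderiv d (formTrace h J Ψ) p)
            - h p a c * (∑ d, raiseSecond h J b d p * pderiv d (formTrace h J Ψ) p)))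

end Hamiltonian

/-- The Hessian `Gⁱʲ = ∂ⁱ∂ʲg`, where `∂ⁱ = ∂/∂xᵢ`. -/
def hessianMatrix (g : (Fin 2 → ℝ) → ℝ) (x : Fin 2 → ℝ) : Matrix (Fin 2) (Fin 2) ℝ :=
  Matrix.of fun i j => pderiv i (pderiv j g) x

/-- A toric Kähler surface in symplectic coordinates: a connected domain `U` of the moment maps
`x₁, x₂` and a symplectic potential `g` on it, with positive definite Hessian. -/
structure ToricKahlerSurface where
  U : Set (Fin 2 → ℝ)
  isOpen : IsOpen U
  connected : IsConnected U
  g : (Fin 2 → ℝ) → ℝ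
  smooth : ContDiffOn ℝ ∞ g U
  posDef : ∀ x ∈ U, (hessianMatrix g x).PosDef

/-- `⟨α, β⟩ = ε_{ij} αⁱ βʲ`. -/
def bracket (α β : Fin 2 → ℝ) : ℝ := α 0 * β 1 - α 1 * β 0

/-- The Jacobian determinant `∂(u, v)/∂(x₁, x₂)`. -/
def jacobian (u v : (Fin 2 → ℝ) → ℝ) (x : Fin 2 → ℝ) : ℝ :=
  pderiv 0 u x * pderiv 1 v x - pderiv 1 u x * pderiv 0 v x

/-- `∂f/∂ξ` in the coordinate system `(ξ, η)`. -/
def partialXi (ξ η f : (Fin 2 → ℝ) → ℝ) (x : Fin 2 → ℝ) : ℝ := jacobian f η x / jacobian ξ η x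

/-- `∂f/∂η` in the coordinate system `(ξ, η)`. -/
def partialEta (ξ η f : (Fin 2 → ℝ) → ℝ) (x : Fin 2 → ℝ) : ℝ := jacobian ξ f x / jacobian ξ η x

/-- The moment map `xᵢ` as a function. -/
def momentCoord (i : Fin 2) (x : Fin 2 → ℝ) : ℝ := x i

/-- The three classes of separable toric Kähler surfaces: product-toric, Calabi-toric and
ortho-toric. -/
inductive SepClass where
  | PT
  | CT
  | OT

/-- The constants in `xᵢ = cᵢ + aᵢ ξ + ãᵢ (ξ + η) + bᵢ ξ η`. -/
structure SepConstants where
  c : Fin 2 → ℝ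
  a : Fin 2 → ℝ
  a' : Fin 2 → ℝ
  b : Fin 2 → ℝ

/-- The canonical choice of constants for each class. -/
def SepConstants.IsCanonical (C : SepConstants) : SepClass → Prop
  | .PT => C.b = 0 ∧ bracket C.a C.a' ≠ 0
  | .CT => C.a' = 0 ∧ bracket C.a C.b ≠ 0
  | .OT => C.a = 0 ∧ bracket C.a' C.b ≠ 0

/-- `dψ` for the angle `ψ` adapted to the class. -/
def SepConstants.dpsi (C : SepConstants) : SepClass → SymplSpace →L[ℝ] ℝ
  | .PT => dangle (C.a + C.a')
  | .CT => dangle C.a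
  | .OT => dangle C.a'

/-- `dφ` for the angle `φ` adapted to the class. -/
def SepConstants.dvarphi (C : SepConstants) : SepClass → SymplSpace →L[ℝ] ℝ
  | .PT => dangle C.a'
  | .CT => dangle C.b
  | .OT => dangle C.b

/-- The 1-form whose exterior derivative is `Ψ_*`; `s`, `t` are the values of `ξ`, `η`. -/
def SepConstants.primitive (C : SepConstants) (s t : ℝ) : SepClass → SymplSpace →L[ℝ] ℝ
  | .PT => s • C.dpsi .PT - t • C.dvarphi .PT
  | .CT => s ^ 2 • (C.dpsi .CT + t • C.dvarphi .CT)
  | .OT => (s ^ 3 / (s - t)) • (C.dpsi .OT + t • C.dvarphi .OT)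
      - (t ^ 3 / (s - t)) • (C.dpsi .OT + s • C.dvarphi .OT)

/-- The 2-form `Ψ_*` of each class. -/
def psiStar (k : SepClass) (C : SepConstants) (ξ η : (Fin 2 → ℝ) → ℝ) : TwoForm :=
  dOneForm fun p => C.primitive (ξ (momentMap p)) (η (momentMap p)) k

/-- The Kähler form `J = dxᵢ ∧ dφⁱ`. -/
def kahlerForm : TwoForm := fun _ => ∑ i, wedge (dx i) (dphi i)

namespace ToricKahlerSurface

variable (T : ToricKahlerSurface)

/-- The surface `U × ℝ²`, on which the torus acts by translations of the angles; torus-invariant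
tensors on `U × (ℝ/2πℤ)²` are the same as translation-invariant ones here. -/
def carrier : Set SymplSpace := {p | momentMap p ∈ T.U}

/-- The metric `h = Gⁱʲ dxᵢ dxⱼ + G_{ij} dφⁱ dφʲ`. -/
def metric : MetricField := fun p =>
  Matrix.fromBlocks (hessianMatrix T.g (momentMap p)) 0 0 (hessianMatrix T.g (momentMap p))⁻¹

/-- Orthogonal coordinates: torus-invariant functions `ξ, η` on `U` with `dξ · dη = 0` and
independent differentials; on differentials of invariant functions the inner product is given by
`G_{ij}`, the inverse of the Hessian. -/
structure IsOrthogonal (ξ η : (Fin 2 → ℝ) → ℝ) : Prop where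
  smooth_xi : ContDiffOn ℝ ∞ ξ T.U
  smooth_eta : ContDiffOn ℝ ∞ η T.U
  orthogonal : ∀ x ∈ T.U, ∑ i, ∑ j, (hessianMatrix T.g x)⁻¹ i j * pderiv i ξ x * pderiv j η x = 0
  independent : ∀ x ∈ T.U, jacobian ξ η x ≠ 0

/-- The surface is separable with respect to the orthogonal coordinates `ξ, η`: the moment maps
satisfy `∂²xᵢ/∂ξ² = 0 = ∂²xᵢ/∂η²`. -/
structure IsSeparable (ξ η : (Fin 2 → ℝ) → ℝ) : Prop extends T.IsOrthogonal ξ η where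
  xi_xi : ∀ x ∈ T.U, ∀ i, partialXi ξ η (partialXi ξ η (momentCoord i)) x = 0
  eta_eta : ∀ x ∈ T.U, ∀ i, partialEta ξ η (partialEta ξ η (momentCoord i)) x = 0

/-- Toric closed 2-forms: closed, torus-invariant, with `m₁♭ ∧ m₂♭ ∧ Ψ = 0`. -/
structure IsToricClosed (Ψ : TwoForm) : Prop where
  smooth : ContDiffOn ℝ ∞ Ψ T.carrier
  closed : ∀ p ∈ T.carrier, extDeriv Ψ p = 0
  invariant : ∀ p ∈ T.carrier, ∀ t, Ψ (torusTranslate t p) = Ψ p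
  orthogonal : ∀ p ∈ T.carrier, ∀ v : Fin 4 → SymplSpace,
    wedgeFour (fun w => torusField 0 ⬝ᵥ (T.metric p *ᵥ w)) (fun w => torusField 1 ⬝ᵥ (T.metric p *ᵥ w))
      (Ψ p) v = 0

/-- `μ₁, μ₂` are (torus-invariant) moment maps of `Ψ`: `ι_{mᵢ} Ψ = -dμᵢ`. -/
structure IsMomentMap (Ψ : TwoForm) (μ : Fin 2 → (Fin 2 → ℝ) → ℝ) : Prop where
  smooth : ∀ i, ContDiffOn ℝ ∞ (μ i) T.U
  contract : ∀ p ∈ T.carrier, ∀ i, ∀ v : SymplSpace,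
    Ψ p ![torusField i, v] = -fderiv ℝ (fun q => μ i (momentMap q)) p v

/-- A toric closed 2-form that is separable with respect to the coordinates `ξ, η`: its moment maps
satisfy `⟨∂_ξ x, ∂_ξ μ⟩ = 0 = ⟨∂_η x, ∂_η μ⟩`. -/
structure IsSeparableTwoForm (ξ η : (Fin 2 → ℝ) → ℝ) (Ψ : TwoForm) : Prop
    extends T.IsToricClosed Ψ where
  exists_moment : ∃ μ : Fin 2 → (Fin 2 → ℝ) → ℝ, T.IsMomentMap Ψ μ ∧
    (∀ x ∈ T.U, bracket (fun i => partialXi ξ η (momentCoord i) x)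
      (fun i => partialXi ξ η (μ i) x) = 0) ∧
    (∀ x ∈ T.U, bracket (fun i => partialEta ξ η (momentCoord i) x)
      (fun i => partialEta ξ η (μ i) x) = 0)

/-- Hamiltonian 2-forms on the surface. -/
def IsHamiltonian (Ψ : TwoForm) : Prop :=
  IsHamiltonianTwoForm T.carrier T.metric kahlerForm Ψ

/-- `(ξ', η')` arises from `(ξ, η)` by affine changes of each coordinate and possibly exchanging
the two. -/
def IsAffineChange (ξ η ξ' η' : (Fin 2 → ℝ) → ℝ) : Prop :=
  ∃ K L C D : ℝ, K ≠ 0 ∧ L ≠ 0 ∧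
    ((∀ x ∈ T.U, ξ' x = K * ξ x + C ∧ η' x = L * η x + D) ∨
      (∀ x ∈ T.U, ξ' x = K * η x + C ∧ η' x = L * ξ x + D))

/-- The coordinates `(ξ, η)` are canonical of class `k` with constants `C`. -/
structure IsCanonical (k : SepClass) (C : SepConstants) (ξ η : (Fin 2 → ℝ) → ℝ) : Prop where
  moment : ∀ x ∈ T.U, ∀ i,
    x i = C.c i + C.a i * ξ x + C.a' i * (ξ x + η x) + C.b i * ξ x * η x
  constants : C.IsCanonical k

end ToricKahlerSurface

end

/-! Integrating `∂_ξ² xᵢ = ∂_η² xᵢ = 0` gives bilinear moment maps `x = c + r ξ + s η + b ξ η`.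
Hence `P = ∂_ξ x = r + b η` and `Q = ∂_η x = s + b ξ` form a frame dual to `X = dξ`, `Y = dη`, and
every tensor is read in this frame. Orthogonality makes the Hessian diagonal, `H = u X X + v Y Y`.
Differentiating `H(P, Q) = 0` determines the mixed third derivatives of the potential from `b = b₁ P
+ b₂ Q`, leaving only the pure components `t₁`, `t₂` free.

A torus-invariant closed form with `m₁♭ ∧ m₂♭ ∧ Ψ = 0` and invariant moment maps is `dμₖ ∧ dφᵏ`, and
separability says `dμ = α X ⊗ P + β Y ⊗ Q`. In the Hamiltonian equation `t₁`, `t₂` cancel, and what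
remains is equivalent to `dα = (α - β)(2 b₂ dξ - b₁ dη)`, `dβ = (α - β)(b₂ dξ - 2 b₁ dη)`. The mixed
components of the equation already force this system (`IsSeparableJet.eigenvalues_of_mixed`);
conversely the system implies all components (`IsBilinear.isHamiltonian_toricForm`).

The difference of eigenvalues satisfies `d(α - β) = (α - β)(b₂ dξ + b₁ dη)`, so its ratio to that of
a solution with distinct eigenvalues is a constant `δ`; since `dα` depends only on the difference,
`α - δ α'` is then a constant `γ` (`EigenvalueSystem.exists_affine`). The constant pair `α = β = 1`
belongs to `J`. It remains to exhibit one solution with distinct eigenvalues: `(1, -1)`, `(2ξ, ξ)`,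
`(2ξ + η, ξ + 2η)` in the classes PT, CT, OT, which are the eigenvalues of `Ψ_*`. Their differences
`2`, `ξ`, `ξ - η` vanish nowhere because `P`, `Q` stay independent. -/

noncomputable section

/-! ### Pointwise algebra of the Hamiltonian equation in a dual frame. -/

/-- A frame `P, Q` of the plane with dual frame `X, Y`. -/
structure IsDualFrame (X Y P Q : Fin 2 → ℝ) : Prop where
  xp : ∑ i, X i * P i = 1
  xq : ∑ i, X i * Q i = 0
  yp : ∑ i, Y i * P i = 0
  yq : ∑ i, Y i * Q i = 1
  delta : ∀ i j, X i * P j + Y i * Q j = if i = j then 1 else 0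

/-- The pointwise data of a separable toric Kähler surface and of a separable 2-form with
eigenvalues `α, β`: `H, G, T` are the Hessian, its inverse and the third derivatives of the
potential, `M` and `dM` the components of the 2-form and their derivatives. -/
structure IsSeparableJet (X Y P Q b : Fin 2 → ℝ) (u v t₁ t₂ b₁ b₂ α β αx αy βx βy : ℝ)
    (H G M : Fin 2 → Fin 2 → ℝ) (T dM : Fin 2 → Fin 2 → Fin 2 → ℝ) : Prop
    extends IsDualFrame X Y P Q where
  u_ne : u ≠ 0
  v_ne : v ≠ 0
  b_eq : ∀ i, b i = b₁ * P i + b₂ * Q i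
  H_eq : ∀ i j, H i j = u * X i * X j + v * Y i * Y j
  G_eq : ∀ i j, G i j = P i * P j / u + Q i * Q j / v
  T_eq : ∀ i j k, T i j k = t₁ * X i * X j * X k + t₂ * Y i * Y j * Y k
     - b₁ * u * (X i * X j * Y k + X i * Y j * X k + Y i * X j * X k)
     - b₂ * v * (X i * Y j * Y k + Y i * Y j * X k + Y i * X j * Y k)
  M_eq : ∀ j k, M j k = α * X j * P k + β * Y j * Q k
  dM_eq : ∀ i j k, dM i j k = (αx * X i + αy * Y i) * X j * P k
    - α * b₁ * (X i * Y j + X j * Y i) * P k + α * X j * Y i * b k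
    + (βx * X i + βy * Y i) * Y j * Q k - β * b₂ * (X i * Y j + X j * Y i) * Q k
    + β * Y j * X i * b k

namespace IsSeparableJet

variable {X Y P Q b : Fin 2 → ℝ} {u v t₁ t₂ b₁ b₂ α β αx αy βx βy : ℝ}
    {H G M : Fin 2 → Fin 2 → ℝ} {T dM : Fin 2 → Fin 2 → Fin 2 → ℝ}

/-- Since `tr M = α + β`, the terms containing `b` must cancel in the contraction. -/
theorem trace_dM (h : IsSeparableJet X Y P Q b u v t₁ t₂ b₁ b₂ α β αx αy βx βy H G M T dM)
    (i : Fin 2) : ∑ l, dM i l l = (αx + βx) * X i + (αy + βy) * Y i := by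
  have h1 := h.xp
  have h2 := h.xq
  have h3 := h.yp
  have h4 := h.yq
  simp only [Fin.sum_univ_two, h.dM_eq, h.b_eq] at h1 h2 h3 h4 ⊢
  linear_combination (αx * X i + αy * Y i - α * b₁ * Y i + α * b₁ * Y i) * h1 +
    (βx * X i + βy * Y i - β * b₂ * X i + β * b₂ * X i) * h4 +
    (- α * b₁ * X i + β * b₁ * X i) * h3 + (-β * b₂ * Y i + α * b₂ * Y i) * h2

theorem sum_P_T (h : IsSeparableJet X Y P Q b u v t₁ t₂ b₁ b₂ α β αx αy βx βy H G M T dM)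
    (i j : Fin 2) : ∑ m, P m * T i j m =
      t₁ * X i * X j - b₁ * u * (X i * Y j + Y i * X j) - b₂ * v * Y i * Y j := by
  have h1 := h.xp
  have h3 := h.yp
  simp only [Fin.sum_univ_two, h.T_eq] at h1 h3 ⊢
  linear_combination (t₁ * X i * X j - b₁ * u * (X i * Y j + Y i * X j) - b₂ * v * Y i * Y j) * h1 +
    (t₂ * Y i * Y j - b₁ * u * X i * X j - b₂ * v * (X i * Y j + Y i * X j)) * h3

theorem sum_Q_T (h : IsSeparableJet X Y P Q b u v t₁ t₂ b₁ b₂ α β αx αy βx βy H G M T dM)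
    (i j : Fin 2) : ∑ m, Q m * T i j m =
      t₂ * Y i * Y j - b₁ * u * X i * X j - b₂ * v * (X i * Y j + Y i * X j) := by
  have h1 := h.xq
  have h3 := h.yq
  simp only [Fin.sum_univ_two, h.T_eq] at h1 h3 ⊢
  linear_combination (t₁ * X i * X j - b₁ * u * (X i * Y j + Y i * X j) - b₂ * v * Y i * Y j) * h1 +
    (t₂ * Y i * Y j - b₁ * u * X i * X j - b₂ * v * (X i * Y j + Y i * X j)) * h3

theorem sum_G_T (h : IsSeparableJet X Y P Q b u v t₁ t₂ b₁ b₂ α β αx αy βx βy H G M T dM)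
    (i j l : Fin 2) : ∑ m, G l m * T i j m =
      P l / u * (t₁ * X i * X j - b₁ * u * (X i * Y j + Y i * X j) - b₂ * v * Y i * Y j) +
      Q l / v * (t₂ * Y i * Y j - b₁ * u * X i * X j - b₂ * v * (X i * Y j + Y i * X j)) := by
  rw [← h.sum_P_T, ← h.sum_Q_T]
  simp only [Fin.sum_univ_two, h.G_eq]
  ring

theorem sum_P_M (h : IsSeparableJet X Y P Q b u v t₁ t₂ b₁ b₂ α β αx αy βx βy H G M T dM)
    (k : Fin 2) : ∑ l, P l * M l k = α * P k := by
  have h1 := h.xp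
  have h3 := h.yp
  simp only [Fin.sum_univ_two, h.M_eq] at h1 h3 ⊢
  linear_combination α * P k * h1 + β * Q k * h3

theorem sum_Q_M (h : IsSeparableJet X Y P Q b u v t₁ t₂ b₁ b₂ α β αx αy βx βy H G M T dM)
    (k : Fin 2) : ∑ l, Q l * M l k = β * Q k := by
  have h1 := h.xq
  have h3 := h.yq
  simp only [Fin.sum_univ_two, h.M_eq] at h1 h3 ⊢
  linear_combination α * P k * h1 + β * Q k * h3

theorem sum_M_X (h : IsSeparableJet X Y P Q b u v t₁ t₂ b₁ b₂ α β αx αy βx βy H G M T dM)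
    (j : Fin 2) : ∑ l, M j l * X l = α * X j := by
  have h1 := h.xp
  have h3 := h.xq
  simp only [Fin.sum_univ_two, h.M_eq] at h1 h3 ⊢
  linear_combination α * X j * h1 + β * Y j * h3

theorem sum_M_Y (h : IsSeparableJet X Y P Q b u v t₁ t₂ b₁ b₂ α β αx αy βx βy H G M T dM)
    (j : Fin 2) : ∑ l, M j l * Y l = β * Y j := by
  have h1 := h.yp
  have h3 := h.yq
  simp only [Fin.sum_univ_two, h.M_eq] at h1 h3 ⊢
  linear_combination α * X j * h1 + β * Y j * h3

/-- The connection term `G T M`. -/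
theorem sum_GT_M (h : IsSeparableJet X Y P Q b u v t₁ t₂ b₁ b₂ α β αx αy βx βy H G M T dM)
    (i j k : Fin 2) : ∑ l, (∑ m, G l m * T i j m) * M l k =
      α * P k / u * (t₁ * X i * X j - b₁ * u * (X i * Y j + Y i * X j) - b₂ * v * Y i * Y j) +
      β * Q k / v * (t₂ * Y i * Y j - b₁ * u * X i * X j - b₂ * v * (X i * Y j + Y i * X j)) := by
  have h1 := h.sum_P_M k
  have h2 := h.sum_Q_M k
  simp only [h.sum_G_T]
  simp only [Fin.sum_univ_two] at h1 h2 ⊢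
  linear_combination
    (t₁ * X i * X j - b₁ * u * (X i * Y j + Y i * X j) - b₂ * v * Y i * Y j) / u * h1 +
    (t₂ * Y i * Y j - b₁ * u * X i * X j - b₂ * v * (X i * Y j + Y i * X j)) / v * h2

/-- The connection term `M T G`. -/
theorem sum_M_GT (h : IsSeparableJet X Y P Q b u v t₁ t₂ b₁ b₂ α β αx αy βx βy H G M T dM)
    (i j k : Fin 2) : ∑ l, M j l * ∑ m, G k m * T i l m =
      P k / u * (t₁ * X i * (α * X j) - b₁ * u * (X i * (β * Y j) + Y i * (α * X j))
        - b₂ * v * Y i * (β * Y j)) +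
      Q k / v * (t₂ * Y i * (β * Y j) - b₁ * u * X i * (α * X j)
        - b₂ * v * (X i * (β * Y j) + Y i * (α * X j))) := by
  simp only [h.sum_G_T, ← h.sum_M_X, ← h.sum_M_Y]
  simp only [Fin.sum_univ_two]
  ring

theorem sum_G_X (h : IsSeparableJet X Y P Q b u v t₁ t₂ b₁ b₂ α β αx αy βx βy H G M T dM)
    (k : Fin 2) : ∑ m, G k m * X m = P k / u := by
  have h1 := h.xp
  have h2 := h.xq
  simp only [Fin.sum_univ_two, h.G_eq] at h1 h2 ⊢
  linear_combination P k / u * h1 + Q k / v * h2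

theorem sum_G_Y (h : IsSeparableJet X Y P Q b u v t₁ t₂ b₁ b₂ α β αx αy βx βy H G M T dM)
    (k : Fin 2) : ∑ m, G k m * Y m = Q k / v := by
  have h1 := h.yp
  have h2 := h.yq
  simp only [Fin.sum_univ_two, h.G_eq] at h1 h2 ⊢
  linear_combination P k / u * h1 + Q k / v * h2

theorem sum_G_trace (h : IsSeparableJet X Y P Q b u v t₁ t₂ b₁ b₂ α β αx αy βx βy H G M T dM)
    (k : Fin 2) : ∑ m, G k m * ∑ l, dM m l l = (αx + βx) * P k / u + (αy + βy) * Q k / v := by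
  have h1 := h.sum_G_X k
  have h2 := h.sum_G_Y k
  simp only [h.trace_dM]
  simp only [Fin.sum_univ_two] at h1 h2 ⊢
  linear_combination (αx + βx) * h1 + (αy + βy) * h2

/-- The mixed component of the Hamiltonian equation, for the derivative along an orbit-space
direction. -/
theorem mixed_sub (h : IsSeparableJet X Y P Q b u v t₁ t₂ b₁ b₂ α β αx αy βx βy H G M T dM)
    (i j k : Fin 2) :
    dM i j k - 1 / 2 * ∑ l, (∑ m, G l m * T i j m) * M l k
      + 1 / 2 * ∑ l, M j l * ∑ m, G k m * T i l m
      - 1 / 3 * ((∑ l, dM i l l) * (if j = k then 1 else 0)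
        + 1 / 2 * (if i = k then 1 else 0) * (∑ l, dM j l l)
        + 1 / 2 * H i j * ∑ m, G k m * ∑ l, dM m l l) =
    (αx - 2 / 3 * (αx + βx)) * X i * X j * P k + (βy - 2 / 3 * (αy + βy)) * Y i * Y j * Q k
      + (αy - 1 / 3 * (αy + βy)) * Y i * X j * P k + (βx - 1 / 3 * (αx + βx)) * X i * Y j * Q k
      + (1 / 2 * (β - α) * b₁ - 1 / 6 * (αy + βy)) * (X i * Y j * P k + u / v * X i * X j * Q k)
      + (1 / 2 * (α - β) * b₂ - 1 / 6 * (αx + βx)) * (Y i * X j * Q k + v / u * Y i * Y j * P k) := by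
  -- `t₁` and `t₂` enter both connection terms with the same eigenvalue factor and cancel; only
  -- multiples of `(α - β) b₁` and `(α - β) b₂` survive.
  rw [h.sum_GT_M, h.sum_M_GT, h.sum_G_trace, h.trace_dM, h.trace_dM, h.dM_eq, h.H_eq, h.b_eq,
    ← h.delta, ← h.delta]
  have hu := h.u_ne
  have hv := h.v_ne
  field_simp
  ring

/-- The component of the Hamiltonian equation along one angular direction and two orbit-space
directions. -/
theorem angular_base_base
    (h : IsSeparableJet X Y P Q b u v t₁ t₂ b₁ b₂ α β αx αy βx βy H G M T dM)
    (hx : αx + βx = 3 * (α - β) * b₂) (hy : αy + βy = 3 * (β - α) * b₁) (i j k : Fin 2) :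
    - (1 / 2 * ∑ l, M k l * ∑ m, G i m * T j l m) + 1 / 2 * ∑ l, M j l * ∑ m, G i m * T k l m =
      1 / 6 * ((if j = i then 1 else 0) * (∑ l, dM k l l)
        - (if k = i then 1 else 0) * (∑ l, dM j l l)) := by
  rw [h.sum_M_GT, h.sum_M_GT, h.trace_dM, h.trace_dM, ← h.delta, ← h.delta, hx, hy]
  have hu := h.u_ne
  have hv := h.v_ne
  field_simp
  ring

theorem sum_GG_T (h : IsSeparableJet X Y P Q b u v t₁ t₂ b₁ b₂ α β αx αy βx βy H G M T dM)
    (a c i : Fin 2) : ∑ e, G a e * ∑ f, G c f * T i e f =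
      P c / u * (t₁ * X i * (P a / u) - b₁ * u * (X i * (Q a / v) + Y i * (P a / u))
        - b₂ * v * Y i * (Q a / v)) +
      Q c / v * (t₂ * Y i * (Q a / v) - b₁ * u * X i * (P a / u)
        - b₂ * v * (X i * (Q a / v) + Y i * (P a / u))) := by
  simp only [h.sum_G_T, ← h.sum_G_X a, ← h.sum_G_Y a]
  simp only [Fin.sum_univ_two]
  ring

theorem sum_GGG_T (h : IsSeparableJet X Y P Q b u v t₁ t₂ b₁ b₂ α β αx αy βx βy H G M T dM)
    (a c l : Fin 2) : ∑ d, G l d * ∑ e, G a e * ∑ f, G c f * T d e f =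
      P l / u * (P c / u * (t₁ * (P a / u) - b₁ * u * (Q a / v)) +
        Q c / v * (- b₁ * u * (P a / u) - b₂ * v * (Q a / v))) +
      Q l / v * (P c / u * (- b₁ * u * (P a / u) - b₂ * v * (Q a / v)) +
        Q c / v * (t₂ * (Q a / v) - b₂ * v * (P a / u))) := by
  rw [← h.sum_G_X l, ← h.sum_G_Y l]
  simp only [h.sum_GG_T]
  simp only [Fin.sum_univ_two]
  ring

/-- The angular component of the Hamiltonian equation. -/
theorem angular (h : IsSeparableJet X Y P Q b u v t₁ t₂ b₁ b₂ α β αx αy βx βy H G M T dM)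
    (hx : αx + βx = 3 * (α - β) * b₂) (hy : αy + βy = 3 * (β - α) * b₁) (i j k : Fin 2) :
    - (1 / 2 * ∑ l, (∑ d, G l d * ∑ e, G i e * ∑ f, G j f * T d e f) * M l k)
      + 1 / 2 * ∑ l, (∑ d, G l d * ∑ e, G i e * ∑ f, G k f * T d e f) * M l j =
      1 / 6 * (G i j * (∑ m, G k m * ∑ l, dM m l l) - G i k * ∑ m, G j m * ∑ l, dM m l l) := by
  have h1 := h.sum_P_M k
  have h2 := h.sum_Q_M k
  have h3 := h.sum_P_M j
  have h4 := h.sum_Q_M j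
  simp only [h.sum_GGG_T, h.sum_G_trace, hx, hy]
  rw [h.G_eq, h.G_eq]
  simp only [Fin.sum_univ_two] at h1 h2 h3 h4 ⊢
  -- `c1 j` and `c2 j` are the coefficients of `P / u` and `Q / v` in the fully raised third
  -- derivative; contraction with `M` multiplies them by `α` and `β`.
  set c1 : Fin 2 → ℝ := fun j => P j / u * (t₁ * (P i / u) - b₁ * u * (Q i / v)) +
        Q j / v * (- b₁ * u * (P i / u) - b₂ * v * (Q i / v)) with hc1
  set c2 : Fin 2 → ℝ := fun j => P j / u * (- b₁ * u * (P i / u) - b₂ * v * (Q i / v)) +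
        Q j / v * (t₂ * (Q i / v) - b₂ * v * (P i / u)) with hc2
  have key : - (1 / 2 * (c1 j / u * (α * P k) + c2 j / v * (β * Q k)))
      + 1 / 2 * (c1 k / u * (α * P j) + c2 k / v * (β * Q j)) =
      1 / 6 * ((P i * P j / u + Q i * Q j / v) *
          (3 * (α - β) * b₂ * P k / u + 3 * (β - α) * b₁ * Q k / v) -
        (P i * P k / u + Q i * Q k / v) *
          (3 * (α - β) * b₂ * P j / u + 3 * (β - α) * b₁ * Q j / v)) := by
    have hu := h.u_ne
    have hv := h.v_ne
    simp only [hc1, hc2]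
    field_simp
    ring
  rw [← key, ← h1, ← h2, ← h3, ← h4]
  simp only [hc1, hc2]
  ring

/-- The 2-form is invariant under the complex structure. -/
theorem sum_G_M_H (h : IsSeparableJet X Y P Q b u v t₁ t₂ b₁ b₂ α β αx αy βx βy H G M T dM)
    (a c : Fin 2) : ∑ j, ∑ k, G j a * M j k * H k c = M c a := by
  have h1 := h.sum_P_M
  have h2 := h.sum_Q_M
  have x1 := h.xp
  have x2 := h.xq
  have x3 := h.yp
  have x4 := h.yq
  have hPH : ∑ k, P k * H k c = u * X c := by
    simp only [Fin.sum_univ_two, h.H_eq] at x1 x3 ⊢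
    linear_combination u * X c * x1 + v * Y c * x3
  have hQH : ∑ k, Q k * H k c = v * Y c := by
    simp only [Fin.sum_univ_two, h.H_eq] at x2 x4 ⊢
    linear_combination u * X c * x2 + v * Y c * x4
  have hGM : ∀ k, ∑ j, G j a * M j k = P a / u * (α * P k) + Q a / v * (β * Q k) := by
    intro k
    rw [← h1, ← h2]
    simp only [Fin.sum_univ_two, h.G_eq]
    ring
  rw [Finset.sum_comm]
  simp only [← Finset.sum_mul, hGM]
  rw [h.M_eq]
  simp only [Fin.sum_univ_two] at hPH hQH ⊢
  have hu := h.u_ne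
  have hv := h.v_ne
  have e1 : P a / u * α * (u * X c) = α * X c * P a := by field_simp
  have e2 : Q a / v * β * (v * Y c) = β * Y c * Q a := by field_simp
  rw [← e1, ← e2, ← hPH, ← hQH]
  ring

/-- The four equations annihilate each of the six coefficients in `mixed_sub`. The other components
of the equation, in `angular_base_base` and `angular`, need only their consequences for `d(α + β)`.
-/
theorem mixed (h : IsSeparableJet X Y P Q b u v t₁ t₂ b₁ b₂ α β αx αy βx βy H G M T dM)
    (h1 : αx = 2 * (α - β) * b₂) (h2 : βx = (α - β) * b₂)
    (h3 : αy = (β - α) * b₁) (h4 : βy = 2 * (β - α) * b₁) (i j k : Fin 2) :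
    dM i j k - 1 / 2 * ∑ l, (∑ m, G l m * T i j m) * M l k
      + 1 / 2 * ∑ l, M j l * ∑ m, G k m * T i l m =
      1 / 3 * ((∑ l, dM i l l) * (if j = k then 1 else 0)
        + 1 / 2 * (if i = k then 1 else 0) * (∑ l, dM j l l)
        + 1 / 2 * H i j * ∑ m, G k m * ∑ l, dM m l l) := by
  have := h.mixed_sub i j k
  subst h1 h2 h3 h4
  rw [← sub_eq_zero, this]
  ring

end IsSeparableJet

namespace IsDualFrame

variable {X Y P Q : Fin 2 → ℝ}

theorem eq_zero_of_dual (h : IsDualFrame X Y P Q) {A B : ℝ} (hAB : ∀ i, A * X i + B * Y i = 0) :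
    A = 0 ∧ B = 0 := by
  have h1 := h.xp
  have h2 := h.xq
  have h3 := h.yp
  have h4 := h.yq
  simp only [Fin.sum_univ_two] at h1 h2 h3 h4
  constructor
  · linear_combination P 0 * hAB 0 + P 1 * hAB 1 - A * h1 - B * h3
  · linear_combination Q 0 * hAB 0 + Q 1 * hAB 1 - A * h2 - B * h4

theorem eq_zero_of_frame (h : IsDualFrame X Y P Q) {A B : ℝ} (hAB : ∀ i, A * P i + B * Q i = 0) :
    A = 0 ∧ B = 0 := by
  have h1 := h.xp
  have h2 := h.xq
  have h3 := h.yp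
  have h4 := h.yq
  simp only [Fin.sum_univ_two] at h1 h2 h3 h4
  constructor
  · linear_combination X 0 * hAB 0 + X 1 * hAB 1 - A * h1 - B * h2
  · linear_combination Y 0 * hAB 0 + Y 1 * hAB 1 - A * h3 - B * h4

end IsDualFrame

namespace IsSeparableJet

variable {X Y P Q b : Fin 2 → ℝ} {u v t₁ t₂ b₁ b₂ α β αx αy βx βy : ℝ}
    {H G M : Fin 2 → Fin 2 → ℝ} {T dM : Fin 2 → Fin 2 → Fin 2 → ℝ}

/-- Tensor products of frame vectors and covectors are independent, so the coefficients in
`mixed_sub` vanish. Peeling off the indices `k`, `j`, `i` in turn isolates them. -/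
theorem eigenvalues_of_mixed
    (h : IsSeparableJet X Y P Q b u v t₁ t₂ b₁ b₂ α β αx αy βx βy H G M T dM)
    (hm : ∀ i j k, dM i j k - 1 / 2 * ∑ l, (∑ m, G l m * T i j m) * M l k
      + 1 / 2 * ∑ l, M j l * ∑ m, G k m * T i l m =
      1 / 3 * ((∑ l, dM i l l) * (if j = k then 1 else 0)
        + 1 / 2 * (if i = k then 1 else 0) * (∑ l, dM j l l)
        + 1 / 2 * H i j * ∑ m, G k m * ∑ l, dM m l l)) :
    αx = 2 * (α - β) * b₂ ∧ βx = (α - β) * b₂ ∧ αy = (β - α) * b₁ ∧ βy = 2 * (β - α) * b₁ := by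
  have e : ∀ i j k, _ := fun i j k => (h.mixed_sub i j k).symm.trans (sub_eq_zero.2 (hm i j k))
  have hf := h.toIsDualFrame
  have e1 := fun i j => hf.eq_zero_of_frame (fun k => show
    ((αx - 2 / 3 * (αx + βx)) * X i * X j + (αy - 1 / 3 * (αy + βy)) * Y i * X j
      + (1 / 2 * (β - α) * b₁ - 1 / 6 * (αy + βy)) * (X i * Y j)
      + (1 / 2 * (α - β) * b₂ - 1 / 6 * (αx + βx)) * (v / u * Y i * Y j)) * P k
    + ((βy - 2 / 3 * (αy + βy)) * Y i * Y j + (βx - 1 / 3 * (αx + βx)) * X i * Y j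
      + (1 / 2 * (β - α) * b₁ - 1 / 6 * (αy + βy)) * (u / v * X i * X j)
      + (1 / 2 * (α - β) * b₂ - 1 / 6 * (αx + βx)) * (Y i * X j)) * Q k = 0 by
      rw [← e i j k]; ring)
  have e2 := fun i => hf.eq_zero_of_dual (fun j => show
    ((αx - 2 / 3 * (αx + βx)) * X i + (αy - 1 / 3 * (αy + βy)) * Y i) * X j
      + ((1 / 2 * (β - α) * b₁ - 1 / 6 * (αy + βy)) * X i
      + (1 / 2 * (α - β) * b₂ - 1 / 6 * (αx + βx)) * (v / u) * Y i) * Y j = 0 by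
      rw [← (e1 i j).1]; ring)
  have e3 := fun i => hf.eq_zero_of_dual (fun j => show
    ((1 / 2 * (β - α) * b₁ - 1 / 6 * (αy + βy)) * (u / v) * X i
      + (1 / 2 * (α - β) * b₂ - 1 / 6 * (αx + βx)) * Y i) * X j
      + ((βx - 1 / 3 * (αx + βx)) * X i + (βy - 2 / 3 * (αy + βy)) * Y i) * Y j = 0 by
      rw [← (e1 i j).2]; ring)
  have f1 := hf.eq_zero_of_dual fun i => (e2 i).1
  have f2 := hf.eq_zero_of_dual fun i => (e2 i).2
  have f3 := hf.eq_zero_of_dual fun i => (e3 i).1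
  have f4 := hf.eq_zero_of_dual fun i => (e3 i).2
  -- `f1` gives `αx = 2 βx` and `βy = 2 αy`; `f3.2` and `f2.1` give the sums `αx + βx = 3 (α - β)
  -- b₂` and `αy + βy = 3 (β - α) b₁`.
  refine ⟨?_, ?_, ?_, ?_⟩
  · linarith [f1.1, f3.2]
  · linarith [f1.1, f3.2]
  · linarith [f1.2, f2.1]
  · linarith [f1.2, f2.1]

end IsSeparableJet

/-! Partial derivatives. -/

section Calculus

theorem ContDiffOn.diffAt {ι : Type} [Fintype ι] {f : (ι → ℝ) → ℝ} {x : ι → ℝ}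
    {U : Set (ι → ℝ)} (hU : IsOpen U) (hf : ContDiffOn ℝ ∞ f U) (hx : x ∈ U) :
    DifferentiableAt ℝ f x :=
  (hf.contDiffAt (hU.mem_nhds hx)).differentiableAt (by simp)

variable {ι : Type} [Fintype ι] [DecidableEq ι] {f g : (ι → ℝ) → ℝ} {x : ι → ℝ} {U : Set (ι → ℝ)}

theorem pderiv_add (i : ι) (hf : DifferentiableAt ℝ f x) (hg : DifferentiableAt ℝ g x) :
    pderiv i (fun y => f y + g y) x = pderiv i f x + pderiv i g x := by
  simp [pderiv, fderiv_fun_add hf hg]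

theorem pderiv_sub (i : ι) (hf : DifferentiableAt ℝ f x) (hg : DifferentiableAt ℝ g x) :
    pderiv i (fun y => f y - g y) x = pderiv i f x - pderiv i g x := by
  simp [pderiv, fderiv_fun_sub hf hg]

theorem pderiv_mul (i : ι) (hf : DifferentiableAt ℝ f x) (hg : DifferentiableAt ℝ g x) :
    pderiv i (fun y => f y * g y) x = pderiv i f x * g x + f x * pderiv i g x := by
  simp [pderiv, fderiv_fun_mul hf hg]
  ring

theorem pderiv_neg (i : ι) : pderiv i (fun y => - f y) x = - pderiv i f x := by
  simp [pderiv]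

theorem pderiv_const (i : ι) (c : ℝ) : pderiv i (fun _ => c) x = 0 := by
  simp [pderiv]

theorem pderiv_const_mul (i : ι) (c : ℝ) (hf : DifferentiableAt ℝ f x) :
    pderiv i (fun y => c * f y) x = c * pderiv i f x := by
  simp [pderiv, fderiv_const_mul hf]

theorem pderiv_coord (i j : ι) : pderiv i (fun y : ι → ℝ => y j) x = if i = j then 1 else 0 := by
  have : HasFDerivAt (fun y : ι → ℝ => y j) (ContinuousLinearMap.proj (R := ℝ) j) x :=
    (ContinuousLinearMap.proj (R := ℝ) (φ := fun _ : ι => ℝ) j).hasFDerivAt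
  simp [pderiv, this.fderiv, coordVec, Pi.single_apply, eq_comm]

theorem pderiv_sum {κ : Type} (s : Finset κ) (i : ι) {F : κ → (ι → ℝ) → ℝ}
    (hF : ∀ k ∈ s, DifferentiableAt ℝ (F k) x) :
    pderiv i (fun y => ∑ k ∈ s, F k y) x = ∑ k ∈ s, pderiv i (F k) x := by
  simp [pderiv, fderiv_fun_sum hF]

theorem pderiv_congr (hU : IsOpen U) (hx : x ∈ U) (h : ∀ y ∈ U, f y = g y) (i : ι) :
    pderiv i f x = pderiv i g x := by
  rw [pderiv, pderiv, Filter.EventuallyEq.fderiv_eq (Filter.eventually_of_mem (hU.mem_nhds hx) h)]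

theorem fderiv_eq_sum_pderiv (v : ι → ℝ) : fderiv ℝ f x v = ∑ i, v i * pderiv i f x := by
  conv_lhs => rw [pi_eq_sum_univ' v, map_sum]
  simp only [map_smul, smul_eq_mul, pderiv, coordVec, Pi.single]

theorem ContDiffOn.pderiv (hU : IsOpen U) (hf : ContDiffOn ℝ ∞ f U) (i : ι) :
    ContDiffOn ℝ ∞ (_root_.pderiv i f) U :=
  (hf.fderiv_of_isOpen hU (by simp)).clm_apply contDiffOn_const

theorem pderiv_comm (hU : IsOpen U) (hf : ContDiffOn ℝ ∞ f U) (hx : x ∈ U) (i j : ι) :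
    pderiv i (pderiv j f) x = pderiv j (pderiv i f) x := by
  have hd : DifferentiableAt ℝ (fderiv ℝ f) x :=
    ((hf.fderiv_of_isOpen hU (m := ∞) (by simp)).contDiffAt (hU.mem_nhds hx)).differentiableAt
      (by simp)
  have key : ∀ a b, pderiv a (pderiv b f) x = fderiv ℝ (fderiv ℝ f) x (coordVec a) (coordVec b) := by
    intro a b
    have : HasFDerivAt (pderiv b f) ((fderiv ℝ (fderiv ℝ f) x).flip (coordVec b)) x := by
      have h := hd.hasFDerivAt.clm_apply (hasFDerivAt_const (coordVec b) x)
      simp only [ContinuousLinearMap.comp_zero, zero_add] at h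
      exact h
    rw [pderiv, this.fderiv]
    rfl
  rw [key, key]
  exact ((hf.contDiffAt (hU.mem_nhds hx)).isSymmSndFDerivAt (by
    rw [minSmoothness_of_isRCLikeNormedField]; exact WithTop.coe_le_coe.2 le_top)) _ _

theorem exists_eq_of_pderiv_eq_zero (hU : IsOpen U) (hc : IsConnected U)
    (hf : ContDiffOn ℝ ∞ f U) (h : ∀ y ∈ U, ∀ i, _root_.pderiv i f y = 0) :
    ∃ c, ∀ y ∈ U, f y = c := by
  obtain ⟨c, hc⟩ := hU.exists_is_const_of_fderiv_eq_zero (𝕜 := ℝ) hc.isPreconnected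
    (hf.differentiableOn (by simp)) (fun y hy => by
      ext v
      simp [fderiv_eq_sum_pderiv, h y hy])
  exact ⟨c, fun y hy => hc y hy⟩

end Calculus

/-! Functions and forms on the torus bundle. -/

/-- The orbit-space projection as a linear map. -/
def momentMapCLM : SymplSpace →L[ℝ] (Fin 2 → ℝ) :=
  ContinuousLinearMap.pi fun i => ContinuousLinearMap.proj (Sum.inl i)

theorem contDiff_momentMap {n : WithTop ℕ∞} : ContDiff ℝ n momentMap := momentMapCLM.contDiff

theorem continuous_momentMap : Continuous momentMap := momentMapCLM.continuous

theorem momentMap_coordVec_inl (i : Fin 2) : momentMap (coordVec (Sum.inl i)) = coordVec i := by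
  ext j
  simp [momentMap, coordVec, Pi.single_apply]

theorem momentMap_coordVec_inr (i : Fin 2) : momentMap (coordVec (Sum.inr i)) = 0 := by
  ext j
  simp [momentMap, coordVec]

theorem momentMap_torusTranslate (t : Fin 2 → ℝ) (p : SymplSpace) :
    momentMap (torusTranslate t p) = momentMap p := by
  ext i
  simp [momentMap, torusTranslate]

section Pullback

variable {f : (Fin 2 → ℝ) → ℝ} {p : SymplSpace}

theorem fderiv_comp_momentMap (hf : DifferentiableAt ℝ f (momentMap p)) (v : SymplSpace) :
    fderiv ℝ (fun q => f (momentMap q)) p v = fderiv ℝ f (momentMap p) (momentMap v) := by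
  have : HasFDerivAt (fun q => f (momentMap q)) ((fderiv ℝ f (momentMap p)).comp momentMapCLM) p :=
    HasFDerivAt.comp p (f := momentMap) hf.hasFDerivAt momentMapCLM.hasFDerivAt
  rw [this.fderiv]
  rfl

theorem pderiv_comp_momentMap_inl (hf : DifferentiableAt ℝ f (momentMap p)) (i : Fin 2) :
    pderiv (Sum.inl i) (fun q => f (momentMap q)) p = pderiv i f (momentMap p) := by
  rw [pderiv, fderiv_comp_momentMap hf, momentMap_coordVec_inl, pderiv]

theorem pderiv_comp_momentMap_inr (hf : DifferentiableAt ℝ f (momentMap p)) (i : Fin 2) :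
    pderiv (Sum.inr i) (fun q => f (momentMap q)) p = 0 := by
  rw [pderiv, fderiv_comp_momentMap hf, momentMap_coordVec_inr, map_zero]

end Pullback

theorem twoForm_ext {φ ψ : SymplSpace [⋀^Fin 2]→L[ℝ] ℝ}
    (h : ∀ a b, φ ![coordVec a, coordVec b] = ψ ![coordVec a, coordVec b]) : φ = ψ := by
  apply ContinuousAlternatingMap.toAlternatingMap_injective
  refine (Pi.basisFun ℝ (Fin 2 ⊕ Fin 2)).ext_alternating fun v _ => ?_
  have : (fun i => (Pi.basisFun ℝ (Fin 2 ⊕ Fin 2)) (v i)) = ![coordVec (v 0), coordVec (v 1)] := by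
    ext i
    fin_cases i <;> simp [coordVec]
  rw [this]
  exact h _ _

theorem twoForm_swap (φ : SymplSpace [⋀^Fin 2]→L[ℝ] ℝ) (v w : SymplSpace) :
    φ ![v, w] = - φ ![w, v] := by
  have := φ.toAlternatingMap.map_swap ![w, v] (i := 0) (j := 1) (by decide)
  rw [← ContinuousAlternatingMap.coe_toAlternatingMap, ← this]
  congr 1
  ext i
  fin_cases i <;> rfl

theorem twoForm_self (φ : SymplSpace [⋀^Fin 2]→L[ℝ] ℝ) (v : SymplSpace) : φ ![v, v] = 0 := by
  linarith [twoForm_swap φ v v]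

/-- The invariant 2-form `dμₖ ∧ dφᵏ`. -/
def toricForm (μ : Fin 2 → (Fin 2 → ℝ) → ℝ) : TwoForm := fun p =>
  ∑ j, ∑ k, pderiv j (μ k) (momentMap p) • wedge (dx j) (dphi k)

section ToricForm

variable (μ : Fin 2 → (Fin 2 → ℝ) → ℝ) (p : SymplSpace)

theorem toricForm_apply (v w : SymplSpace) : toricForm μ p ![v, w] =
    ∑ j, ∑ k, pderiv j (μ k) (momentMap p) *
      (v (Sum.inl j) * w (Sum.inr k) - w (Sum.inl j) * v (Sum.inr k)) := by
  simp only [toricForm, ContinuousAlternatingMap.sum_apply, ContinuousAlternatingMap.smul_apply,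
    wedge_apply, smul_eq_mul]
  refine Finset.sum_congr rfl fun j _ => Finset.sum_congr rfl fun k _ => ?_
  simp [dx, dphi]

theorem formComp_toricForm_inl_inl (j k : Fin 2) :
    formComp (toricForm μ) (Sum.inl j) (Sum.inl k) p = 0 := by
  simp [formComp, toricForm_apply, coordVec]

theorem formComp_toricForm_inr_inr (j k : Fin 2) :
    formComp (toricForm μ) (Sum.inr j) (Sum.inr k) p = 0 := by
  simp [formComp, toricForm_apply, coordVec]

theorem formComp_toricForm_inl_inr (j k : Fin 2) :
    formComp (toricForm μ) (Sum.inl j) (Sum.inr k) p = pderiv j (μ k) (momentMap p) := by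
  simp [formComp, toricForm_apply, coordVec, Pi.single_apply]

theorem formComp_toricForm_inr_inl (j k : Fin 2) :
    formComp (toricForm μ) (Sum.inr k) (Sum.inl j) p = - pderiv j (μ k) (momentMap p) := by
  simp [formComp, toricForm_apply, coordVec, Pi.single_apply]

end ToricForm

/-- The usual formula for `dθ(v, w)`; there is no bracket term because `v`, `w` are constant vector
fields. -/
theorem dOneForm_apply {θ : SymplSpace → SymplSpace →L[ℝ] ℝ} {p : SymplSpace}
    (hθ : DifferentiableAt ℝ θ p) (v w : SymplSpace) :
    dOneForm θ p ![v, w] = fderiv ℝ (fun q => θ q w) p v - fderiv ℝ (fun q => θ q v) p w := by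
  have hd : DifferentiableAt ℝ (fun p => ContinuousAlternatingMap.ofSubsingleton ℝ SymplSpace ℝ
      (0 : Fin 1) (θ p)) p :=
    (ContinuousAlternatingMap.ofSubsingletonLIE (𝕜 := ℝ) (E := SymplSpace) (F := ℝ)
      (0 : Fin 1)).differentiable.differentiableAt.comp p hθ
  rw [dOneForm, extDeriv_apply hd]
  simp [Fin.sum_univ_two, Fin.removeNth, sub_eq_add_neg]

/-- Exchanging the last two slots is an odd permutation, so both terms of `γ ∧ δ` contribute the
same determinant; hence the factor 2. -/
theorem wedgeFour_wedge (α β : SymplSpace → ℝ) (γ δ : SymplSpace →L[ℝ] ℝ)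
    (v : Fin 4 → SymplSpace) : wedgeFour α β (wedge γ δ) v =
      2 * (Matrix.of fun a i => ![α (v a), β (v a), γ (v a), δ (v a)] i).det := by
  have hu : (Matrix.of fun a i => ![α (v a), β (v a), γ (v a), δ (v a)] i).det =
      ∑ s : Equiv.Perm (Fin 4), ((Equiv.Perm.sign s : ℤ) : ℝ) *
        (α (v (s 0)) * β (v (s 1)) * γ (v (s 2)) * δ (v (s 3))) := by
    rw [Matrix.det_apply']
    simp [Fin.prod_univ_four]
  have hs : (∑ s : Equiv.Perm (Fin 4), ((Equiv.Perm.sign s : ℤ) : ℝ) *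
        (α (v (s 0)) * β (v (s 1)) * γ (v (s 3)) * δ (v (s 2)))) =
      - ∑ s : Equiv.Perm (Fin 4), ((Equiv.Perm.sign s : ℤ) : ℝ) *
        (α (v (s 0)) * β (v (s 1)) * γ (v (s 2)) * δ (v (s 3))) := by
    rw [← Finset.sum_neg_distrib]
    refine Fintype.sum_equiv (Equiv.mulRight (Equiv.swap 2 3)) _ _ fun s => ?_
    have e0 : (Equiv.swap 2 3 : Equiv.Perm (Fin 4)) 0 = 0 := by decide
    have e1 : (Equiv.swap 2 3 : Equiv.Perm (Fin 4)) 1 = 1 := by decide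
    have e2 : (Equiv.swap 2 3 : Equiv.Perm (Fin 4)) 2 = 3 := by decide
    have e3 : (Equiv.swap 2 3 : Equiv.Perm (Fin 4)) 3 = 2 := by decide
    have e4 : Equiv.Perm.sign (Equiv.swap 2 3 : Equiv.Perm (Fin 4)) = -1 := by decide
    simp [e0, e1, e2, e3, e4]
  rw [hu, two_mul]
  nth_rewrite 2 [← neg_neg (∑ s : Equiv.Perm (Fin 4), _)]
  rw [← hs, ← sub_eq_add_neg, ← Finset.sum_sub_distrib]
  refine Finset.sum_congr rfl fun s _ => ?_
  rw [wedge_apply]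
  ring

theorem wedgeFour_sum {κ : Type} (s : Finset κ) (α β : SymplSpace → ℝ) (c : κ → ℝ)
    (Ψ : κ → SymplSpace [⋀^Fin 2]→L[ℝ] ℝ) (v : Fin 4 → SymplSpace) :
    wedgeFour α β (∑ k ∈ s, c k • Ψ k) v = ∑ k ∈ s, c k * wedgeFour α β (Ψ k) v := by
  simp only [wedgeFour, ContinuousAlternatingMap.sum_apply, ContinuousAlternatingMap.smul_apply,
    Finset.mul_sum, smul_eq_mul]
  rw [Finset.sum_comm]
  refine Finset.sum_congr rfl fun _ _ => Finset.sum_congr rfl fun _ _ => ?_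
  ring

/-- Two torus-orthogonal covectors detect the orbit-space component of a 2-form. -/
theorem wedgeFour_coord (α β : SymplSpace → ℝ) (Ψ : SymplSpace [⋀^Fin 2]→L[ℝ] ℝ)
    (hα : ∀ i, α (coordVec (Sum.inl i)) = 0) (hβ : ∀ i, β (coordVec (Sum.inl i)) = 0) :
    wedgeFour α β Ψ ![coordVec (Sum.inr 0), coordVec (Sum.inr 1), coordVec (Sum.inl 0),
      coordVec (Sum.inl 1)] = 2 * ((α (coordVec (Sum.inr 0)) * β (coordVec (Sum.inr 1)) -
        α (coordVec (Sum.inr 1)) * β (coordVec (Sum.inr 0))) *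
          Ψ ![coordVec (Sum.inl 0), coordVec (Sum.inl 1)]) := by
  -- `S` consists of the permutations preserving `{0, 1}` and `{2, 3}`. Any other one feeds an
  -- orbit-space vector to `α` or `β`, which kills it.
  set S : Finset (Equiv.Perm (Fin 4)) :=
    {1, Equiv.swap 0 1, Equiv.swap 2 3, Equiv.swap 0 1 * Equiv.swap 2 3} with hS
  have hout : ∀ s : Equiv.Perm (Fin 4), s ∉ S → (s 0 = 2 ∨ s 0 = 3) ∨ (s 1 = 2 ∨ s 1 = 3) := by
    decide
  rw [wedgeFour, ← Finset.sum_subset (Finset.subset_univ S)]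
  · have n1 : (1 : Equiv.Perm (Fin 4)) ∉ ({Equiv.swap 0 1, Equiv.swap 2 3,
      Equiv.swap 0 1 * Equiv.swap 2 3} : Finset (Equiv.Perm (Fin 4))) := by decide
    have n2 : (Equiv.swap 0 1 : Equiv.Perm (Fin 4)) ∉ ({Equiv.swap 2 3,
      Equiv.swap 0 1 * Equiv.swap 2 3} : Finset (Equiv.Perm (Fin 4))) := by decide
    have n3 : (Equiv.swap 2 3 : Equiv.Perm (Fin 4)) ∉ ({
      Equiv.swap 0 1 * Equiv.swap 2 3} : Finset (Equiv.Perm (Fin 4))) := by decide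
    rw [hS, Finset.sum_insert n1, Finset.sum_insert n2, Finset.sum_insert n3, Finset.sum_singleton]
    have e0 : (Equiv.swap 2 3 : Equiv.Perm (Fin 4)) 0 = 0 := by decide
    have e1 : (Equiv.swap 2 3 : Equiv.Perm (Fin 4)) 1 = 1 := by decide
    have e2 : (Equiv.swap 2 3 : Equiv.Perm (Fin 4)) 2 = 3 := by decide
    have e3 : (Equiv.swap 2 3 : Equiv.Perm (Fin 4)) 3 = 2 := by decide
    have f0 : (Equiv.swap 0 1 : Equiv.Perm (Fin 4)) 0 = 1 := by decide
    have f1 : (Equiv.swap 0 1 : Equiv.Perm (Fin 4)) 1 = 0 := by decide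
    have f2 : (Equiv.swap 0 1 : Equiv.Perm (Fin 4)) 2 = 2 := by decide
    have f3 : (Equiv.swap 0 1 : Equiv.Perm (Fin 4)) 3 = 3 := by decide
    have e4 : Equiv.Perm.sign (Equiv.swap 2 3 : Equiv.Perm (Fin 4)) = -1 := by decide
    have f4 : Equiv.Perm.sign (Equiv.swap 0 1 : Equiv.Perm (Fin 4)) = -1 := by decide
    simp only [Equiv.Perm.mul_apply, e0, e1, e2, e3, e4, f0, f1, f2, f3, f4, Equiv.Perm.sign_mul,
      Equiv.Perm.one_apply, map_one]
    have hsw := twoForm_swap Ψ (coordVec (Sum.inl 1)) (coordVec (Sum.inl 0))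
    simp [hsw]
    ring
  · intro s _ hs
    rcases hout s hs with (h | h) | (h | h) <;> simp [h, hα, hβ]

/-! ### Toric closed 2-forms and their moment maps. -/

namespace ToricKahlerSurface

variable (T : ToricKahlerSurface)

theorem isOpen_carrier : IsOpen T.carrier := T.isOpen.preimage continuous_momentMap

theorem torusField_dotProduct (i : Fin 2) (p w : SymplSpace) :
    torusField i ⬝ᵥ (T.metric p *ᵥ w) =
      ∑ j, (hessianMatrix T.g (momentMap p))⁻¹ i j * w (Sum.inr j) := by
  fin_cases i <;> simp [torusField, coordVec, metric, Matrix.mulVec, dotProduct]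

theorem det_hessian_pos {x : Fin 2 → ℝ} (hx : x ∈ T.U) : 0 < (hessianMatrix T.g x).det :=
  (T.posDef x hx).det_pos

theorem isUnit_det_hessian {x : Fin 2 → ℝ} (hx : x ∈ T.U) : IsUnit (hessianMatrix T.g x).det :=
  (T.det_hessian_pos hx).ne'.isUnit

variable {T}

/-- A toric closed 2-form is determined by its moment maps. -/
theorem IsToricClosed.eq_toricForm {Ψ : TwoForm} (hΨ : T.IsToricClosed Ψ)
    {μ : Fin 2 → (Fin 2 → ℝ) → ℝ} (hμ : T.IsMomentMap Ψ μ) {p : SymplSpace} (hp : p ∈ T.carrier) :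
    Ψ p = toricForm μ p := by
  have hc : ∀ k b, Ψ p ![coordVec (Sum.inr k), coordVec b] =
      toricForm μ p ![coordVec (Sum.inr k), coordVec b] := by
    intro k b
    have hd : DifferentiableAt ℝ (μ k) (momentMap p) := (hμ.smooth k).diffAt T.isOpen hp
    rw [show coordVec (Sum.inr k) = torusField k from rfl, hμ.contract p hp k,
      fderiv_comp_momentMap hd]
    rcases b with b | b
    · rw [momentMap_coordVec_inl]
      exact (formComp_toricForm_inr_inl μ p b k).symm
    · rw [momentMap_coordVec_inr, map_zero, neg_zero]
      exact (formComp_toricForm_inr_inr μ p k b).symm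
  -- Moment maps control every component with an angular slot. For the remaining one, `m₁♭ ∧ m₂♭ =
  -- det G dφ¹ ∧ dφ²` with `det G ≠ 0`, so orthogonality forces it to vanish.
  have h01 : Ψ p ![coordVec (Sum.inl 0), coordVec (Sum.inl 1)] = 0 := by
    have h := hΨ.orthogonal p hp ![coordVec (Sum.inr 0), coordVec (Sum.inr 1), coordVec (Sum.inl 0),
      coordVec (Sum.inl 1)]
    have hdet := T.det_hessian_pos hp
    rw [wedgeFour_coord] at h
    · simp only [torusField_dotProduct, Fin.sum_univ_two] at h
      have hG : (hessianMatrix T.g (momentMap p))⁻¹.det ≠ 0 := by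
        rw [Matrix.det_nonsing_inv, Ring.inverse_eq_inv']
        exact inv_ne_zero hdet.ne'
      rw [Matrix.det_fin_two] at hG
      simp [coordVec] at h
      rcases h with h | h
      · exact absurd h hG
      · exact h
    · intro i
      simp only [torusField_dotProduct]
      simp [coordVec]
    · intro i
      simp only [torusField_dotProduct]
      simp [coordVec]
  refine twoForm_ext fun a b => ?_
  rcases a with a | a
  · rcases b with b | b
    · rw [show toricForm μ p ![coordVec (Sum.inl a), coordVec (Sum.inl b)] = 0 from
        formComp_toricForm_inl_inl μ p a b]
      fin_cases a <;> fin_cases b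
      · exact twoForm_self _ _
      · exact h01
      · exact (twoForm_swap _ _ _).trans (by rw [neg_eq_zero]; exact h01)
      · exact twoForm_self _ _
    · rw [twoForm_swap, hc, ← twoForm_swap]
  · exact hc a b

/-- `m₁♭`, `m₂♭` and `dφᵏ` are three covectors in the plane spanned by `dφ¹`, `dφ²`, so the
determinant for each `dxⱼ ∧ dφᵏ` is zero. -/
theorem toricForm_orthogonal (T : ToricKahlerSurface) (μ : Fin 2 → (Fin 2 → ℝ) → ℝ)
    (p : SymplSpace) (v : Fin 4 → SymplSpace) :
    wedgeFour (fun w => torusField 0 ⬝ᵥ (T.metric p *ᵥ w))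
      (fun w => torusField 1 ⬝ᵥ (T.metric p *ᵥ w)) (toricForm μ p) v = 0 := by
  have h : ∀ j k, wedgeFour (fun w => torusField 0 ⬝ᵥ (T.metric p *ᵥ w))
      (fun w => torusField 1 ⬝ᵥ (T.metric p *ᵥ w)) (wedge (dx j) (dphi k)) v = 0 := by
    intro j k
    simp only [torusField_dotProduct]
    rw [wedgeFour_wedge]
    simp only [dphi, Fin.sum_univ_two]
    fin_cases k <;>
    · simp [Matrix.det_succ_row_zero, Fin.sum_univ_succ, Fin.succAbove, Matrix.submatrix]
      ring
  have := wedgeFour_sum Finset.univ (fun w => torusField 0 ⬝ᵥ (T.metric p *ᵥ w))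
      (fun w => torusField 1 ⬝ᵥ (T.metric p *ᵥ w))
      (fun jk : Fin 2 × Fin 2 => pderiv jk.1 (μ jk.2) (momentMap p))
      (fun jk => wedge (dx jk.1) (dphi jk.2)) v
  rw [toricForm, ← Fintype.sum_prod_type'
    (f := fun j k => pderiv j (μ k) (momentMap p) • wedge (dx j) (dphi k)), this]
  simp [h]

end ToricKahlerSurface

/-! ### Levi-Civita connection in symplectic coordinates. -/

/-- The third derivatives of the symplectic potential. -/
def thirdDeriv (g : (Fin 2 → ℝ) → ℝ) (x : Fin 2 → ℝ) (i j k : Fin 2) : ℝ :=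
  pderiv i (pderiv j (pderiv k g)) x

section InverseDeriv

variable {A : (Fin 2 → ℝ) → Matrix (Fin 2) (Fin 2) ℝ} {x : Fin 2 → ℝ}

theorem differentiableAt_inv_entry (hA : ∀ i j, DifferentiableAt ℝ (fun y => A y i j) x)
    (hdet : (A x).det ≠ 0) (i j : Fin 2) : DifferentiableAt ℝ (fun y => (A y)⁻¹ i j) x := by
  have hd : DifferentiableAt ℝ (fun y => (A y).det⁻¹) x := by
    refine DifferentiableAt.inv ?_ hdet
    simp only [Matrix.det_fin_two]
    exact ((hA 0 0).mul (hA 1 1)).sub ((hA 0 1).mul (hA 1 0))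
  simp only [Matrix.inv_def, Ring.inverse_eq_inv', Matrix.smul_apply, smul_eq_mul,
    Matrix.adjugate_fin_two]
  refine hd.mul ?_
  fin_cases i <;> fin_cases j <;> simp [hA]

theorem pderiv_inv_entry {U : Set (Fin 2 → ℝ)} (hU : IsOpen U) (hx : x ∈ U)
    (hA : ∀ i j, DifferentiableAt ℝ (fun y => A y i j) x) (hdet : ∀ y ∈ U, (A y).det ≠ 0)
    (k i j : Fin 2) : pderiv k (fun y => (A y)⁻¹ i j) x =
      - ((A x)⁻¹ * (Matrix.of fun a b => pderiv k (fun y => A y a b) x) * (A x)⁻¹) i j := by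
  have hB := differentiableAt_inv_entry hA (hdet x hx)
  set dA : Matrix (Fin 2) (Fin 2) ℝ := Matrix.of fun a b => pderiv k (fun y => A y a b) x with hdA
  set dB : Matrix (Fin 2) (Fin 2) ℝ := Matrix.of fun a b => pderiv k (fun y => (A y)⁻¹ a b) x with hdB
  have hz : dA * (A x)⁻¹ + A x * dB = 0 := by
    ext a b
    have h1 : pderiv k (fun y => ∑ l, A y a l * (A y)⁻¹ l b) x = 0 := by
      rw [pderiv_congr hU hx (g := fun _ => (1 : Matrix (Fin 2) (Fin 2) ℝ) a b), pderiv_const]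
      intro y hy
      rw [← Matrix.mul_apply, Matrix.mul_nonsing_inv _ (hdet y hy).isUnit]
    rw [pderiv_sum _ _ fun l _ => (hA a l).fun_mul (hB l b)] at h1
    simp only [pderiv_mul k (hA a _) (hB _ b), Finset.sum_add_distrib] at h1
    simpa [Matrix.mul_apply, hdA, hdB] using h1
  have : dB = - ((A x)⁻¹ * dA * (A x)⁻¹) := by
    have h2 := congrArg (fun B => (A x)⁻¹ * B) hz
    simp only [mul_add, mul_zero, ← Matrix.mul_assoc,
      Matrix.nonsing_inv_mul _ (hdet x hx).isUnit, one_mul] at h2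
    exact eq_neg_of_add_eq_zero_right h2
  exact congrFun (congrFun this i) j

end InverseDeriv

/-- The Kähler form is the toric form whose moment maps are the `xₖ`, so everything proved for
`toricForm` applies to it. -/
theorem kahlerForm_eq : kahlerForm = toricForm momentCoord := by
  funext p
  have : ∀ j k : Fin 2, pderiv j (momentCoord k) (momentMap p) = if j = k then 1 else 0 :=
    fun j k => pderiv_coord j k
  simp [kahlerForm, toricForm, this]

theorem pderiv_momentCoord (j k : Fin 2) (x : Fin 2 → ℝ) :
    pderiv j (momentCoord k) x = if j = k then 1 else 0 := pderiv_coord j k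

section KahlerComponents

variable (j k : Fin 2) (p : SymplSpace)

theorem formComp_kahlerForm_inl_inl : formComp kahlerForm (Sum.inl j) (Sum.inl k) p = 0 := by
  rw [kahlerForm_eq, formComp_toricForm_inl_inl]

theorem formComp_kahlerForm_inr_inr : formComp kahlerForm (Sum.inr j) (Sum.inr k) p = 0 := by
  rw [kahlerForm_eq, formComp_toricForm_inr_inr]

theorem formComp_kahlerForm_inl_inr :
    formComp kahlerForm (Sum.inl j) (Sum.inr k) p = if j = k then 1 else 0 := by
  rw [kahlerForm_eq, formComp_toricForm_inl_inr, pderiv_momentCoord]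

theorem formComp_kahlerForm_inr_inl :
    formComp kahlerForm (Sum.inr k) (Sum.inl j) p = if j = k then -1 else 0 := by
  rw [kahlerForm_eq, formComp_toricForm_inr_inl, pderiv_momentCoord]
  split_ifs <;> simp

end KahlerComponents

namespace ToricKahlerSurface

variable {T : ToricKahlerSurface} {x : Fin 2 → ℝ} {p : SymplSpace}

theorem contDiffOn_hessian (i j : Fin 2) :
    ContDiffOn ℝ ∞ (fun y => hessianMatrix T.g y i j) T.U :=
  (T.smooth.pderiv T.isOpen j).pderiv T.isOpen i

theorem differentiableAt_hessian (hx : x ∈ T.U) (i j : Fin 2) :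
    DifferentiableAt ℝ (fun y => hessianMatrix T.g y i j) x :=
  (contDiffOn_hessian i j).diffAt T.isOpen hx

theorem hessian_symm (hx : x ∈ T.U) (i j : Fin 2) :
    hessianMatrix T.g x i j = hessianMatrix T.g x j i :=
  pderiv_comm T.isOpen T.smooth hx i j

theorem inv_hessian_symm (hx : x ∈ T.U) (i j : Fin 2) :
    (hessianMatrix T.g x)⁻¹ i j = (hessianMatrix T.g x)⁻¹ j i := by
  have h : (hessianMatrix T.g x)ᵀ = hessianMatrix T.g x := by
    ext a b
    exact hessian_symm hx b a
  conv_lhs => rw [← h, ← Matrix.transpose_nonsing_inv]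
  rfl

theorem thirdDeriv_swap_right (hx : x ∈ T.U) (i j k : Fin 2) :
    thirdDeriv T.g x i j k = thirdDeriv T.g x i k j :=
  pderiv_congr T.isOpen hx (fun _ hy => pderiv_comm T.isOpen T.smooth hy j k) i

theorem thirdDeriv_swap_left (hx : x ∈ T.U) (i j k : Fin 2) :
    thirdDeriv T.g x i j k = thirdDeriv T.g x j i k :=
  pderiv_comm T.isOpen (T.smooth.pderiv T.isOpen k) hx i j

theorem pderiv_inv_hessian (hx : x ∈ T.U) (k i j : Fin 2) :
    pderiv k (fun y => (hessianMatrix T.g y)⁻¹ i j) x =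
      - ∑ e, (hessianMatrix T.g x)⁻¹ i e * ∑ f, (hessianMatrix T.g x)⁻¹ j f *
        thirdDeriv T.g x k e f := by
  rw [pderiv_inv_entry T.isOpen hx (differentiableAt_hessian hx)
    (fun y hy => (T.det_hessian_pos hy).ne'), Matrix.mul_assoc, Matrix.mul_apply]
  refine congrArg Neg.neg (Finset.sum_congr rfl fun e _ => ?_)
  rw [Matrix.mul_apply]
  refine congrArg _ (Finset.sum_congr rfl fun f _ => ?_)
  rw [inv_hessian_symm hx f j, mul_comm]
  rfl

theorem sum_hessian_inv (hx : x ∈ T.U) (i j : Fin 2) :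
    ∑ k, hessianMatrix T.g x i k * (hessianMatrix T.g x)⁻¹ k j = if i = j then 1 else 0 := by
  rw [← Matrix.mul_apply, Matrix.mul_nonsing_inv _ (T.isUnit_det_hessian hx), Matrix.one_apply]

theorem metric_inv (hp : p ∈ T.carrier) : (T.metric p)⁻¹ =
    Matrix.fromBlocks (hessianMatrix T.g (momentMap p))⁻¹ 0 0 (hessianMatrix T.g (momentMap p)) := by
  have hu := T.isUnit_det_hessian hp
  refine Matrix.inv_eq_right_inv ?_
  rw [metric, Matrix.fromBlocks_multiply]
  simp [Matrix.mul_nonsing_inv _ hu, Matrix.nonsing_inv_mul _ hu]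

theorem pderiv_metric_base (hp : p ∈ T.carrier) (k i j : Fin 2) :
    pderiv (Sum.inl k) (fun q => T.metric q (Sum.inl i) (Sum.inl j)) p =
      thirdDeriv T.g (momentMap p) k i j :=
  pderiv_comp_momentMap_inl (differentiableAt_hessian hp i j) k

theorem pderiv_metric_fibre (hp : p ∈ T.carrier) (k i j : Fin 2) :
    pderiv (Sum.inl k) (fun q => T.metric q (Sum.inr i) (Sum.inr j)) p =
      - ∑ e, (hessianMatrix T.g (momentMap p))⁻¹ i e * ∑ f, (hessianMatrix T.g (momentMap p))⁻¹ j f *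
        thirdDeriv T.g (momentMap p) k e f := by
  rw [← pderiv_inv_hessian hp]
  exact pderiv_comp_momentMap_inl (differentiableAt_inv_entry (differentiableAt_hessian hp)
    (T.det_hessian_pos hp).ne' i j) k

theorem pderiv_metric_angle (hp : p ∈ T.carrier) (k : Fin 2) (a b : Fin 2 ⊕ Fin 2) :
    pderiv (Sum.inr k) (fun q => T.metric q a b) p = 0 := by
  rcases a with a | a <;> rcases b with b | b
  · exact pderiv_comp_momentMap_inr (differentiableAt_hessian hp a b) k
  · exact pderiv_const _ 0
  · exact pderiv_const _ 0
  · exact pderiv_comp_momentMap_inr (differentiableAt_inv_entry (differentiableAt_hessian hp)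
      (T.det_hessian_pos hp).ne' a b) k

theorem pderiv_metric_mixed (k : Fin 2 ⊕ Fin 2) (i j : Fin 2) :
    pderiv k (fun q => T.metric q (Sum.inl i) (Sum.inr j)) p = 0 := pderiv_const _ 0

theorem pderiv_metric_mixed' (k : Fin 2 ⊕ Fin 2) (i j : Fin 2) :
    pderiv k (fun q => T.metric q (Sum.inr i) (Sum.inl j)) p = 0 := pderiv_const _ 0

section Christoffel

variable {c a b : Fin 2}

/-- Third derivatives are totally symmetric, so the three terms of the Christoffel symbol collapse
to one. -/
theorem christoffel_base_base_base (hp : p ∈ T.carrier) :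
    christoffel T.metric (Sum.inl c) (Sum.inl a) (Sum.inl b) p =
      1 / 2 * ∑ m, (hessianMatrix T.g (momentMap p))⁻¹ c m * thirdDeriv T.g (momentMap p) a b m := by
  rw [christoffel, metric_inv hp, Fintype.sum_sum_type]
  simp only [pderiv_metric_base hp, Matrix.fromBlocks_apply₁₁, Matrix.fromBlocks_apply₁₂,
    Matrix.zero_apply, zero_mul, Finset.sum_const_zero, add_zero]
  congr 1
  refine Finset.sum_congr rfl fun m _ => ?_
  rw [thirdDeriv_swap_left hp b a m, thirdDeriv_swap_left hp m a b, thirdDeriv_swap_right hp a m b]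
  ring

theorem christoffel_base_angle_angle (hp : p ∈ T.carrier) :
    christoffel T.metric (Sum.inl c) (Sum.inr a) (Sum.inr b) p =
      1 / 2 * ∑ d, (hessianMatrix T.g (momentMap p))⁻¹ c d *
        ∑ e, (hessianMatrix T.g (momentMap p))⁻¹ a e *
          ∑ f, (hessianMatrix T.g (momentMap p))⁻¹ b f * thirdDeriv T.g (momentMap p) d e f := by
  rw [christoffel, metric_inv hp, Fintype.sum_sum_type]
  simp [pderiv_metric_fibre hp, pderiv_metric_angle hp]

/-- The fibre metric is `G` with inverse `H` and derivative `-G T G`; one factor `G` cancels against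
`H`. -/
theorem christoffel_angle_base_angle (hp : p ∈ T.carrier) :
    christoffel T.metric (Sum.inr c) (Sum.inl a) (Sum.inr b) p =
      -(1 / 2) * ∑ m, (hessianMatrix T.g (momentMap p))⁻¹ b m * thirdDeriv T.g (momentMap p) a c m := by
  have h0 := sum_hessian_inv hp c 0
  have h1 := sum_hessian_inv hp c 1
  rw [christoffel, metric_inv hp, Fintype.sum_sum_type]
  simp only [pderiv_metric_fibre hp, pderiv_metric_angle hp, pderiv_metric_mixed,
    Matrix.fromBlocks_apply₂₁, Matrix.fromBlocks_apply₂₂, Matrix.zero_apply, zero_mul,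
    Finset.sum_const_zero, zero_add, add_zero, sub_zero]
  set H := hessianMatrix T.g (momentMap p)
  set G := H⁻¹
  set t := thirdDeriv T.g (momentMap p)
  -- Inserts `H G = 1` in front of the index `c`, which produces the factors of `G` present on the
  -- other side.
  have key : ∀ e, t a c e = (∑ k, H c k * G k 0) * t a e 0 + (∑ k, H c k * G k 1) * t a e 1 := by
    intro e
    rw [h0, h1, show t a c e = t a e c from thirdDeriv_swap_right hp a c e]
    fin_cases c <;> simp
  simp only [key]
  simp only [Fin.sum_univ_two]
  ring

theorem christoffel_angle_angle_base (hp : p ∈ T.carrier) :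
    christoffel T.metric (Sum.inr c) (Sum.inr a) (Sum.inl b) p =
      -(1 / 2) * ∑ m, (hessianMatrix T.g (momentMap p))⁻¹ a m * thirdDeriv T.g (momentMap p) b c m := by
  rw [← christoffel_angle_base_angle hp, christoffel, christoffel, metric_inv hp]
  simp [pderiv_metric_fibre hp, pderiv_metric_angle hp, pderiv_metric_mixed, pderiv_metric_mixed']

theorem christoffel_base_base_angle (hp : p ∈ T.carrier) :
    christoffel T.metric (Sum.inl c) (Sum.inl a) (Sum.inr b) p = 0 := by
  rw [christoffel, metric_inv hp]
  simp [pderiv_metric_angle hp, pderiv_metric_mixed, pderiv_metric_mixed']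

theorem christoffel_base_angle_base (hp : p ∈ T.carrier) :
    christoffel T.metric (Sum.inl c) (Sum.inr a) (Sum.inl b) p = 0 := by
  rw [christoffel, metric_inv hp]
  simp [pderiv_metric_angle hp, pderiv_metric_mixed']

theorem christoffel_angle_base_base (hp : p ∈ T.carrier) :
    christoffel T.metric (Sum.inr c) (Sum.inl a) (Sum.inl b) p = 0 := by
  rw [christoffel, metric_inv hp]
  simp [pderiv_metric_angle hp, pderiv_metric_mixed]

theorem christoffel_angle_angle_angle (hp : p ∈ T.carrier) :
    christoffel T.metric (Sum.inr c) (Sum.inr a) (Sum.inr b) p = 0 := by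
  rw [christoffel, metric_inv hp]
  simp [pderiv_metric_angle hp]

end Christoffel

end ToricKahlerSurface

/-! ### Components of the Hamiltonian equation for an invariant 2-form. -/

namespace ToricKahlerSurface

variable {T : ToricKahlerSurface} {x : Fin 2 → ℝ} {p : SymplSpace}

theorem raiseSecond_base_base (hp : p ∈ T.carrier) (c d : Fin 2) :
    raiseSecond T.metric kahlerForm (Sum.inl c) (Sum.inl d) p = 0 := by
  rw [raiseSecond, metric_inv hp]
  simp [formComp_kahlerForm_inl_inl]

theorem raiseSecond_angle_base (hp : p ∈ T.carrier) (c d : Fin 2) :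
    raiseSecond T.metric kahlerForm (Sum.inr c) (Sum.inl d) p =
      - (hessianMatrix T.g (momentMap p))⁻¹ c d := by
  rw [raiseSecond, metric_inv hp]
  simp [formComp_kahlerForm_inr_inl, formComp_kahlerForm_inr_inr]

/-- On a base-angle pair the two inverse metric factors are `G` and `H`, which cancel. Each pair is
counted in both orders, turning `1/4` into `1/2`. -/
theorem formTrace_toricForm (hp : p ∈ T.carrier) (μ : Fin 2 → (Fin 2 → ℝ) → ℝ) :
    formTrace T.metric kahlerForm (toricForm μ) p =
      1 / 2 * ∑ l, pderiv l (μ l) (momentMap p) := by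
  have h : ∀ i j, ∑ k, hessianMatrix T.g (momentMap p) i k * (hessianMatrix T.g (momentMap p))⁻¹ k j
    = _ := sum_hessian_inv hp
  have h00 := h 0 0
  have h01 := h 0 1
  have h10 := h 1 0
  have h11 := h 1 1
  rw [formTrace, metric_inv hp]
  simp only [Fintype.sum_sum_type, formComp_toricForm_inl_inl, formComp_toricForm_inr_inr,
    formComp_toricForm_inl_inr, formComp_toricForm_inr_inl, formComp_kahlerForm_inl_inl,
    formComp_kahlerForm_inr_inr, formComp_kahlerForm_inl_inr, formComp_kahlerForm_inr_inl,
    Matrix.fromBlocks_apply₁₁, Matrix.fromBlocks_apply₁₂, Matrix.fromBlocks_apply₂₁,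
    Matrix.fromBlocks_apply₂₂, Matrix.zero_apply]
  simp only [Fin.sum_univ_two] at h00 h01 h10 h11 ⊢
  simp at h00 h01 h10 h11 ⊢
  rw [inv_hessian_symm hp 1 0] at *
  rw [hessian_symm hp 1 0] at *
  set G := (hessianMatrix T.g (momentMap p))⁻¹
  set H := hessianMatrix T.g (momentMap p)
  set M := fun i j => pderiv i (μ j) (momentMap p) with hM
  simp only [← show ∀ i j, M i j = pderiv i (μ j) (momentMap p) from fun _ _ => rfl]
  linear_combination 1 / 2 * (M 0 0 * h00 + M 0 1 * h10 + M 1 0 * h01 + M 1 1 * h11)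

section Equation

variable {μ : Fin 2 → (Fin 2 → ℝ) → ℝ}

theorem differentiableAt_pderiv (hμ : ∀ i, ContDiffOn ℝ ∞ (μ i) T.U) (hx : x ∈ T.U) (j k : Fin 2) :
    DifferentiableAt ℝ (pderiv j (μ k)) x :=
  ((hμ k).pderiv T.isOpen j).diffAt T.isOpen hx

theorem pderiv_formTrace_base (hμ : ∀ i, ContDiffOn ℝ ∞ (μ i) T.U) (hp : p ∈ T.carrier)
    (i : Fin 2) : pderiv (Sum.inl i) (formTrace T.metric kahlerForm (toricForm μ)) p =
      1 / 2 * ∑ l, pderiv i (pderiv l (μ l)) (momentMap p) := by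
  have hd := differentiableAt_pderiv hμ hp
  rw [pderiv_congr T.isOpen_carrier hp (fun q hq => formTrace_toricForm hq μ),
    pderiv_comp_momentMap_inl (f := fun x => 1 / 2 * ∑ l, pderiv l (μ l) x)
      ((DifferentiableAt.fun_sum fun l _ => hd l l).const_mul _),
    pderiv_const_mul _ _ (DifferentiableAt.fun_sum fun l _ => hd l l),
    pderiv_sum _ _ fun l _ => hd l l]

theorem pderiv_formTrace_angle (hμ : ∀ i, ContDiffOn ℝ ∞ (μ i) T.U) (hp : p ∈ T.carrier)
    (i : Fin 2) : pderiv (Sum.inr i) (formTrace T.metric kahlerForm (toricForm μ)) p = 0 := by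
  have hd := differentiableAt_pderiv hμ hp
  rw [pderiv_congr T.isOpen_carrier hp (fun q hq => formTrace_toricForm hq μ),
    pderiv_comp_momentMap_inr (f := fun x => 1 / 2 * ∑ l, pderiv l (μ l) x)
      ((DifferentiableAt.fun_sum fun l _ => hd l l).const_mul _)]

theorem pderiv_formComp_base (hμ : ∀ i, ContDiffOn ℝ ∞ (μ i) T.U) (hp : p ∈ T.carrier)
    (i j k : Fin 2) : pderiv (Sum.inl i) (formComp (toricForm μ) (Sum.inl j) (Sum.inr k)) p =
      pderiv i (pderiv j (μ k)) (momentMap p) := by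
  rw [show formComp (toricForm μ) (Sum.inl j) (Sum.inr k) =
    fun q => pderiv j (μ k) (momentMap q) from funext fun q => formComp_toricForm_inl_inr μ q j k]
  exact pderiv_comp_momentMap_inl (differentiableAt_pderiv hμ hp j k) i

theorem pderiv_formComp_angle (hμ : ∀ i, ContDiffOn ℝ ∞ (μ i) T.U) (hp : p ∈ T.carrier)
    (i j k : Fin 2) : pderiv (Sum.inr i) (formComp (toricForm μ) (Sum.inl j) (Sum.inr k)) p = 0 := by
  rw [show formComp (toricForm μ) (Sum.inl j) (Sum.inr k) =
    fun q => pderiv j (μ k) (momentMap q) from funext fun q => formComp_toricForm_inl_inr μ q j k]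
  exact pderiv_comp_momentMap_inr (differentiableAt_pderiv hμ hp j k) i

theorem pderiv_formComp_inl_inl (a : Fin 2 ⊕ Fin 2) (j k : Fin 2) :
    pderiv a (formComp (toricForm μ) (Sum.inl j) (Sum.inl k)) p = 0 := by
  rw [show formComp (toricForm μ) (Sum.inl j) (Sum.inl k) = fun _ => 0 from
    funext fun q => formComp_toricForm_inl_inl μ q j k, pderiv_const]

theorem pderiv_formComp_inr_inr (a : Fin 2 ⊕ Fin 2) (j k : Fin 2) :
    pderiv a (formComp (toricForm μ) (Sum.inr j) (Sum.inr k)) p = 0 := by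
  rw [show formComp (toricForm μ) (Sum.inr j) (Sum.inr k) = fun _ => 0 from
    funext fun q => formComp_toricForm_inr_inr μ q j k, pderiv_const]

/-- The right hand side of the Hamiltonian equation. -/
def hamiltonianRHS (h : MetricField) (J Ψ : TwoForm) (a b c : Fin 2 ⊕ Fin 2) (p : SymplSpace) : ℝ :=
  (2 / 3) * (pderiv a (formTrace h J Ψ) p * formComp J b c p
        - (1 / 2) * (formComp J a b p * pderiv c (formTrace h J Ψ) p
            - formComp J a c p * pderiv b (formTrace h J Ψ) p)
        - (1 / 2) * (h p a b * (∑ d, raiseSecond h J c d p * pderiv d (formTrace h J Ψ) p)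
            - h p a c * (∑ d, raiseSecond h J b d p * pderiv d (formTrace h J Ψ) p)))

theorem formComp_swap (Ψ : TwoForm) (a b : Fin 2 ⊕ Fin 2) :
    formComp Ψ a b = fun q => - formComp Ψ b a q := funext fun q => twoForm_swap (Ψ q) _ _

/-- Both sides of the equation are antisymmetric in the last two indices, so a mixed pair need only
be treated in the order base, angle. -/
theorem covDeriv_swap (h : MetricField) (Ψ : TwoForm) (a b c : Fin 2 ⊕ Fin 2) :
    covDeriv h Ψ a b c p = - covDeriv h Ψ a c b p := by
  have e : ∀ b c, formComp Ψ b c p = - formComp Ψ c b p := fun b c => congrFun (formComp_swap Ψ b c) p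
  rw [covDeriv, covDeriv, formComp_swap Ψ b c, pderiv_neg]
  simp only [e _ c, e b _, mul_neg, Finset.sum_neg_distrib]
  ring

theorem hamiltonianRHS_swap (h : MetricField) (J Ψ : TwoForm) (a b c : Fin 2 ⊕ Fin 2) :
    hamiltonianRHS h J Ψ a b c p = - hamiltonianRHS h J Ψ a c b p := by
  have e : formComp J b c p = - formComp J c b p := congrFun (formComp_swap J b c) p
  rw [hamiltonianRHS, hamiltonianRHS, e]
  ring

/-- Stated as an equivalence because these components serve in both directions: they alone force the
eigenvalue system. The right-hand form is the one computed in `IsSeparableJet.mixed_sub`. -/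
theorem hamiltonian_mixed_iff (hμ : ∀ i, ContDiffOn ℝ ∞ (μ i) T.U) (hp : p ∈ T.carrier)
    (i j k : Fin 2) :
    covDeriv T.metric (toricForm μ) (Sum.inl i) (Sum.inl j) (Sum.inr k) p =
      hamiltonianRHS T.metric kahlerForm (toricForm μ) (Sum.inl i) (Sum.inl j) (Sum.inr k) p ↔
    pderiv i (pderiv j (μ k)) (momentMap p)
      - 1 / 2 * ∑ l, (∑ m, (hessianMatrix T.g (momentMap p))⁻¹ l m *
          thirdDeriv T.g (momentMap p) i j m) * pderiv l (μ k) (momentMap p)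
      + 1 / 2 * ∑ l, pderiv j (μ l) (momentMap p) *
          ∑ m, (hessianMatrix T.g (momentMap p))⁻¹ k m * thirdDeriv T.g (momentMap p) i l m =
      1 / 3 * ((∑ l, pderiv i (pderiv l (μ l)) (momentMap p)) * (if j = k then 1 else 0)
        + 1 / 2 * (if i = k then 1 else 0) * (∑ l, pderiv j (pderiv l (μ l)) (momentMap p))
        + 1 / 2 * hessianMatrix T.g (momentMap p) i j *
          ∑ m, (hessianMatrix T.g (momentMap p))⁻¹ k m *
            ∑ l, pderiv m (pderiv l (μ l)) (momentMap p)) := by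
  have hm : T.metric p (Sum.inl i) (Sum.inl j) = hessianMatrix T.g (momentMap p) i j := rfl
  have hm' : T.metric p (Sum.inl i) (Sum.inr k) = 0 := rfl
  rw [covDeriv, hamiltonianRHS]
  simp only [Fintype.sum_sum_type, pderiv_formComp_base hμ hp, pderiv_formTrace_base hμ hp,
    pderiv_formTrace_angle hμ hp, raiseSecond_angle_base hp, raiseSecond_base_base hp,
    formComp_kahlerForm_inl_inl, formComp_kahlerForm_inl_inr, formComp_toricForm_inl_inr,
    formComp_toricForm_inl_inl, formComp_toricForm_inr_inr,
    christoffel_base_base_base hp, christoffel_angle_base_angle hp, christoffel_base_base_angle hp,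
    christoffel_angle_base_base hp, hm, hm']
  rw [← sub_eq_zero, ← sub_eq_zero (b := 1 / 3 * _)]
  refine Eq.congr ?_ rfl
  simp only [Fin.sum_univ_two]
  ring

theorem hamiltonian_angular_base_base (hμ : ∀ i, ContDiffOn ℝ ∞ (μ i) T.U) (hp : p ∈ T.carrier)
    (i j k : Fin 2)
    (h : - (1 / 2 * ∑ l, pderiv k (μ l) (momentMap p) * ∑ m,
          (hessianMatrix T.g (momentMap p))⁻¹ i m * thirdDeriv T.g (momentMap p) j l m)
        + 1 / 2 * ∑ l, pderiv j (μ l) (momentMap p) * ∑ m,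
          (hessianMatrix T.g (momentMap p))⁻¹ i m * thirdDeriv T.g (momentMap p) k l m =
      1 / 6 * ((if j = i then 1 else 0) * (∑ l, pderiv k (pderiv l (μ l)) (momentMap p))
        - (if k = i then 1 else 0) * (∑ l, pderiv j (pderiv l (μ l)) (momentMap p)))) :
    covDeriv T.metric (toricForm μ) (Sum.inr i) (Sum.inl j) (Sum.inl k) p =
      hamiltonianRHS T.metric kahlerForm (toricForm μ) (Sum.inr i) (Sum.inl j) (Sum.inl k) p := by
  have hm : ∀ l, T.metric p (Sum.inr i) (Sum.inl l) = 0 := fun _ => rfl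
  have e : ∀ l : Fin 2, (if l = i then -1 else 0 : ℝ) = - (if l = i then 1 else 0) := by
    intro l
    split_ifs <;> simp
  rw [covDeriv, hamiltonianRHS]
  simp only [Fintype.sum_sum_type, pderiv_formComp_inl_inl, pderiv_formTrace_base hμ hp,
    pderiv_formTrace_angle hμ hp, raiseSecond_base_base hp,
    formComp_kahlerForm_inl_inl, formComp_kahlerForm_inr_inl, formComp_toricForm_inl_inr,
    formComp_toricForm_inl_inl, formComp_toricForm_inr_inl,
    christoffel_base_angle_base hp, christoffel_angle_angle_base hp, hm, e]
  simp only [Fin.sum_univ_two] at h ⊢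
  linear_combination h

theorem hamiltonian_angular (hμ : ∀ i, ContDiffOn ℝ ∞ (μ i) T.U) (hp : p ∈ T.carrier)
    (i j k : Fin 2)
    (h : - (1 / 2 * ∑ l, (∑ d, (hessianMatrix T.g (momentMap p))⁻¹ l d *
          ∑ e, (hessianMatrix T.g (momentMap p))⁻¹ i e * ∑ f,
            (hessianMatrix T.g (momentMap p))⁻¹ j f * thirdDeriv T.g (momentMap p) d e f) *
              pderiv l (μ k) (momentMap p))
        + 1 / 2 * ∑ l, (∑ d, (hessianMatrix T.g (momentMap p))⁻¹ l d *
          ∑ e, (hessianMatrix T.g (momentMap p))⁻¹ i e * ∑ f,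
            (hessianMatrix T.g (momentMap p))⁻¹ k f * thirdDeriv T.g (momentMap p) d e f) *
              pderiv l (μ j) (momentMap p) =
      1 / 6 * ((hessianMatrix T.g (momentMap p))⁻¹ i j *
          (∑ m, (hessianMatrix T.g (momentMap p))⁻¹ k m *
            ∑ l, pderiv m (pderiv l (μ l)) (momentMap p))
        - (hessianMatrix T.g (momentMap p))⁻¹ i k * ∑ m, (hessianMatrix T.g (momentMap p))⁻¹ j m *
            ∑ l, pderiv m (pderiv l (μ l)) (momentMap p))) :
    covDeriv T.metric (toricForm μ) (Sum.inr i) (Sum.inr j) (Sum.inr k) p =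
      hamiltonianRHS T.metric kahlerForm (toricForm μ) (Sum.inr i) (Sum.inr j) (Sum.inr k) p := by
  have hm : ∀ l, T.metric p (Sum.inr i) (Sum.inr l) = (hessianMatrix T.g (momentMap p))⁻¹ i l :=
    fun _ => rfl
  rw [covDeriv, hamiltonianRHS]
  simp only [Fintype.sum_sum_type, pderiv_formComp_inr_inr, pderiv_formTrace_base hμ hp,
    pderiv_formTrace_angle hμ hp, raiseSecond_angle_base hp,
    formComp_kahlerForm_inr_inr, formComp_toricForm_inl_inr,
    formComp_toricForm_inr_inr, formComp_toricForm_inr_inl,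
    christoffel_base_angle_angle hp, christoffel_angle_angle_angle hp, hm]
  simp only [Fin.sum_univ_two] at h ⊢
  linear_combination h

/-- With an even number of angular indices both sides vanish: `φ ↦ -φ` is an isometry reversing the
sign of `J` and of every `dμₖ ∧ dφᵏ`. The next two lemmas are of the same kind. -/
theorem hamiltonian_base_base_base (hμ : ∀ i, ContDiffOn ℝ ∞ (μ i) T.U) (hp : p ∈ T.carrier)
    (i j k : Fin 2) :
    covDeriv T.metric (toricForm μ) (Sum.inl i) (Sum.inl j) (Sum.inl k) p =
      hamiltonianRHS T.metric kahlerForm (toricForm μ) (Sum.inl i) (Sum.inl j) (Sum.inl k) p := by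
  rw [covDeriv, hamiltonianRHS]
  simp [pderiv_formComp_inl_inl, pderiv_formTrace_angle hμ hp, raiseSecond_base_base hp,
    formComp_kahlerForm_inl_inl, formComp_toricForm_inl_inl, christoffel_angle_base_base hp]

theorem hamiltonian_base_angle_angle (hμ : ∀ i, ContDiffOn ℝ ∞ (μ i) T.U) (hp : p ∈ T.carrier)
    (i j k : Fin 2) :
    covDeriv T.metric (toricForm μ) (Sum.inl i) (Sum.inr j) (Sum.inr k) p =
      hamiltonianRHS T.metric kahlerForm (toricForm μ) (Sum.inl i) (Sum.inr j) (Sum.inr k) p := by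
  have hm : ∀ l, T.metric p (Sum.inl i) (Sum.inr l) = 0 := fun _ => rfl
  rw [covDeriv, hamiltonianRHS]
  simp [pderiv_formComp_inr_inr, pderiv_formTrace_angle hμ hp, hm,
    formComp_kahlerForm_inr_inr, formComp_toricForm_inr_inr, christoffel_base_base_angle hp]

theorem hamiltonian_angle_base_angle (hμ : ∀ i, ContDiffOn ℝ ∞ (μ i) T.U) (hp : p ∈ T.carrier)
    (i j k : Fin 2) :
    covDeriv T.metric (toricForm μ) (Sum.inr i) (Sum.inl j) (Sum.inr k) p =
      hamiltonianRHS T.metric kahlerForm (toricForm μ) (Sum.inr i) (Sum.inl j) (Sum.inr k) p := by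
  have hm : ∀ l, T.metric p (Sum.inr i) (Sum.inl l) = 0 := fun _ => rfl
  rw [covDeriv, hamiltonianRHS]
  simp [pderiv_formComp_angle hμ hp, pderiv_formTrace_angle hμ hp, hm,
    formComp_kahlerForm_inr_inr, formComp_toricForm_inr_inr, formComp_toricForm_inl_inl,
    christoffel_base_angle_base hp, christoffel_angle_angle_angle hp, raiseSecond_base_base hp]

end Equation

end ToricKahlerSurface

/-! ### Expansion of vectors and symmetric tensors in a dual frame. -/

theorem IsDualFrame.of_delta {X Y P Q : Fin 2 → ℝ}
    (h : ∀ i j, X i * P j + Y i * Q j = if i = j then 1 else 0) : IsDualFrame X Y P Q := by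
  have hm : (Matrix.of fun i j : Fin 2 => ![X i, Y i] j) * (Matrix.of fun i j => ![P j, Q j] i) = 1 := by
    ext i j
    simp [Matrix.mul_apply, Fin.sum_univ_two, h, Matrix.one_apply]
  -- A one-sided inverse of a square matrix is two-sided, so completeness of the frame yields the
  -- four pairings.
  have hm' := mul_eq_one_comm.1 hm
  have e : ∀ i j, _ = (1 : Matrix (Fin 2) (Fin 2) ℝ) i j := fun i j => congrFun (congrFun hm' i) j
  have e00 := e 0 0
  have e01 := e 0 1
  have e10 := e 1 0
  have e11 := e 1 1
  simp [Matrix.mul_apply] at e00 e01 e10 e11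
  refine ⟨?_, ?_, ?_, ?_, h⟩ <;> rw [Fin.sum_univ_two] <;> linarith

namespace IsDualFrame

variable {X Y P Q : Fin 2 → ℝ}

theorem vec_eq (h : IsDualFrame X Y P Q) (w : Fin 2 → ℝ) (i : Fin 2) :
    w i = (∑ k, X k * w k) * P i + (∑ k, Y k * w k) * Q i := by
  have h0 := h.delta 0 i
  have h1 := h.delta 1 i
  simp only [Fin.sum_univ_two]
  fin_cases i <;> simp at h0 h1 ⊢ <;> linear_combination - w 0 * h0 - w 1 * h1

theorem covec_eq (h : IsDualFrame X Y P Q) (w : Fin 2 → ℝ) (i : Fin 2) :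
    w i = (∑ k, P k * w k) * X i + (∑ k, Q k * w k) * Y i := by
  have h0 := h.delta i 0
  have h1 := h.delta i 1
  simp only [Fin.sum_univ_two]
  fin_cases i <;> simp at h0 h1 ⊢ <;> linear_combination - w 0 * h0 - w 1 * h1

theorem jac_mul_bracket (h : IsDualFrame X Y P Q) :
    (X 0 * Y 1 - X 1 * Y 0) * bracket P Q = 1 := by
  have h1 := h.xp
  have h2 := h.xq
  have h3 := h.yp
  have h4 := h.yq
  simp only [Fin.sum_univ_two] at h1 h2 h3 h4
  rw [bracket]
  linear_combination (Y 0 * Q 0 + Y 1 * Q 1) * h1 - (Y 0 * P 0 + Y 1 * P 1) * h2 + h4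

/-- Cramer's rule. It identifies the quotient of Jacobians `partialXi` with the derivative along
`P`; `jac_mul_Q` does the same for `partialEta` and `Q`. -/
theorem jac_mul_P (h : IsDualFrame X Y P Q) (w : Fin 2 → ℝ) :
    (X 0 * Y 1 - X 1 * Y 0) * ∑ i, P i * w i = w 0 * Y 1 - w 1 * Y 0 := by
  have h1 := h.xp
  have h3 := h.yp
  simp only [Fin.sum_univ_two] at h1 h3 ⊢
  linear_combination (w 0 * Y 1 - w 1 * Y 0) * h1 + (w 1 * X 0 - w 0 * X 1) * h3

theorem jac_mul_Q (h : IsDualFrame X Y P Q) (w : Fin 2 → ℝ) :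
    (X 0 * Y 1 - X 1 * Y 0) * ∑ i, Q i * w i = X 0 * w 1 - X 1 * w 0 := by
  have h1 := h.xq
  have h3 := h.yq
  simp only [Fin.sum_univ_two] at h1 h3 ⊢
  linear_combination (w 0 * Y 1 - w 1 * Y 0) * h1 + (w 1 * X 0 - w 0 * X 1) * h3

/-- `⟨P, w⟩` is the `Q` component of `w` times `⟨P, Q⟩ ≠ 0`. This turns the separability conditions
into statements about frame components. -/
theorem bracket_P_eq_zero_iff (h : IsDualFrame X Y P Q) (w : Fin 2 → ℝ) :
    bracket P w = 0 ↔ ∑ k, Y k * w k = 0 := by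
  have hj : bracket P Q ≠ 0 := right_ne_zero_of_mul_eq_one h.jac_mul_bracket
  have : bracket P w = (∑ k, Y k * w k) * bracket P Q := by
    rw [bracket, bracket]
    linear_combination P 0 * h.vec_eq w 1 - P 1 * h.vec_eq w 0
  rw [this, mul_eq_zero, or_iff_left hj]

theorem bracket_Q_eq_zero_iff (h : IsDualFrame X Y P Q) (w : Fin 2 → ℝ) :
    bracket Q w = 0 ↔ ∑ k, X k * w k = 0 := by
  have hj : bracket P Q ≠ 0 := right_ne_zero_of_mul_eq_one h.jac_mul_bracket
  have : bracket Q w = - (∑ k, X k * w k) * bracket P Q := by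
    rw [bracket, bracket]
    linear_combination Q 0 * h.vec_eq w 1 - Q 1 * h.vec_eq w 0
  rw [this, mul_eq_zero, neg_eq_zero, or_iff_left hj]

/-- A symmetric matrix in terms of its components in the frame. -/
theorem symm_eq (h : IsDualFrame X Y P Q) (S : Fin 2 → Fin 2 → ℝ) (hS : ∀ i j, S i j = S j i)
    (i j : Fin 2) : S i j = (∑ k, ∑ l, P k * P l * S k l) * X i * X j
      + (∑ k, ∑ l, P k * Q l * S k l) * (X i * Y j + Y i * X j)
      + (∑ k, ∑ l, Q k * Q l * S k l) * Y i * Y j := by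
  rw [h.covec_eq (fun i => S i j) i, h.covec_eq (fun j => ∑ k, P k * S k j) j,
    h.covec_eq (fun j => ∑ k, Q k * S k j) j]
  have hs := hS 1 0
  simp only [Fin.sum_univ_two, hs]
  ring

/-- A symmetric bivector in terms of its components in the frame. -/
theorem symm_eq' (h : IsDualFrame X Y P Q) (S : Fin 2 → Fin 2 → ℝ) (hS : ∀ i j, S i j = S j i)
    (i j : Fin 2) : S i j = (∑ k, ∑ l, X k * X l * S k l) * P i * P j
      + (∑ k, ∑ l, X k * Y l * S k l) * (P i * Q j + Q i * P j)
      + (∑ k, ∑ l, Y k * Y l * S k l) * Q i * Q j := by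
  rw [h.vec_eq (fun i => S i j) i, h.vec_eq (fun j => ∑ k, X k * S k j) j,
    h.vec_eq (fun j => ∑ k, Y k * S k j) j]
  have hs := hS 1 0
  simp only [Fin.sum_univ_two, hs]
  ring

/-- A symmetric cubic tensor has four frame components. Contraction with `P` and `Q` supplies the
two mixed ones, `A` on `PPQ` and `B` on `PQQ`. -/
theorem cubic_eq (h : IsDualFrame X Y P Q) (S : Fin 2 → Fin 2 → Fin 2 → ℝ)
    (hS : ∀ i j k, S i j k = S j i k) (hS' : ∀ i j k, S i j k = S i k j) {A B : ℝ}
    (hAB : ∀ i, ∑ j, ∑ k, P j * Q k * S i j k = A * X i + B * Y i) (i j k : Fin 2) :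
    S i j k = (∑ l, ∑ m, ∑ n, P l * P m * P n * S l m n) * X i * X j * X k
      + (∑ l, ∑ m, ∑ n, Q l * Q m * Q n * S l m n) * Y i * Y j * Y k
      + A * (X i * X j * Y k + X i * Y j * X k + Y i * X j * X k)
      + B * (X i * Y j * Y k + Y i * Y j * X k + Y i * X j * Y k) := by
  have h1 := h.xp
  have h2 := h.xq
  have h3 := h.yp
  have h4 := h.yq
  have hA : ∑ i, P i * ∑ j, ∑ k, P j * Q k * S i j k = A := by
    simp only [hAB]
    simp only [Fin.sum_univ_two] at h1 h3 ⊢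
    linear_combination A * h1 + B * h3
  have hB : ∑ i, Q i * ∑ j, ∑ k, P j * Q k * S i j k = B := by
    simp only [hAB]
    simp only [Fin.sum_univ_two] at h2 h4 ⊢
    linear_combination A * h2 + B * h4
  rw [h.symm_eq (fun j k => S i j k) (hS' i) j k, hAB i,
    h.covec_eq (fun i => ∑ k, ∑ l, P k * P l * S i k l) i,
    h.covec_eq (fun i => ∑ k, ∑ l, Q k * Q l * S i k l) i]
  have s1 := hS 1 0 0
  have s2 := hS' 0 1 0
  have s3 := hS 1 0 1
  have s4 := hS' 1 1 0
  have eA : ∑ k, Q k * ∑ l, ∑ m, P l * P m * S k l m = A := by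
    rw [← hA]
    simp only [Fin.sum_univ_two, s1, s2, s3, s4]
    ring
  have eB : ∑ k, P k * ∑ l, ∑ m, Q l * Q m * S k l m = B := by
    rw [← hB]
    simp only [Fin.sum_univ_two, s1, s2, s3, s4]
    ring
  rw [eA, eB]
  simp only [Fin.sum_univ_two]
  ring

end IsDualFrame

/-! ### Geometry of a surface in bilinear orthogonal coordinates. -/

namespace ToricKahlerSurface

variable {T : ToricKahlerSurface} {x : Fin 2 → ℝ} {p : SymplSpace}

/-- Orthogonal coordinates in which the moment maps are `c + r ξ + s η + b ξ η`. -/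
structure IsBilinear (T : ToricKahlerSurface) (ξ η : (Fin 2 → ℝ) → ℝ) (c r s b : Fin 2 → ℝ) : Prop
    extends T.IsOrthogonal ξ η where
  moment : ∀ x ∈ T.U, ∀ i, x i = c i + r i * ξ x + s i * η x + b i * ξ x * η x

namespace IsBilinear

variable {ξ η : (Fin 2 → ℝ) → ℝ} {c r s b : Fin 2 → ℝ}

/-- Differentiating the bilinear formula for `xⱼ` in the direction `xᵢ` gives `δᵢⱼ = ∂ᵢξ Pⱼ + ∂ᵢη
Qⱼ`. -/
theorem dualFrame (h : T.IsBilinear ξ η c r s b) (hx : x ∈ T.U) :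
    IsDualFrame (fun i => pderiv i ξ x) (fun i => pderiv i η x)
      (fun i => r i + b i * η x) (fun i => s i + b i * ξ x) := by
  refine IsDualFrame.of_delta fun i j => ?_
  have hξ := h.smooth_xi.diffAt T.isOpen hx
  have hη := h.smooth_eta.diffAt T.isOpen hx
  rw [← pderiv_coord (x := x) i j, pderiv_congr T.isOpen hx (fun y hy => h.moment y hy j),
    pderiv_add _ (by fun_prop) (by fun_prop), pderiv_add _ (by fun_prop) (by fun_prop),
    pderiv_add _ (by fun_prop) (by fun_prop), pderiv_const, pderiv_const_mul _ _ hξ,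
    pderiv_const_mul _ _ hη, pderiv_mul _ (by fun_prop) hη, pderiv_const_mul _ _ hξ]
  ring

theorem partialXi_eq (h : T.IsBilinear ξ η c r s b) (hx : x ∈ T.U) (f : (Fin 2 → ℝ) → ℝ) :
    partialXi ξ η f x = ∑ i, (r i + b i * η x) * pderiv i f x := by
  rw [partialXi, div_eq_iff (h.independent x hx), mul_comm]
  exact ((h.dualFrame hx).jac_mul_P fun i => pderiv i f x).symm

theorem partialEta_eq (h : T.IsBilinear ξ η c r s b) (hx : x ∈ T.U) (f : (Fin 2 → ℝ) → ℝ) :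
    partialEta ξ η f x = ∑ i, (s i + b i * ξ x) * pderiv i f x := by
  rw [partialEta, div_eq_iff (h.independent x hx), mul_comm, jacobian,
    mul_comm (pderiv 1 ξ x) (pderiv 0 f x), mul_comm (pderiv 0 f x)]
  exact ((h.dualFrame hx).jac_mul_Q fun i => pderiv i f x).symm

/-- The `∂_ξ` component of the constant vector `b`. -/
def coeffXi (ξ : (Fin 2 → ℝ) → ℝ) (b x : Fin 2 → ℝ) : ℝ := ∑ k, pderiv k ξ x * b k

theorem coeff_eq (h : T.IsBilinear ξ η c r s b) (hx : x ∈ T.U) (i : Fin 2) :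
    b i = coeffXi ξ b x * (r i + b i * η x) + coeffXi η b x * (s i + b i * ξ x) :=
  (h.dualFrame hx).vec_eq b i

/-- Differentiate the duality relation, using `dP = b dη` and `dQ = b dξ`, then expand `b` in the
frame and compare coefficients of `P` and `Q`. -/
theorem pderiv_pderiv (h : T.IsBilinear ξ η c r s b) (hx : x ∈ T.U) (i j : Fin 2) :
    pderiv i (pderiv j ξ) x =
        - coeffXi ξ b x * (pderiv i ξ x * pderiv j η x + pderiv j ξ x * pderiv i η x) ∧
      pderiv i (pderiv j η) x =
        - coeffXi η b x * (pderiv i ξ x * pderiv j η x + pderiv j ξ x * pderiv i η x) := by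
  have hξ := h.smooth_xi.diffAt T.isOpen hx
  have hη := h.smooth_eta.diffAt T.isOpen hx
  have hξj := (h.smooth_xi.pderiv T.isOpen j).diffAt T.isOpen hx
  have hηj := (h.smooth_eta.pderiv T.isOpen j).diffAt T.isOpen hx
  have key : ∀ k, pderiv i (pderiv j ξ) x * (r k + b k * η x) + pderiv j ξ x * (b k * pderiv i η x)
      + (pderiv i (pderiv j η) x * (s k + b k * ξ x) + pderiv j η x * (b k * pderiv i ξ x)) = 0 := by
    intro k
    have e := pderiv_congr T.isOpen hx (fun y hy => (h.dualFrame hy).delta j k) i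
    rw [pderiv_const, pderiv_add _ (by fun_prop) (by fun_prop), pderiv_mul _ hξj (by fun_prop),
      pderiv_mul _ hηj (by fun_prop), pderiv_add _ (by fun_prop) (by fun_prop),
      pderiv_add _ (by fun_prop) (by fun_prop), pderiv_const, pderiv_const,
      pderiv_const_mul _ _ hξ, pderiv_const_mul _ _ hη] at e
    linear_combination e
  have := (h.dualFrame hx).eq_zero_of_frame
    (A := pderiv i (pderiv j ξ) x
      + coeffXi ξ b x * (pderiv i ξ x * pderiv j η x + pderiv j ξ x * pderiv i η x))
    (B := pderiv i (pderiv j η) x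
      + coeffXi η b x * (pderiv i ξ x * pderiv j η x + pderiv j ξ x * pderiv i η x)) (by
      intro k
      linear_combination key k -
        (pderiv i ξ x * pderiv j η x + pderiv j ξ x * pderiv i η x) * h.coeff_eq hx k)
  exact ⟨by linear_combination this.1, by linear_combination this.2⟩

/-- The metric components in the coordinate frame. -/
theorem exists_metric_eq (h : T.IsBilinear ξ η c r s b) (hx : x ∈ T.U) :
    ∃ u v : ℝ, u ≠ 0 ∧ v ≠ 0 ∧
      (∀ i j, hessianMatrix T.g x i j =
        u * pderiv i ξ x * pderiv j ξ x + v * pderiv i η x * pderiv j η x) ∧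
      ∀ i j, (hessianMatrix T.g x)⁻¹ i j = (r i + b i * η x) * (r j + b j * η x) / u +
        (s i + b i * ξ x) * (s j + b j * ξ x) / v := by
  have hf := h.dualFrame hx
  set X := fun i => pderiv i ξ x with hX
  set Y := fun i => pderiv i η x with hY
  set P := fun i => r i + b i * η x with hP
  set Q := fun i => s i + b i * ξ x with hQ
  -- `dξ · dη = 0` is the vanishing of the off-diagonal frame component of `G`.
  have ho : ∑ k, ∑ l, X k * Y l * (hessianMatrix T.g x)⁻¹ k l = 0 := by
    rw [← h.orthogonal x hx]
    refine Finset.sum_congr rfl fun k _ => Finset.sum_congr rfl fun l _ => ?_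
    simp only [hX, hY]
    ring
  have hG : ∀ i j, (hessianMatrix T.g x)⁻¹ i j = _ :=
    hf.symm_eq' (fun i j => (hessianMatrix T.g x)⁻¹ i j) (inv_hessian_symm hx)
  simp only [ho, zero_mul, add_zero] at hG
  set u' := ∑ k, ∑ l, X k * X l * (hessianMatrix T.g x)⁻¹ k l
  set v' := ∑ k, ∑ l, Y k * Y l * (hessianMatrix T.g x)⁻¹ k l
  -- `det G = u' v' ⟨P, Q⟩²` is nonzero, so both diagonal entries are; `H` is then diagonal in the
  -- dual frame with the inverse entries.
  have hdet : u' * v' ≠ 0 := by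
    have h1 : (hessianMatrix T.g x)⁻¹.det ≠ 0 := by
      rw [Matrix.det_nonsing_inv, Ring.inverse_eq_inv']
      exact inv_ne_zero (T.det_hessian_pos hx).ne'
    intro h0
    apply h1
    rw [Matrix.det_fin_two, hG, hG, hG, hG]
    linear_combination (P 0 * Q 1 - P 1 * Q 0) ^ 2 * h0
  have hu' := left_ne_zero_of_mul hdet
  have hv' := right_ne_zero_of_mul hdet
  refine ⟨u'⁻¹, v'⁻¹, inv_ne_zero hu', inv_ne_zero hv', ?_, ?_⟩
  · have hm : (Matrix.of fun i j => u'⁻¹ * X i * X j + v'⁻¹ * Y i * Y j) *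
        (hessianMatrix T.g x)⁻¹ = 1 := by
      ext i j
      have h1 := hf.xp
      have h2 := hf.xq
      have h3 := hf.yp
      have h4 := hf.yq
      rw [Matrix.mul_apply, Matrix.one_apply, ← hf.delta i j]
      have k1 : u'⁻¹ * u' = 1 := inv_mul_cancel₀ hu'
      have k2 : v'⁻¹ * v' = 1 := inv_mul_cancel₀ hv'
      simp only [Matrix.of_apply, Fin.sum_univ_two, hG] at h1 h2 h3 h4 ⊢
      linear_combination (u'⁻¹ * X i * u' * P j) * h1 + (u'⁻¹ * X i * v' * Q j) * h2 +
        (v'⁻¹ * Y i * u' * P j) * h3 + (v'⁻¹ * Y i * v' * Q j) * h4 + X i * P j * k1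
        + Y i * Q j * k2
    have hi := Matrix.inv_eq_left_inv hm
    rw [Matrix.nonsing_inv_nonsing_inv _ (T.isUnit_det_hessian hx)] at hi
    intro i j
    rw [hi]
    rfl
  · intro i j
    rw [hG, div_inv_eq_mul, div_inv_eq_mul]
    simp only [hP, hQ]
    ring

/-- Differentiate `H(P, Q) = 0`. The frame contributes `H(b, Q) dη + H(P, b) dξ = v b₂ dη + u b₁
dξ`. -/
theorem third_eq (h : T.IsBilinear ξ η c r s b) (hx : x ∈ T.U) {u v : ℝ}
    (hH : ∀ i j, hessianMatrix T.g x i j =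
        u * pderiv i ξ x * pderiv j ξ x + v * pderiv i η x * pderiv j η x) (i : Fin 2) :
    ∑ j, ∑ k, (r j + b j * η x) * (s k + b k * ξ x) * thirdDeriv T.g x i j k =
      - (coeffXi ξ b x * u) * pderiv i ξ x + - (coeffXi η b x * v) * pderiv i η x := by
  have hz : ∀ y ∈ T.U, ∑ j, ∑ k, (r j + b j * η y) * (s k + b k * ξ y) * hessianMatrix T.g y j k
      = 0 := by
    intro y hy
    obtain ⟨u, v, -, -, hH, -⟩ := h.exists_metric_eq hy
    have hf := h.dualFrame hy
    have h2 := hf.xq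
    have h3 := hf.yp
    simp only [hH]
    simp only [Fin.sum_univ_two] at h2 h3 ⊢
    linear_combination u * (pderiv 0 ξ y * (r 0 + b 0 * η y) + pderiv 1 ξ y * (r 1 + b 1 * η y)) * h2
      + v * (pderiv 0 η y * (s 0 + b 0 * ξ y) + pderiv 1 η y * (s 1 + b 1 * ξ y)) * h3
  have hξ := h.smooth_xi.diffAt T.isOpen hx
  have hη := h.smooth_eta.diffAt T.isOpen hx
  have hd : ∀ j k, DifferentiableAt ℝ (fun y => hessianMatrix T.g y j k) x :=
    differentiableAt_hessian hx
  have hP : ∀ j, pderiv i (fun y => r j + b j * η y) x = b j * pderiv i η x := fun j => by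
    rw [pderiv_add _ (by fun_prop) (by fun_prop), pderiv_const, pderiv_const_mul _ _ hη, zero_add]
  have hQ : ∀ j, pderiv i (fun y => s j + b j * ξ y) x = b j * pderiv i ξ x := fun j => by
    rw [pderiv_add _ (by fun_prop) (by fun_prop), pderiv_const, pderiv_const_mul _ _ hξ, zero_add]
  have hPQ : ∀ j k, DifferentiableAt ℝ (fun y => (r j + b j * η y) * (s k + b k * ξ y)) x :=
    fun j k => by fun_prop
  have e := pderiv_congr T.isOpen hx hz i
  rw [pderiv_const, pderiv_sum _ _ fun j _ => DifferentiableAt.fun_sum fun k _ =>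
    (hPQ j k).fun_mul (hd j k)] at e
  have e2 : ∀ j, pderiv i (fun y => ∑ k, (r j + b j * η y) * (s k + b k * ξ y) *
      hessianMatrix T.g y j k) x = ∑ k, ((b j * pderiv i η x * (s k + b k * ξ x) +
        (r j + b j * η x) * (b k * pderiv i ξ x)) * hessianMatrix T.g x j k +
        (r j + b j * η x) * (s k + b k * ξ x) * thirdDeriv T.g x i j k) := by
    intro j
    rw [pderiv_sum _ _ fun k _ => (hPQ j k).fun_mul (hd j k)]
    refine Finset.sum_congr rfl fun k _ => ?_
    rw [pderiv_mul _ (hPQ j k) (hd j k), pderiv_mul _ (by fun_prop) (by fun_prop), hP, hQ]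
    rfl
  simp only [e2, Finset.sum_add_distrib] at e
  have hf := h.dualFrame hx
  have h1 := hf.xp
  have h2 := hf.xq
  have h3 := hf.yp
  have h4 := hf.yq
  rw [← sub_eq_zero, ← e]
  simp only [hH, coeffXi]
  simp only [Fin.sum_univ_two] at h1 h2 h3 h4 ⊢
  set X := fun i => pderiv i ξ x with hX
  set Y := fun i => pderiv i η x with hY
  simp only [show ∀ i, pderiv i ξ x = X i from fun _ => rfl,
    show ∀ i, pderiv i η x = Y i from fun _ => rfl] at h1 h2 h3 h4 ⊢
  linear_combination (-u * X i * (X 0 * b 0 + X 1 * b 1)) * h1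
    + (-v * Y i * (Y 0 * b 0 + Y 1 * b 1)) * h4 + (-v * X i * (Y 0 * b 0 + Y 1 * b 1)) * h3
    + (-u * Y i * (X 0 * b 0 + X 1 * b 1)) * h2

end IsBilinear

end ToricKahlerSurface

namespace ToricKahlerSurface

variable {T : ToricKahlerSurface} {x : Fin 2 → ℝ} {p : SymplSpace}

namespace IsBilinear

variable {ξ η : (Fin 2 → ℝ) → ℝ} {c r s b : Fin 2 → ℝ}

/-- The 2-form `dμₖ ∧ dφᵏ` has eigenvalues `α, β` with respect to the Kähler form, with eigenspaces
spanned by the coordinate directions. -/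
def HasEigenvalues (T : ToricKahlerSurface) (ξ η : (Fin 2 → ℝ) → ℝ) (r s b : Fin 2 → ℝ)
    (μ : Fin 2 → (Fin 2 → ℝ) → ℝ) (α β : (Fin 2 → ℝ) → ℝ) : Prop :=
  ∀ x ∈ T.U, ∀ j k, pderiv j (μ k) x =
    α x * pderiv j ξ x * (r k + b k * η x) + β x * pderiv j η x * (s k + b k * ξ x)

/-- The differential equations for the eigenvalues of a Hamiltonian 2-form. -/
def EigenvalueSystem (T : ToricKahlerSurface) (ξ η : (Fin 2 → ℝ) → ℝ) (b : Fin 2 → ℝ)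
    (α β : (Fin 2 → ℝ) → ℝ) : Prop :=
  ∀ x ∈ T.U, ∀ i,
    pderiv i α x = (α x - β x) *
      (2 * coeffXi η b x * pderiv i ξ x
        - coeffXi ξ b x * pderiv i η x) ∧
    pderiv i β x = (α x - β x) *
      (coeffXi η b x * pderiv i ξ x - 2 * coeffXi ξ b x * pderiv i η x)

variable {μ : Fin 2 → (Fin 2 → ℝ) → ℝ} {α β : (Fin 2 → ℝ) → ℝ}

/-- `t₁`, `t₂` are the components of the third derivatives on `PPP` and `QQQ`; the mixed ones come
from `third_eq`. The formula for `dM` is the derivative of the eigenvalue decomposition, with second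
derivatives of `ξ`, `η` replaced by `pderiv_pderiv`. -/
theorem exists_jet (h : T.IsBilinear ξ η c r s b) (hα : ContDiffOn ℝ ∞ α T.U)
    (hβ : ContDiffOn ℝ ∞ β T.U) (hM : HasEigenvalues T ξ η r s b μ α β) (hx : x ∈ T.U) :
    ∃ u v t₁ t₂ : ℝ, IsSeparableJet (fun i => pderiv i ξ x) (fun i => pderiv i η x)
      (fun i => r i + b i * η x) (fun i => s i + b i * ξ x) b u v t₁ t₂
      (coeffXi ξ b x) (coeffXi η b x) (α x) (β x)
      (∑ i, (r i + b i * η x) * pderiv i α x) (∑ i, (s i + b i * ξ x) * pderiv i α x)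
      (∑ i, (r i + b i * η x) * pderiv i β x) (∑ i, (s i + b i * ξ x) * pderiv i β x)
      (fun i j => hessianMatrix T.g x i j) (fun i j => (hessianMatrix T.g x)⁻¹ i j)
      (fun j k => pderiv j (μ k) x) (thirdDeriv T.g x)
      (fun i j k => pderiv i (pderiv j (μ k)) x) := by
  obtain ⟨u, v, hu, hv, hH, hG⟩ := h.exists_metric_eq hx
  have hf := h.dualFrame hx
  have hT := hf.cubic_eq (thirdDeriv T.g x) (thirdDeriv_swap_left hx) (thirdDeriv_swap_right hx)
    (h.third_eq hx hH)
  refine ⟨u, v, ∑ l, ∑ m, ∑ n, (r l + b l * η x) * (r m + b m * η x) * (r n + b n * η x) *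
      thirdDeriv T.g x l m n, ∑ l, ∑ m, ∑ n, (s l + b l * ξ x) * (s m + b m * ξ x) *
      (s n + b n * ξ x) * thirdDeriv T.g x l m n, hf, hu, hv, h.coeff_eq hx, hH, hG, fun i j k => ?_, hM x hx, fun i j k => ?_⟩
  · rw [hT i j k]
    ring
  · have hξ := h.smooth_xi.diffAt T.isOpen hx
    have hη := h.smooth_eta.diffAt T.isOpen hx
    have hξj := (h.smooth_xi.pderiv T.isOpen j).diffAt T.isOpen hx
    have hηj := (h.smooth_eta.pderiv T.isOpen j).diffAt T.isOpen hx
    have hα' := hα.diffAt T.isOpen hx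
    have hβ' := hβ.diffAt T.isOpen hx
    have eα := hf.covec_eq (fun i => pderiv i α x) i
    have eβ := hf.covec_eq (fun i => pderiv i β x) i
    obtain ⟨e1, e2⟩ := h.pderiv_pderiv hx i j
    rw [pderiv_congr T.isOpen hx (fun y hy => hM y hy j k), pderiv_add _ (by fun_prop) (by fun_prop),
      pderiv_mul _ (by fun_prop) (by fun_prop), pderiv_mul _ (by fun_prop) (by fun_prop),
      pderiv_mul _ (by fun_prop) (by fun_prop), pderiv_mul _ (by fun_prop) (by fun_prop),
      pderiv_add _ (by fun_prop) (by fun_prop), pderiv_add _ (by fun_prop) (by fun_prop),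
      pderiv_const, pderiv_const, pderiv_const_mul _ _ hξ, pderiv_const_mul _ _ hη, e1, e2]
    linear_combination pderiv j ξ x * (r k + b k * η x) * eα
      + pderiv j η x * (s k + b k * ξ x) * eβ

theorem eigenvalueSystem_of_equation (h : T.IsBilinear ξ η c r s b)
    (hμ : ∀ i, ContDiffOn ℝ ∞ (μ i) T.U) (hα : ContDiffOn ℝ ∞ α T.U) (hβ : ContDiffOn ℝ ∞ β T.U)
    (hM : HasEigenvalues T ξ η r s b μ α β) (hH : T.IsHamiltonian (toricForm μ)) :
    EigenvalueSystem T ξ η b α β := by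
  intro x hx i
  obtain ⟨u, v, t₁, t₂, hj⟩ := h.exists_jet hα hβ hM hx
  -- The equation is used at the point over `x` with zero angles.
  have hp : Sum.elim x (0 : Fin 2 → ℝ) ∈ T.carrier := hx
  have := hj.eigenvalues_of_mixed (fun i j k =>
    (hamiltonian_mixed_iff hμ hp i j k).1 (hH.equation _ hp _ _ _))
  obtain ⟨h1, h2, h3, h4⟩ := this
  have eα := (h.dualFrame hx).covec_eq (fun i => pderiv i α x) i
  have eβ := (h.dualFrame hx).covec_eq (fun i => pderiv i β x) i
  rw [h1, h3] at eα
  rw [h2, h4] at eβ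
  constructor
  · linear_combination eα
  · linear_combination eβ

end IsBilinear

/-! ### Complex structure, exactness of invariant forms, and the sufficiency of the eigenvalue
system. -/

theorem complexStructure_inl {v : SymplSpace} (hp : p ∈ T.carrier) (a : Fin 2) :
    complexStructure T.metric kahlerForm p v (Sum.inl a) =
      ∑ j, (hessianMatrix T.g (momentMap p))⁻¹ a j * v (Sum.inr j) := by
  rw [complexStructure, metric_inv hp]
  simp [formComp_kahlerForm_inl_inl, formComp_kahlerForm_inl_inr]

theorem complexStructure_inr {v : SymplSpace} (hp : p ∈ T.carrier) (a : Fin 2) :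
    complexStructure T.metric kahlerForm p v (Sum.inr a) =
      - ∑ j, hessianMatrix T.g (momentMap p) a j * v (Sum.inl j) := by
  have e : ∀ j k : Fin 2, (if j = k then -1 else 0 : ℝ) = - (if j = k then 1 else 0) := by
    intro j k
    split_ifs <;> simp
  rw [complexStructure, metric_inv hp]
  simp [formComp_kahlerForm_inr_inl, formComp_kahlerForm_inr_inr]
  ring

/-- The invariant 1-form `μₖ dφᵏ`. -/
def toricPrimitive (μ : Fin 2 → (Fin 2 → ℝ) → ℝ) (p : SymplSpace) : SymplSpace →L[ℝ] ℝ :=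
  ∑ k, μ k (momentMap p) • dphi k

section ToricForm

variable {μ : Fin 2 → (Fin 2 → ℝ) → ℝ}

theorem contDiffOn_comp_momentMap {f : (Fin 2 → ℝ) → ℝ} (hf : ContDiffOn ℝ ∞ f T.U) :
    ContDiffOn ℝ ∞ (fun q => f (momentMap q)) T.carrier :=
  hf.comp contDiff_momentMap.contDiffOn fun _ hq => hq

theorem contDiffOn_toricPrimitive (hμ : ∀ i, ContDiffOn ℝ ∞ (μ i) T.U) :
    ContDiffOn ℝ ∞ (toricPrimitive μ) T.carrier :=
  ContDiffOn.sum fun k _ => (contDiffOn_comp_momentMap (hμ k)).smul contDiffOn_const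

theorem contDiffOn_toricForm (hμ : ∀ i, ContDiffOn ℝ ∞ (μ i) T.U) :
    ContDiffOn ℝ ∞ (toricForm μ) T.carrier :=
  ContDiffOn.sum fun j _ => ContDiffOn.sum fun k _ =>
    (contDiffOn_comp_momentMap ((hμ k).pderiv T.isOpen j)).smul contDiffOn_const

/-- `d(μₖ dφᵏ) = dμₖ ∧ dφᵏ`. This gives closedness through `d² = 0`, and later identifies `Ψ_*` from
its primitive. -/
theorem dOneForm_toricPrimitive (hμ : ∀ i, ContDiffOn ℝ ∞ (μ i) T.U) (hp : p ∈ T.carrier) :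
    dOneForm (toricPrimitive μ) p = toricForm μ p := by
  have hd : DifferentiableAt ℝ (toricPrimitive μ) p :=
    ((contDiffOn_toricPrimitive hμ).contDiffAt (T.isOpen_carrier.mem_nhds hp)).differentiableAt
      (by simp)
  have hq : ∀ k, DifferentiableAt ℝ (fun q => μ k (momentMap q)) p := fun k =>
    (contDiffOn_comp_momentMap (hμ k)).diffAt T.isOpen_carrier hp
  have key : ∀ v w : SymplSpace, fderiv ℝ (fun q => toricPrimitive μ q w) p v =
      ∑ k, (∑ j, v (Sum.inl j) * pderiv j (μ k) (momentMap p)) * w (Sum.inr k) := by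
    intro v w
    have e : (fun q => toricPrimitive μ q w) = fun q => ∑ k, μ k (momentMap q) * w (Sum.inr k) := by
      funext q
      simp [toricPrimitive, dphi]
    rw [e, fderiv_fun_sum fun k _ => (hq k).mul_const _, sum_apply]
    refine Finset.sum_congr rfl fun k _ => ?_
    rw [fderiv_mul_const (hq k), smul_apply,
      fderiv_comp_momentMap ((hμ k).diffAt T.isOpen hp), fderiv_eq_sum_pderiv, smul_eq_mul, mul_comm]
    rfl
  refine twoForm_ext fun a b => ?_
  rw [dOneForm_apply hd, key, key, toricForm_apply]
  simp only [Fin.sum_univ_two]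
  ring

theorem extDeriv_toricForm (hμ : ∀ i, ContDiffOn ℝ ∞ (μ i) T.U) (hp : p ∈ T.carrier) :
    extDeriv (toricForm μ) p = 0 := by
  have e : extDeriv (toricForm μ) p = extDeriv (dOneForm (toricPrimitive μ)) p :=
    Filter.EventuallyEq.extDeriv_eq (Filter.eventually_of_mem (T.isOpen_carrier.mem_nhds hp)
      fun q hq => (dOneForm_toricPrimitive hμ hq).symm)
  rw [e]
  refine extDeriv_extDeriv_apply (r := ∞) ?_ (by
    rw [minSmoothness_of_isRCLikeNormedField]; exact WithTop.coe_le_coe.2 le_top)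
  exact (ContinuousAlternatingMap.ofSubsingletonLIE (𝕜 := ℝ) (E := SymplSpace) (F := ℝ)
    (0 : Fin 1)).contDiff.contDiffAt.comp p
      ((contDiffOn_toricPrimitive hμ).contDiffAt (T.isOpen_carrier.mem_nhds hp))

theorem isToricClosed_toricForm (hμ : ∀ i, ContDiffOn ℝ ∞ (μ i) T.U) :
    T.IsToricClosed (toricForm μ) where
  smooth := contDiffOn_toricForm hμ
  closed _ hp := extDeriv_toricForm hμ hp
  invariant p _ t := by simp only [toricForm, momentMap_torusTranslate]
  orthogonal p _ v := toricForm_orthogonal T μ p v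

theorem isMomentMap_toricForm (hμ : ∀ i, ContDiffOn ℝ ∞ (μ i) T.U) :
    T.IsMomentMap (toricForm μ) μ where
  smooth := hμ
  contract p hp i v := by
    rw [fderiv_comp_momentMap ((hμ i).diffAt T.isOpen hp), fderiv_eq_sum_pderiv, toricForm_apply]
    fin_cases i <;> simp [torusField, coordVec, momentMap] <;> ring

/-- `T.carrier` is open and torus-invariant, so values on it determine the derivatives and the
invariance condition there. This lets an arbitrary `Ψ` be exchanged for a `toricForm`. -/
theorem IsToricClosed.congr {Ψ Ψ' : TwoForm} (h : T.IsToricClosed Ψ)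
    (e : ∀ p ∈ T.carrier, Ψ' p = Ψ p) : T.IsToricClosed Ψ' where
  smooth := h.smooth.congr e
  closed p hp := by
    rw [← h.closed p hp]
    exact Filter.EventuallyEq.extDeriv_eq (Filter.eventually_of_mem (T.isOpen_carrier.mem_nhds hp) e)
  invariant p hp t := by
    have ht : torusTranslate t p ∈ T.carrier := by
      rw [carrier, Set.mem_ofPred_eq, momentMap_torusTranslate]
      exact hp
    rw [e p hp, e _ ht, h.invariant p hp t]
  orthogonal p hp := by
    rw [e p hp]
    exact h.orthogonal p hp

theorem IsMomentMap.congr {Ψ Ψ' : TwoForm} (h : T.IsMomentMap Ψ μ)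
    (e : ∀ p ∈ T.carrier, Ψ' p = Ψ p) : T.IsMomentMap Ψ' μ where
  smooth := h.smooth
  contract p hp i v := by rw [e p hp, h.contract p hp]

theorem IsHamiltonian.congr {Ψ Ψ' : TwoForm} (h : T.IsHamiltonian Ψ)
    (e : ∀ p ∈ T.carrier, Ψ' p = Ψ p) : T.IsHamiltonian Ψ' where
  smooth := ContDiffOn.congr h.smooth e
  closed p hp := by
    rw [← h.closed p hp]
    exact Filter.EventuallyEq.extDeriv_eq (Filter.eventually_of_mem (T.isOpen_carrier.mem_nhds hp) e)
  invariant p hp := by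
    rw [e p hp]
    exact h.invariant p hp
  equation p hp a b c := by
    have ec : ∀ q ∈ T.carrier, ∀ a b, formComp Ψ' a b q = formComp Ψ a b q := fun q hq a b => by
      rw [formComp, formComp, e q hq]
    have et : ∀ a, pderiv a (formTrace T.metric kahlerForm Ψ') p =
        pderiv a (formTrace T.metric kahlerForm Ψ) p :=
      pderiv_congr T.isOpen_carrier hp fun q hq => by
        simp only [formTrace, ec q hq]
    have e1 := h.equation p hp a b c
    simp only [et]
    rw [← e1, covDeriv, covDeriv, pderiv_congr T.isOpen_carrier hp (fun q hq => ec q hq b c)]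
    simp only [ec p hp]

end ToricForm

theorem IsBilinear.isHamiltonian_toricForm {ξ η α β : (Fin 2 → ℝ) → ℝ} {c r s b : Fin 2 → ℝ}
    {μ : Fin 2 → (Fin 2 → ℝ) → ℝ} (h : T.IsBilinear ξ η c r s b)
    (hμ : ∀ i, ContDiffOn ℝ ∞ (μ i) T.U) (hα : ContDiffOn ℝ ∞ α T.U) (hβ : ContDiffOn ℝ ∞ β T.U)
    (hM : HasEigenvalues T ξ η r s b μ α β) (hS : EigenvalueSystem T ξ η b α β) :
    T.IsHamiltonian (toricForm μ) where
  smooth := contDiffOn_toricForm hμ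
  closed _ hp := extDeriv_toricForm hμ hp
  invariant p hp v w := by
    obtain ⟨u, v', t₁, t₂, hj⟩ := h.exists_jet hα hβ hM hp
    have hs := hj.sum_G_M_H
    have h1 := inv_hessian_symm hp 1 0
    simp only [toricForm_apply, complexStructure_inl hp, complexStructure_inr hp]
    rw [← sub_eq_zero]
    have h00 := hs 0 0
    have h01 := hs 0 1
    have h10 := hs 1 0
    have h11 := hs 1 1
    simp only [Fin.sum_univ_two] at h00 h01 h10 h11 ⊢
    rw [h1] at *
    linear_combination
      (v (Sum.inl 0) * w (Sum.inr 0) - w (Sum.inl 0) * v (Sum.inr 0)) * h00 +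
      (v (Sum.inl 1) * w (Sum.inr 0) - w (Sum.inl 1) * v (Sum.inr 0)) * h01 +
      (v (Sum.inl 0) * w (Sum.inr 1) - w (Sum.inl 0) * v (Sum.inr 1)) * h10 +
      (v (Sum.inl 1) * w (Sum.inr 1) - w (Sum.inl 1) * v (Sum.inr 1)) * h11
  equation p hp a b' c' := by
    obtain ⟨u, v, t₁, t₂, hj⟩ := h.exists_jet hα hβ hM hp
    have hf := h.dualFrame hp
    have hS' := hS _ hp
    have h1 := hf.xp
    have h2 := hf.xq
    have h3 := hf.yp
    have h4 := hf.yq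
    -- `e1` to `e4` are the components of `dα`, `dβ` along `P` and `Q`, read off from the system by
    -- duality.
    have e1 : ∑ i, (r i + b i * η (momentMap p)) * pderiv i α (momentMap p) =
        2 * (α (momentMap p) - β (momentMap p)) * coeffXi η b (momentMap p) := by
      simp only [(hS' _).1, Fin.sum_univ_two] at h1 h3 ⊢
      linear_combination 2 * (α (momentMap p) - β (momentMap p)) * coeffXi η b (momentMap p) * h1 -
        (α (momentMap p) - β (momentMap p)) * coeffXi ξ b (momentMap p) * h3
    have e2 : ∑ i, (r i + b i * η (momentMap p)) * pderiv i β (momentMap p) =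
        (α (momentMap p) - β (momentMap p)) * coeffXi η b (momentMap p) := by
      simp only [(hS' _).2, Fin.sum_univ_two] at h1 h3 ⊢
      linear_combination (α (momentMap p) - β (momentMap p)) * coeffXi η b (momentMap p) * h1 -
        2 * (α (momentMap p) - β (momentMap p)) * coeffXi ξ b (momentMap p) * h3
    have e3 : ∑ i, (s i + b i * ξ (momentMap p)) * pderiv i α (momentMap p) =
        (β (momentMap p) - α (momentMap p)) * coeffXi ξ b (momentMap p) := by
      simp only [(hS' _).1, Fin.sum_univ_two] at h2 h4 ⊢
      linear_combination 2 * (α (momentMap p) - β (momentMap p)) * coeffXi η b (momentMap p) * h2 -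
        (α (momentMap p) - β (momentMap p)) * coeffXi ξ b (momentMap p) * h4
    have e4 : ∑ i, (s i + b i * ξ (momentMap p)) * pderiv i β (momentMap p) =
        2 * (β (momentMap p) - α (momentMap p)) * coeffXi ξ b (momentMap p) := by
      simp only [(hS' _).2, Fin.sum_univ_two] at h2 h4 ⊢
      linear_combination (α (momentMap p) - β (momentMap p)) * coeffXi η b (momentMap p) * h2 -
        2 * (α (momentMap p) - β (momentMap p)) * coeffXi ξ b (momentMap p) * h4
    have hm : ∀ i j k, _ := fun i j k => (hamiltonian_mixed_iff hμ hp i j k).2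
      (hj.mixed e1 e2 e3 e4 i j k)
    change _ = hamiltonianRHS T.metric kahlerForm (toricForm μ) a b' c' p
    rcases a with a | a <;> rcases b' with j | j <;> rcases c' with k | k
    · exact hamiltonian_base_base_base hμ hp a j k
    · exact hm a j k
    · rw [covDeriv_swap, hamiltonianRHS_swap, hm]
    · exact hamiltonian_base_angle_angle hμ hp a j k
    · exact hamiltonian_angular_base_base hμ hp a j k
        (hj.angular_base_base (by rw [e1, e2]; ring) (by rw [e3, e4]; ring) a j k)
    · exact hamiltonian_angle_base_angle hμ hp a j k
    · rw [covDeriv_swap, hamiltonianRHS_swap, hamiltonian_angle_base_angle hμ hp]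
    · exact hamiltonian_angular hμ hp a j k
        (hj.angular (by rw [e1, e2]; ring) (by rw [e3, e4]; ring) a j k)

end ToricKahlerSurface

/-! ### Affine changes of coordinates and the solution space of the eigenvalue system. -/

namespace ToricKahlerSurface

variable {T : ToricKahlerSurface} {x : Fin 2 → ℝ} {p : SymplSpace}

/-- The separability condition `⟨∂_ξ x, ∂_ξ μ⟩ = 0 = ⟨∂_η x, ∂_η μ⟩`. -/
def IsSeparableMoment (T : ToricKahlerSurface) (ξ η : (Fin 2 → ℝ) → ℝ)
    (μ : Fin 2 → (Fin 2 → ℝ) → ℝ) : Prop :=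
  (∀ x ∈ T.U, bracket (fun i => partialXi ξ η (momentCoord i) x)
      (fun i => partialXi ξ η (μ i) x) = 0) ∧
    ∀ x ∈ T.U, bracket (fun i => partialEta ξ η (momentCoord i) x)
      (fun i => partialEta ξ η (μ i) x) = 0

section AffineChange

variable {ξ₀ η₀ ξ η : (Fin 2 → ℝ) → ℝ}

theorem pderiv_affine (hξ : ContDiffOn ℝ ∞ ξ₀ T.U) {K C : ℝ}
    (h : ∀ x ∈ T.U, ξ x = K * ξ₀ x + C) (hx : x ∈ T.U) (i : Fin 2) :
    pderiv i ξ x = K * pderiv i ξ₀ x := by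
  have hd := hξ.diffAt T.isOpen hx
  rw [pderiv_congr T.isOpen hx h, pderiv_add _ (by fun_prop) (by fun_prop), pderiv_const,
    pderiv_const_mul _ _ hd, add_zero]

theorem contDiffOn_affine (hξ : ContDiffOn ℝ ∞ ξ₀ T.U) {K C : ℝ}
    (h : ∀ x ∈ T.U, ξ x = K * ξ₀ x + C) : ContDiffOn ℝ ∞ ξ T.U :=
  ((contDiffOn_const.mul hξ).add contDiffOn_const).congr h

theorem IsOrthogonal.affineChange (h : T.IsOrthogonal ξ₀ η₀) (hc : T.IsAffineChange ξ₀ η₀ ξ η) :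
    T.IsOrthogonal ξ η := by
  obtain ⟨K, L, C, D, hK, hL, hc | hc⟩ := hc
  · have e1 := fun x hx => (hc x hx).1
    have e2 := fun x hx => (hc x hx).2
    refine ⟨contDiffOn_affine h.smooth_xi e1, contDiffOn_affine h.smooth_eta e2, fun x hx => ?_,
      fun x hx => ?_⟩
    · rw [← mul_zero (K * L), ← h.orthogonal x hx]
      simp only [Fin.sum_univ_two, pderiv_affine h.smooth_xi e1 hx,
        pderiv_affine h.smooth_eta e2 hx]
      ring
    · have := mul_ne_zero (mul_ne_zero hK hL) (h.independent x hx)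
      contrapose! this
      rw [← this]
      simp only [jacobian, pderiv_affine h.smooth_xi e1 hx, pderiv_affine h.smooth_eta e2 hx]
      ring
  · have e1 := fun x hx => (hc x hx).1
    have e2 := fun x hx => (hc x hx).2
    refine ⟨contDiffOn_affine h.smooth_eta e1, contDiffOn_affine h.smooth_xi e2, fun x hx => ?_,
      fun x hx => ?_⟩
    · rw [← mul_zero (K * L), ← h.orthogonal x hx]
      simp only [Fin.sum_univ_two, pderiv_affine h.smooth_eta e1 hx,
        pderiv_affine h.smooth_xi e2 hx, inv_hessian_symm hx 1 0]
      ring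
    · have := mul_ne_zero (mul_ne_zero hK hL) (h.independent x hx)
      contrapose! this
      rw [← neg_eq_zero, ← this]
      simp only [jacobian, pderiv_affine h.smooth_eta e1 hx, pderiv_affine h.smooth_xi e2 hx]
      ring

theorem bracket_mul (k : ℝ) (v w : Fin 2 → ℝ) :
    bracket (fun i => k * v i) (fun i => k * w i) = k ^ 2 * bracket v w := by
  simp only [bracket]
  ring

/-- Each condition involves a single coordinate derivative quadratically, so rescaling multiplies it
by a nonzero square; exchanging coordinates exchanges the two conditions. -/
theorem IsOrthogonal.isSeparableMoment_iff (h : T.IsOrthogonal ξ₀ η₀)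
    (hc : T.IsAffineChange ξ₀ η₀ ξ η) (μ : Fin 2 → (Fin 2 → ℝ) → ℝ) :
    T.IsSeparableMoment ξ η μ ↔ T.IsSeparableMoment ξ₀ η₀ μ := by
  obtain ⟨K, L, C, D, hK, hL, hc | hc⟩ := hc
  · have e1 := fun x hx => (hc x hx).1
    have e2 := fun x hx => (hc x hx).2
    have p1 : ∀ x ∈ T.U, ∀ f, partialXi ξ η f x = K⁻¹ * partialXi ξ₀ η₀ f x := by
      intro x hx f
      have hj := h.independent x hx
      simp only [partialXi, jacobian, pderiv_affine h.smooth_xi e1 hx,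
        pderiv_affine h.smooth_eta e2 hx] at hj ⊢
      rw [← div_eq_inv_mul, div_div, div_eq_div_iff]
      · ring
      · convert mul_ne_zero (mul_ne_zero hK hL) hj using 1
        ring
      · exact mul_ne_zero hj hK
    have p2 : ∀ x ∈ T.U, ∀ f, partialEta ξ η f x = L⁻¹ * partialEta ξ₀ η₀ f x := by
      intro x hx f
      have hj := h.independent x hx
      simp only [partialEta, jacobian, pderiv_affine h.smooth_xi e1 hx,
        pderiv_affine h.smooth_eta e2 hx] at hj ⊢
      rw [← div_eq_inv_mul, div_div, div_eq_div_iff]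
      · ring
      · convert mul_ne_zero (mul_ne_zero hK hL) hj using 1
        ring
      · exact mul_ne_zero hj hL
    refine and_congr (forall₂_congr fun x hx => ?_) (forall₂_congr fun x hx => ?_)
    · simp only [p1 x hx, bracket_mul]
      simp [hK]
    · simp only [p2 x hx, bracket_mul]
      simp [hL]
  · have e1 := fun x hx => (hc x hx).1
    have e2 := fun x hx => (hc x hx).2
    have p1 : ∀ x ∈ T.U, ∀ f, partialXi ξ η f x = K⁻¹ * partialEta ξ₀ η₀ f x := by
      intro x hx f
      have hj := h.independent x hx
      simp only [partialXi, partialEta, jacobian, pderiv_affine h.smooth_eta e1 hx,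
        pderiv_affine h.smooth_xi e2 hx] at hj ⊢
      rw [← div_eq_inv_mul, div_div, div_eq_div_iff]
      · ring
      · convert neg_ne_zero.2 (mul_ne_zero (mul_ne_zero hK hL) hj) using 1
        ring
      · exact mul_ne_zero hj hK
    have p2 : ∀ x ∈ T.U, ∀ f, partialEta ξ η f x = L⁻¹ * partialXi ξ₀ η₀ f x := by
      intro x hx f
      have hj := h.independent x hx
      simp only [partialXi, partialEta, jacobian, pderiv_affine h.smooth_eta e1 hx,
        pderiv_affine h.smooth_xi e2 hx] at hj ⊢
      rw [← div_eq_inv_mul, div_div, div_eq_div_iff]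
      · ring
      · convert neg_ne_zero.2 (mul_ne_zero (mul_ne_zero hK hL) hj) using 1
        ring
      · exact mul_ne_zero hj hL
    rw [IsSeparableMoment, and_comm]
    refine and_congr (forall₂_congr fun x hx => ?_) (forall₂_congr fun x hx => ?_)
    · simp only [p2 x hx, bracket_mul]
      simp [hL]
    · simp only [p1 x hx, bracket_mul]
      simp [hK]

end AffineChange

namespace IsBilinear

variable {ξ η : (Fin 2 → ℝ) → ℝ} {c r s b : Fin 2 → ℝ} {μ : Fin 2 → (Fin 2 → ℝ) → ℝ}
  {α β : (Fin 2 → ℝ) → ℝ}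

theorem partialXi_momentCoord (h : T.IsBilinear ξ η c r s b) (hx : x ∈ T.U) (i : Fin 2) :
    partialXi ξ η (momentCoord i) x = r i + b i * η x := by
  rw [h.partialXi_eq hx]
  simp [pderiv_momentCoord]

theorem partialEta_momentCoord (h : T.IsBilinear ξ η c r s b) (hx : x ∈ T.U) (i : Fin 2) :
    partialEta ξ η (momentCoord i) x = s i + b i * ξ x := by
  rw [h.partialEta_eq hx]
  simp [pderiv_momentCoord]

theorem isSeparableMoment_iff (h : T.IsBilinear ξ η c r s b) :
    T.IsSeparableMoment ξ η μ ↔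
      (∀ x ∈ T.U, ∑ k, pderiv k η x * ∑ j, (r j + b j * η x) * pderiv j (μ k) x = 0) ∧
      ∀ x ∈ T.U, ∑ k, pderiv k ξ x * ∑ j, (s j + b j * ξ x) * pderiv j (μ k) x = 0 := by
  refine and_congr (forall₂_congr fun x hx => ?_) (forall₂_congr fun x hx => ?_)
  · simp only [h.partialXi_momentCoord hx, h.partialXi_eq hx]
    exact (h.dualFrame hx).bracket_P_eq_zero_iff _
  · simp only [h.partialEta_momentCoord hx, h.partialEta_eq hx]
    exact (h.dualFrame hx).bracket_Q_eq_zero_iff _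

/-- Separability makes `∂_ξ μ` a multiple of `P` and `∂_η μ` a multiple of `Q`. The multiples are `α
= dξ(∂_ξ μ)` and `β = dη(∂_η μ)`, smooth by construction. -/
theorem exists_hasEigenvalues (h : T.IsBilinear ξ η c r s b)
    (hμ : ∀ i, ContDiffOn ℝ ∞ (μ i) T.U) (hs : T.IsSeparableMoment ξ η μ) :
    ∃ α β : (Fin 2 → ℝ) → ℝ, ContDiffOn ℝ ∞ α T.U ∧ ContDiffOn ℝ ∞ β T.U ∧
      HasEigenvalues T ξ η r s b μ α β := by
  rw [h.isSeparableMoment_iff] at hs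
  refine ⟨fun x => ∑ k, pderiv k ξ x * ∑ j, (r j + b j * η x) * pderiv j (μ k) x,
    fun x => ∑ k, pderiv k η x * ∑ j, (s j + b j * ξ x) * pderiv j (μ k) x, ?_, ?_, ?_⟩
  · exact ContDiffOn.sum fun k _ => (h.smooth_xi.pderiv T.isOpen k).mul (ContDiffOn.sum fun j _ =>
      (contDiffOn_const.add (contDiffOn_const.mul h.smooth_eta)).mul ((hμ k).pderiv T.isOpen j))
  · exact ContDiffOn.sum fun k _ => (h.smooth_eta.pderiv T.isOpen k).mul (ContDiffOn.sum fun j _ =>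
      (contDiffOn_const.add (contDiffOn_const.mul h.smooth_xi)).mul ((hμ k).pderiv T.isOpen j))
  · intro x hx j k
    have hf := h.dualFrame hx
    have e1 := hf.vec_eq (fun k => ∑ j, (r j + b j * η x) * pderiv j (μ k) x) k
    have e2 := hf.vec_eq (fun k => ∑ j, (s j + b j * ξ x) * pderiv j (μ k) x) k
    have e3 := hf.covec_eq (fun j => pderiv j (μ k) x) j
    rw [hs.1 x hx] at e1
    rw [hs.2 x hx] at e2
    linear_combination e3 + pderiv j ξ x * e1 + pderiv j η x * e2

theorem HasEigenvalues.isSeparableMoment (h : T.IsBilinear ξ η c r s b)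
    (hM : HasEigenvalues T ξ η r s b μ α β) : T.IsSeparableMoment ξ η μ := by
  rw [h.isSeparableMoment_iff]
  refine ⟨fun x hx => ?_, fun x hx => ?_⟩
  · have h1 := (h.dualFrame hx).xp
    have h3 := (h.dualFrame hx).yp
    simp only [hM x hx, Fin.sum_univ_two] at h1 h3 ⊢
    linear_combination (α x * (pderiv 0 ξ x * (r 0 + b 0 * η x) + pderiv 1 ξ x * (r 1 + b 1 * η x))
      + β x * (pderiv 0 η x * (s 0 + b 0 * ξ x) + pderiv 1 η x * (s 1 + b 1 * ξ x))) * h3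
  · have h1 := (h.dualFrame hx).xq
    have h3 := (h.dualFrame hx).yq
    simp only [hM x hx, Fin.sum_univ_two] at h1 h3 ⊢
    linear_combination (α x * (pderiv 0 ξ x * (r 0 + b 0 * η x) + pderiv 1 ξ x * (r 1 + b 1 * η x))
      + β x * (pderiv 0 η x * (s 0 + b 0 * ξ x) + pderiv 1 η x * (s 1 + b 1 * ξ x))) * h1

/-- A solution of the eigenvalue system is determined up to an affine change by one with distinct
eigenvalues. -/
theorem EigenvalueSystem.exists_affine {α' β' : (Fin 2 → ℝ) → ℝ}
    (hα : ContDiffOn ℝ ∞ α T.U) (hβ : ContDiffOn ℝ ∞ β T.U)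
    (hα' : ContDiffOn ℝ ∞ α' T.U) (hβ' : ContDiffOn ℝ ∞ β' T.U)
    (hne : ∀ x ∈ T.U, α' x - β' x ≠ 0)
    (h : EigenvalueSystem T ξ η b α β) (h' : EigenvalueSystem T ξ η b α' β') :
    ∃ γ δ : ℝ, ∀ x ∈ T.U, α x = γ + δ * α' x ∧ β x = γ + δ * β' x := by
  have hs : ContDiffOn ℝ ∞ (fun x => (α x - β x) / (α' x - β' x)) T.U :=
    (hα.sub hβ).div (hα'.sub hβ') hne
  -- Both differences satisfy the same linear equation `df = f (b₂ dξ + b₁ dη)`, so their quotient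
  -- is constant. Differentiating quotient times denominator replaces the quotient rule.
  obtain ⟨δ, hδ⟩ := exists_eq_of_pderiv_eq_zero T.isOpen T.connected hs (by
    intro x hx i
    have d1 := hα.diffAt T.isOpen hx
    have d2 := hβ.diffAt T.isOpen hx
    have d3 := hα'.diffAt T.isOpen hx
    have d4 := hβ'.diffAt T.isOpen hx
    have e := pderiv_congr T.isOpen hx
      (f := fun x => (α x - β x) / (α' x - β' x) * (α' x - β' x)) (g := fun x => α x - β x)
      (fun y hy => div_mul_cancel₀ _ (hne y hy)) i
    rw [pderiv_mul _ (hs.diffAt T.isOpen hx) (by fun_prop), pderiv_sub _ d1 d2, pderiv_sub _ d3 d4,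
      (h x hx i).1, (h x hx i).2, (h' x hx i).1, (h' x hx i).2] at e
    refine (mul_eq_zero.1 ?_).resolve_right (hne x hx)
    have k : (α x - β x) / (α' x - β' x) * (α' x - β' x) = α x - β x :=
      div_mul_cancel₀ _ (hne x hx)
    linear_combination e - (coeffXi η b x * pderiv i ξ x + coeffXi ξ b x * pderiv i η x) * k)
  have hδ' : ∀ x ∈ T.U, α x - β x = δ * (α' x - β' x) := fun x hx => by
    rw [← hδ x hx, div_mul_cancel₀ _ (hne x hx)]
  -- `dα` is linear in the difference of the eigenvalues, so `d(α - δ α') = 0`.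
  obtain ⟨γ, hγ⟩ := exists_eq_of_pderiv_eq_zero T.isOpen T.connected
    (hα.sub (contDiffOn_const.mul hα') : ContDiffOn ℝ ∞ (fun x => α x - δ * α' x) T.U) (by
    intro x hx i
    have d1 := hα.diffAt T.isOpen hx
    have d3 := hα'.diffAt T.isOpen hx
    rw [pderiv_sub _ d1 (by fun_prop), pderiv_const_mul _ _ d3, (h x hx i).1, (h' x hx i).1]
    linear_combination (2 * coeffXi η b x * pderiv i ξ x - coeffXi ξ b x * pderiv i η x) * hδ' x hx)
  refine ⟨γ, δ, fun x hx => ⟨?_, ?_⟩⟩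
  · linear_combination hγ x hx
  · linear_combination hγ x hx - hδ' x hx

end IsBilinear

theorem toricForm_linear {μ : Fin 2 → (Fin 2 → ℝ) → ℝ} (hμ : ∀ i, ContDiffOn ℝ ∞ (μ i) T.U)
    (hp : p ∈ T.carrier) (γ δ : ℝ) :
    toricForm (fun k x => γ * momentCoord k x + δ * μ k x) p =
      γ • kahlerForm p + δ • toricForm μ p := by
  rw [kahlerForm_eq]
  simp only [toricForm, Finset.smul_sum, ← Finset.sum_add_distrib]
  refine Finset.sum_congr rfl fun j _ => Finset.sum_congr rfl fun k _ => ?_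
  have h1 : DifferentiableAt ℝ (momentCoord k) (momentMap p) :=
    (ContinuousLinearMap.proj (R := ℝ) (φ := fun _ : Fin 2 => ℝ) k).differentiableAt
  have h2 := (hμ k).diffAt T.isOpen hp
  rw [pderiv_add _ (by fun_prop) (by fun_prop), pderiv_const_mul _ _ h1, pderiv_const_mul _ _ h2,
    add_smul, mul_smul, mul_smul]

/-- The Hamiltonian 2-forms separable with respect to `ξ, η` are spanned by the Kähler form and any
one of them with distinct eigenvalues. -/
theorem IsBilinear.separable_hamiltonian_iff {ξ η α β : (Fin 2 → ℝ) → ℝ} {c r s b : Fin 2 → ℝ}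
    {μ : Fin 2 → (Fin 2 → ℝ) → ℝ} (h : T.IsBilinear ξ η c r s b)
    (hμ : ∀ i, ContDiffOn ℝ ∞ (μ i) T.U) (hα : ContDiffOn ℝ ∞ α T.U) (hβ : ContDiffOn ℝ ∞ β T.U)
    (hM : HasEigenvalues T ξ η r s b μ α β) (hS : EigenvalueSystem T ξ η b α β)
    (hne : ∀ x ∈ T.U, α x - β x ≠ 0) (Ψ : TwoForm) :
    (T.IsSeparableTwoForm ξ η Ψ ∧ T.IsHamiltonian Ψ) ↔
      ∃ γ δ : ℝ, ∀ p ∈ T.carrier, Ψ p = γ • kahlerForm p + δ • toricForm μ p := by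
  constructor
  · rintro ⟨hsep, hH⟩
    obtain ⟨ν, hν, hb⟩ := hsep.exists_moment
    have e : ∀ p ∈ T.carrier, Ψ p = toricForm ν p := fun p hp =>
      hsep.toIsToricClosed.eq_toricForm hν hp
    obtain ⟨α', β', hα', hβ', hM'⟩ := h.exists_hasEigenvalues hν.smooth hb
    have hS' := h.eigenvalueSystem_of_equation hν.smooth hα' hβ' hM'
      (hH.congr fun p hp => (e p hp).symm)
    obtain ⟨γ, δ, hγδ⟩ := EigenvalueSystem.exists_affine hα' hβ' hα hβ hne hS' hS
    refine ⟨γ, δ, fun p hp => ?_⟩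
    rw [e p hp, kahlerForm_eq]
    simp only [toricForm, Finset.smul_sum, ← Finset.sum_add_distrib]
    refine Finset.sum_congr rfl fun j _ => Finset.sum_congr rfl fun k _ => ?_
    rw [smul_smul, smul_smul, ← add_smul, hM' _ hp, hM _ hp, pderiv_momentCoord,
      ← (h.dualFrame hp).delta, (hγδ _ hp).1, (hγδ _ hp).2]
    congr 1
    ring
  · rintro ⟨γ, δ, e⟩
    -- The combination has moment maps `γ xₖ + δ μₖ` and eigenvalues `γ + δ α`, `γ + δ β`, because
    -- both eigenvalues of `J` are 1.
    set ν : Fin 2 → (Fin 2 → ℝ) → ℝ := fun k x => γ * momentCoord k x + δ * μ k x with hν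
    have e' : ∀ p ∈ T.carrier, Ψ p = toricForm ν p := fun p hp => by
      rw [e p hp, toricForm_linear hμ hp]
    have hc : ∀ k, ContDiff ℝ ∞ (momentCoord k) := fun k =>
      (ContinuousLinearMap.proj (R := ℝ) (φ := fun _ : Fin 2 => ℝ) k).contDiff
    have hνs : ∀ i, ContDiffOn ℝ ∞ (ν i) T.U := fun i =>
      (contDiffOn_const.mul (hc i).contDiffOn).add (contDiffOn_const.mul (hμ i))
    have hνM : HasEigenvalues T ξ η r s b ν (fun x => γ + δ * α x) (fun x => γ + δ * β x) := by
      intro x hx j k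
      have h1 : DifferentiableAt ℝ (momentCoord k) x := (hc k).differentiable (by simp) x
      have h2 := (hμ k).diffAt T.isOpen hx
      rw [hν, pderiv_add _ (by fun_prop) (by fun_prop), pderiv_const_mul _ _ h1,
        pderiv_const_mul _ _ h2, pderiv_momentCoord, ← (h.dualFrame hx).delta, hM x hx]
      ring
    have hνS : EigenvalueSystem T ξ η b (fun x => γ + δ * α x) (fun x => γ + δ * β x) := by
      intro x hx i
      have d1 := hα.diffAt T.isOpen hx
      have d2 := hβ.diffAt T.isOpen hx
      rw [pderiv_add _ (by fun_prop) (by fun_prop), pderiv_const, pderiv_const_mul _ _ d1,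
        pderiv_add _ (by fun_prop) (by fun_prop), pderiv_const, pderiv_const_mul _ _ d2,
        (hS x hx i).1, (hS x hx i).2]
      constructor <;> ring
    refine ⟨⟨(isToricClosed_toricForm hνs).congr e', ν, (isMomentMap_toricForm hνs).congr e',
      HasEigenvalues.isSeparableMoment h hνM⟩, ?_⟩
    exact (h.isHamiltonian_toricForm hνs (contDiffOn_const.add (contDiffOn_const.mul hα))
      (contDiffOn_const.add (contDiffOn_const.mul hβ)) hνM hνS).congr e'

/-- A multiple of `J` has two equal eigenvalues, so distinct ones at a single point suffice. -/
theorem IsBilinear.not_multiple {ξ η α β : (Fin 2 → ℝ) → ℝ} {c r s b : Fin 2 → ℝ}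
    {μ : Fin 2 → (Fin 2 → ℝ) → ℝ} (h : T.IsBilinear ξ η c r s b)
    (hM : HasEigenvalues T ξ η r s b μ α β) (hx : x ∈ T.U) (hne : α x - β x ≠ 0) (γ : ℝ)
    (hγ : ∀ p ∈ T.carrier, toricForm μ p = γ • kahlerForm p) : False := by
  have hp : (Sum.elim x (0 : Fin 2 → ℝ) : SymplSpace) ∈ T.carrier := hx
  have hf := h.dualFrame hx
  have e : ∀ j k, α x * pderiv j ξ x * (r k + b k * η x) + β x * pderiv j η x * (s k + b k * ξ x) =
      γ * (pderiv j ξ x * (r k + b k * η x) + pderiv j η x * (s k + b k * ξ x)) := by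
    intro j k
    have := formComp_toricForm_inl_inr μ (Sum.elim x (0 : Fin 2 → ℝ)) j k
    rw [formComp, hγ _ hp, kahlerForm_eq, ContinuousAlternatingMap.smul_apply] at this
    have h2 := formComp_toricForm_inl_inr momentCoord (Sum.elim x (0 : Fin 2 → ℝ)) j k
    rw [formComp] at h2
    rw [h2, pderiv_momentCoord, ← hf.delta, hM _ hp] at this
    exact this.symm
  have e1 := fun j => hf.eq_zero_of_frame (A := (α x - γ) * pderiv j ξ x)
    (B := (β x - γ) * pderiv j η x) fun k => by linear_combination e j k
  have e2 := (hf.eq_zero_of_dual (A := α x - γ) (B := 0) fun j => by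
    linear_combination (e1 j).1).1
  have e3 := (hf.eq_zero_of_dual (A := 0) (B := β x - γ) fun j => by
    linear_combination (e1 j).2).2
  exact hne (by linear_combination e2 - e3)

end ToricKahlerSurface

/-! ### The form `Ψ_*` in the three canonical classes. -/

/-- The moment maps of `Ψ_*`. -/
def SepConstants.starMoment (C : SepConstants) (ξ η : (Fin 2 → ℝ) → ℝ) :
    SepClass → Fin 2 → (Fin 2 → ℝ) → ℝ
  | .PT => fun i x => (C.a i + C.a' i) * ξ x - C.a' i * η x
  | .CT => fun i x => C.a i * (ξ x * ξ x) + C.b i * (ξ x * ξ x * η x)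
  | .OT => fun i x => C.a' i * (ξ x * ξ x + ξ x * η x + η x * η x) +
      C.b i * (ξ x * η x * (ξ x + η x))

/-- The eigenvalue of `Ψ_*` along `∂_ξ`. -/
def SepClass.alpha (ξ η : (Fin 2 → ℝ) → ℝ) : SepClass → (Fin 2 → ℝ) → ℝ
  | .PT => fun _ => 1
  | .CT => fun x => 2 * ξ x
  | .OT => fun x => 2 * ξ x + η x

/-- The eigenvalue of `Ψ_*` along `∂_η`. -/
def SepClass.beta (ξ η : (Fin 2 → ℝ) → ℝ) : SepClass → (Fin 2 → ℝ) → ℝ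
  | .PT => fun _ => -1
  | .CT => fun x => ξ x
  | .OT => fun x => ξ x + 2 * η x

namespace ToricKahlerSurface

variable {T : ToricKahlerSurface} {x : Fin 2 → ℝ} {p : SymplSpace}

section Canonical

variable {k : SepClass} {C : SepConstants} {ξ η : (Fin 2 → ℝ) → ℝ}

theorem IsCanonical.isBilinear (hC : T.IsCanonical k C ξ η) (ho : T.IsOrthogonal ξ η) :
    T.IsBilinear ξ η C.c (fun i => C.a i + C.a' i) C.a' C.b where
  toIsOrthogonal := ho
  moment x hx i := by linear_combination hC.moment x hx i

/-- In CT `Q = ξ b`, so duality reads `ξ b₁ = 0`, `ξ b₂ = 1`. In OT `Q - P = (ξ - η) b`, giving `(ξ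
- η) b₁ = -1`, `(ξ - η) b₂ = 1`. In PT `b = 0` and the difference of eigenvalues is 2. -/
theorem IsCanonical.coeff (hC : T.IsCanonical k C ξ η) (ho : T.IsOrthogonal ξ η) (hx : x ∈ T.U) :
    k.alpha ξ η x - k.beta ξ η x ≠ 0 ∧
    (k.alpha ξ η x - k.beta ξ η x) * IsBilinear.coeffXi ξ C.b x =
      (match k with | .PT => 0 | .CT => 0 | .OT => -1) ∧
    (k.alpha ξ η x - k.beta ξ η x) * IsBilinear.coeffXi η C.b x =
      (match k with | .PT => 0 | .CT => 1 | .OT => 1) := by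
  have hf := (hC.isBilinear ho).dualFrame hx
  have h1 := hf.xp
  have h2 := hf.xq
  have h3 := hf.yp
  have h4 := hf.yq
  have hk := hC.constants
  simp only [Fin.sum_univ_two] at h1 h2 h3 h4
  cases k with
  | PT =>
    have hb : C.b = 0 := hk.1
    simp only [SepClass.alpha, SepClass.beta, IsBilinear.coeffXi, hb]
    norm_num
  | CT =>
    have ha : C.a' = 0 := hk.1
    simp only [SepClass.alpha, SepClass.beta, IsBilinear.coeffXi, ha, Fin.sum_univ_two,
      Pi.zero_apply] at h2 h4 ⊢
    refine ⟨fun h0 => ?_, by linear_combination h2, by linear_combination h4⟩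
    -- `ξ = 0` would make `Q` vanish, contradicting `dη(Q) = 1`.
    rw [show ξ x = 0 by linarith] at h4
    simp at h4
  | OT =>
    have ha : C.a = 0 := hk.1
    simp only [SepClass.alpha, SepClass.beta, IsBilinear.coeffXi, ha, Fin.sum_univ_two,
      Pi.zero_apply] at h1 h2 h3 h4 ⊢
    refine ⟨fun h0 => ?_, by linear_combination h2 - h1, by linear_combination h4 - h3⟩
    have h5 : ξ x = η x := by linarith
    rw [h5] at h2
    linarith

theorem contDiffOn_alpha (ho : T.IsOrthogonal ξ η) : ContDiffOn ℝ ∞ (k.alpha ξ η) T.U := by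
  have h1 := ho.smooth_xi
  have h2 := ho.smooth_eta
  cases k <;> simp only [SepClass.alpha] <;> fun_prop

theorem contDiffOn_beta (ho : T.IsOrthogonal ξ η) : ContDiffOn ℝ ∞ (k.beta ξ η) T.U := by
  have h1 := ho.smooth_xi
  have h2 := ho.smooth_eta
  cases k <;> simp only [SepClass.beta] <;> fun_prop

theorem contDiffOn_starMoment (ho : T.IsOrthogonal ξ η) (i : Fin 2) :
    ContDiffOn ℝ ∞ (C.starMoment ξ η k i) T.U := by
  have h1 := ho.smooth_xi
  have h2 := ho.smooth_eta
  cases k <;> simp only [SepConstants.starMoment] <;> fun_prop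

/-- By `coeff` the products of `α - β` with the components of `b` are constants, so the system has
constant coefficients in `dξ`, `dη` and the listed affine eigenvalues solve it. -/
theorem IsCanonical.eigenvalueSystem (hC : T.IsCanonical k C ξ η) (ho : T.IsOrthogonal ξ η) :
    IsBilinear.EigenvalueSystem T ξ η C.b (k.alpha ξ η) (k.beta ξ η) := by
  intro x hx i
  obtain ⟨-, h1, h2⟩ := hC.coeff ho hx
  have hξ := ho.smooth_xi.diffAt T.isOpen hx
  have hη := ho.smooth_eta.diffAt T.isOpen hx
  have e1 : (k.alpha ξ η x - k.beta ξ η x) * (2 * IsBilinear.coeffXi η C.b x * pderiv i ξ x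
        - IsBilinear.coeffXi ξ C.b x * pderiv i η x) =
      2 * ((k.alpha ξ η x - k.beta ξ η x) * IsBilinear.coeffXi η C.b x) * pderiv i ξ x -
        (k.alpha ξ η x - k.beta ξ η x) * IsBilinear.coeffXi ξ C.b x * pderiv i η x := by ring
  have e2 : (k.alpha ξ η x - k.beta ξ η x) * (IsBilinear.coeffXi η C.b x * pderiv i ξ x
        - 2 * IsBilinear.coeffXi ξ C.b x * pderiv i η x) =
      (k.alpha ξ η x - k.beta ξ η x) * IsBilinear.coeffXi η C.b x * pderiv i ξ x -
        2 * ((k.alpha ξ η x - k.beta ξ η x) * IsBilinear.coeffXi ξ C.b x) * pderiv i η x := by ring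
  rw [e1, e2, h1, h2]
  cases k with
  | PT =>
    simp only [SepClass.alpha, SepClass.beta, pderiv_const]
    constructor <;> ring
  | CT =>
    simp only [SepClass.alpha, SepClass.beta]
    rw [pderiv_const_mul _ _ hξ]
    constructor <;> ring
  | OT =>
    simp only [SepClass.alpha, SepClass.beta]
    rw [pderiv_add _ (by fun_prop) (by fun_prop), pderiv_add _ (by fun_prop) (by fun_prop),
      pderiv_const_mul _ _ hξ, pderiv_const_mul _ _ hη]
    constructor <;> ring

theorem IsCanonical.hasEigenvalues (hC : T.IsCanonical k C ξ η) (ho : T.IsOrthogonal ξ η) :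
    IsBilinear.HasEigenvalues T ξ η (fun i => C.a i + C.a' i) C.a' C.b (C.starMoment ξ η k)
      (k.alpha ξ η) (k.beta ξ η) := by
  intro x hx j i
  have hξ := ho.smooth_xi.diffAt T.isOpen hx
  have hη := ho.smooth_eta.diffAt T.isOpen hx
  have hk := hC.constants
  cases k with
  | PT =>
    have hb : C.b = 0 := hk.1
    simp only [SepClass.alpha, SepClass.beta, SepConstants.starMoment, hb, Pi.zero_apply]
    rw [pderiv_sub _ (by fun_prop) (by fun_prop), pderiv_const_mul _ _ hξ, pderiv_const_mul _ _ hη]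
    ring
  | CT =>
    have ha : C.a' = 0 := hk.1
    simp only [SepClass.alpha, SepClass.beta, SepConstants.starMoment, ha, Pi.zero_apply]
    rw [pderiv_add _ (by fun_prop) (by fun_prop), pderiv_const_mul _ _ (by fun_prop),
      pderiv_const_mul _ _ (by fun_prop), pderiv_mul _ (by fun_prop) hη, pderiv_mul _ hξ hξ]
    ring
  | OT =>
    have ha : C.a = 0 := hk.1
    simp only [SepClass.alpha, SepClass.beta, SepConstants.starMoment, ha, Pi.zero_apply]
    rw [pderiv_add _ (by fun_prop) (by fun_prop), pderiv_const_mul _ _ (by fun_prop),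
      pderiv_const_mul _ _ (by fun_prop), pderiv_mul _ (by fun_prop) (by fun_prop),
      pderiv_add _ (by fun_prop) (by fun_prop), pderiv_add _ (by fun_prop) (by fun_prop),
      pderiv_add _ (by fun_prop) (by fun_prop), pderiv_mul _ hξ hη, pderiv_mul _ hξ hξ,
      pderiv_mul _ hη hη]
    ring

/-- In OT the primitive is polynomial, since `(ξ³ - η³)/(ξ - η) = ξ² + ξη + η²` and `(ξ³η - η³ξ)/(ξ
- η) = ξη(ξ + η)`. -/
theorem IsCanonical.psiStar_eq (hC : T.IsCanonical k C ξ η) (ho : T.IsOrthogonal ξ η)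
    (hp : p ∈ T.carrier) : psiStar k C ξ η p = toricForm (C.starMoment ξ η k) p := by
  rw [← dOneForm_toricPrimitive (contDiffOn_starMoment ho) hp, psiStar, dOneForm, dOneForm]
  refine Filter.EventuallyEq.extDeriv_eq
    (Filter.eventually_of_mem (T.isOpen_carrier.mem_nhds hp) fun q hq => ?_)
  have hne := (hC.coeff ho hq).1
  have e : C.primitive (ξ (momentMap q)) (η (momentMap q)) k =
      toricPrimitive (C.starMoment ξ η k) q := by
    ext v
    cases k with
    | PT =>
      simp [SepConstants.primitive, toricPrimitive, SepConstants.starMoment, SepConstants.dpsi,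
        SepConstants.dvarphi, dangle, Fin.sum_univ_two]
      ring
    | CT =>
      simp [SepConstants.primitive, toricPrimitive, SepConstants.starMoment, SepConstants.dpsi,
        SepConstants.dvarphi, dangle, Fin.sum_univ_two]
      ring
    | OT =>
      have hd : ξ (momentMap q) - η (momentMap q) ≠ 0 := by
        intro h0
        apply hne
        simp only [SepClass.alpha, SepClass.beta]
        linarith
      simp [SepConstants.primitive, toricPrimitive, SepConstants.starMoment, SepConstants.dpsi,
        SepConstants.dvarphi, dangle, Fin.sum_univ_two]
      field_simp
      ring
  simp only [e]

end Canonical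

/-! ### Separable coordinates are bilinear, and their normal forms. -/

section Classification

variable {ξ η : (Fin 2 → ℝ) → ℝ}

/-- A function whose differential is a multiple of `dξ` and a multiple of `dη` is constant. -/
theorem IsOrthogonal.exists_eq_const (ho : T.IsOrthogonal ξ η) {f : (Fin 2 → ℝ) → ℝ}
    (hf : ContDiffOn ℝ ∞ f T.U)
    (h1 : ∀ x ∈ T.U, pderiv 0 f x * pderiv 1 ξ x = pderiv 1 f x * pderiv 0 ξ x)
    (h2 : ∀ x ∈ T.U, pderiv 0 f x * pderiv 1 η x = pderiv 1 f x * pderiv 0 η x) :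
    ∃ c, ∀ x ∈ T.U, f x = c := by
  refine exists_eq_of_pderiv_eq_zero T.isOpen T.connected hf fun x hx i => ?_
  have hj := ho.independent x hx
  rw [jacobian] at hj
  refine (mul_eq_zero.1 ?_).resolve_right hj
  have e1 := h1 x hx
  have e2 := h2 x hx
  fin_cases i
  · change pderiv 0 f x * _ = 0
    linear_combination pderiv 0 ξ x * e2 - pderiv 0 η x * e1
  · change pderiv 1 f x * _ = 0
    linear_combination pderiv 1 ξ x * e2 - pderiv 1 η x * e1

/-- The moment maps of a separable surface are bilinear in the coordinates. -/
theorem IsSeparable.exists_isBilinear (h : T.IsSeparable ξ η) :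
    ∃ c r s b : Fin 2 → ℝ, T.IsBilinear ξ η c r s b := by
  have ho := h.toIsOrthogonal
  suffices ∀ i, ∃ c r s b : ℝ, ∀ x ∈ T.U, x i = c + r * ξ x + s * η x + b * ξ x * η x by
    choose c r s b hm using this
    exact ⟨c, r, s, b, ho, fun x hx i => hm i x hx⟩
  intro i
  have hm : ∀ j x, pderiv j (momentCoord i) x = if j = i then 1 else 0 :=
    fun j x => pderiv_coord j i
  have hξs := h.smooth_xi
  have hηs := h.smooth_eta
  have hms : ContDiffOn ℝ ∞ (momentCoord i) T.U :=
    (ContinuousLinearMap.proj (R := ℝ) (φ := fun _ : Fin 2 => ℝ) i).contDiff.contDiffOn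
  have hjs : ∀ u v, ContDiffOn ℝ ∞ u T.U → ContDiffOn ℝ ∞ v T.U →
      ContDiffOn ℝ ∞ (jacobian u v) T.U := fun u v hu hv =>
    ((hu.pderiv T.isOpen 0).mul (hv.pderiv T.isOpen 1)).sub
      ((hu.pderiv T.isOpen 1).mul (hv.pderiv T.isOpen 0))
  have hP : ContDiffOn ℝ ∞ (partialXi ξ η (momentCoord i)) T.U :=
    (hjs _ _ hms hηs).div (hjs _ _ hξs hηs) h.independent
  have hQ : ContDiffOn ℝ ∞ (partialEta ξ η (momentCoord i)) T.U :=
    (hjs _ _ hξs hms).div (hjs _ _ hξs hηs) h.independent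
  set P := partialXi ξ η (momentCoord i) with hPdef
  set Q := partialEta ξ η (momentCoord i) with hQdef
  -- `df = ∂_ξ f dξ + ∂_η f dη`, by Cramer's rule.
  have chain : ∀ x ∈ T.U, ∀ f j,
      pderiv j f x = partialXi ξ η f x * pderiv j ξ x + partialEta ξ η f x * pderiv j η x := by
    intro x hx f j
    have hj := h.independent x hx
    rw [partialXi, partialEta, div_mul_eq_mul_div, div_mul_eq_mul_div, ← add_div, eq_div_iff hj]
    simp only [jacobian]
    fin_cases j <;> simp only [Fin.zero_eta, Fin.mk_one] <;> ring
  set R := partialEta ξ η P with hR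
  set S := partialXi ξ η Q with hS
  have dP : ∀ x ∈ T.U, ∀ j, pderiv j P x = R x * pderiv j η x := by
    intro x hx j
    rw [chain x hx P j, h.xi_xi x hx i, zero_mul, zero_add]
  have dQ : ∀ x ∈ T.U, ∀ j, pderiv j Q x = S x * pderiv j ξ x := by
    intro x hx j
    rw [chain x hx Q j, h.eta_eta x hx i, zero_mul, add_zero]
  have dm : ∀ x ∈ T.U, ∀ j, pderiv j (momentCoord i) x = P x * pderiv j ξ x + Q x * pderiv j η x :=
    fun x hx j => chain x hx _ j
  -- Equality of `∂_ξ∂_η xᵢ` and `∂_η∂_ξ xᵢ`: expand `d(P dξ + Q dη) = 0`, which is `(S - R)` times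
  -- minus or plus the nonzero Jacobian once `dP = R dη`, `dQ = S dξ` are inserted.
  have hRS : ∀ x ∈ T.U, S x = R x := by
    intro x hx
    have hPx := hP.diffAt T.isOpen hx
    have hQx := hQ.diffAt T.isOpen hx
    have hξ1 := fun j => (hξs.pderiv T.isOpen j).diffAt T.isOpen hx
    have hη1 := fun j => (hηs.pderiv T.isOpen j).diffAt T.isOpen hx
    have key : ∀ l j, S x * pderiv l ξ x * pderiv j η x + R x * pderiv l η x * pderiv j ξ x +
        (P x * pderiv l (pderiv j ξ) x + Q x * pderiv l (pderiv j η) x) = 0 := by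
      intro l j
      have e := pderiv_congr T.isOpen hx (fun y hy => dm y hy j) l
      rw [show pderiv j (momentCoord i) = fun _ => if j = i then 1 else 0 from funext (hm j),
        pderiv_const, pderiv_add _ (hPx.fun_mul (hξ1 j)) (hQx.fun_mul (hη1 j)),
        pderiv_mul _ hPx (hξ1 j), pderiv_mul _ hQx (hη1 j), dP x hx, dQ x hx] at e
      linear_combination -e
    have c1 := pderiv_comm T.isOpen hξs hx 0 1
    have c2 := pderiv_comm T.isOpen hηs hx 0 1
    have hj := h.independent x hx
    rw [jacobian] at hj
    rw [← sub_eq_zero]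
    refine (mul_eq_zero.1 ?_).resolve_right hj
    linear_combination key 0 1 - key 1 0 - P x * c1 - Q x * c2
  have hRs : ContDiffOn ℝ ∞ R T.U := (hjs _ _ hξs hP).div (hjs _ _ hξs hηs) h.independent
  -- `dQ = R dξ` gives `dR ∧ dξ = 0`, and `dP = R dη` gives `dR ∧ dη = 0`; hence `R` is a constant
  -- `b`.
  obtain ⟨b, hb⟩ := ho.exists_eq_const hRs (by
    intro x hx
    have e : ∀ l j, pderiv l (pderiv j Q) x =
        pderiv l R x * pderiv j ξ x + R x * pderiv l (pderiv j ξ) x := by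
      intro l j
      rw [pderiv_congr T.isOpen hx (fun y hy => by rw [dQ y hy j, hRS y hy]),
        pderiv_mul _ (hRs.diffAt T.isOpen hx) ((hξs.pderiv T.isOpen j).diffAt T.isOpen hx)]
    have c1 := pderiv_comm T.isOpen hQ hx 0 1
    have c2 := pderiv_comm T.isOpen hξs hx 0 1
    rw [e, e] at c1
    linear_combination c1 - R x * c2) (by
    intro x hx
    have e : ∀ l j, pderiv l (pderiv j P) x =
        pderiv l R x * pderiv j η x + R x * pderiv l (pderiv j η) x := by
      intro l j
      rw [pderiv_congr T.isOpen hx (fun y hy => dP y hy j),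
        pderiv_mul _ (hRs.diffAt T.isOpen hx) ((hηs.pderiv T.isOpen j).diffAt T.isOpen hx)]
    have c1 := pderiv_comm T.isOpen hP hx 0 1
    have c2 := pderiv_comm T.isOpen hηs hx 0 1
    rw [e, e] at c1
    linear_combination c1 - R x * c2)
  obtain ⟨r, hr⟩ := exists_eq_of_pderiv_eq_zero T.isOpen T.connected
    (hP.sub (contDiffOn_const.mul hηs) : ContDiffOn ℝ ∞ (fun x => P x - b * η x) T.U) (by
    intro x hx j
    have hη := hηs.diffAt T.isOpen hx
    rw [pderiv_sub _ (hP.diffAt T.isOpen hx) (by fun_prop), pderiv_const_mul _ _ hη, dP x hx, hb x hx]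
    ring)
  obtain ⟨s, hs⟩ := exists_eq_of_pderiv_eq_zero T.isOpen T.connected
    (hQ.sub (contDiffOn_const.mul hξs) : ContDiffOn ℝ ∞ (fun x => Q x - b * ξ x) T.U) (by
    intro x hx j
    have hξ := hξs.diffAt T.isOpen hx
    rw [pderiv_sub _ (hQ.diffAt T.isOpen hx) (by fun_prop), pderiv_const_mul _ _ hξ, dQ x hx,
      hRS x hx, hb x hx]
    ring)
  obtain ⟨c, hc⟩ := exists_eq_of_pderiv_eq_zero T.isOpen T.connected
    (f := fun x => momentCoord i x - (r * ξ x + s * η x + b * (ξ x * η x))) (by fun_prop) (by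
    intro x hx j
    have hξ := hξs.diffAt T.isOpen hx
    have hη := hηs.diffAt T.isOpen hx
    have hmx := hms.diffAt T.isOpen hx
    rw [pderiv_sub _ hmx (by fun_prop), pderiv_add _ (by fun_prop) (by fun_prop),
      pderiv_add _ (by fun_prop) (by fun_prop), pderiv_const_mul _ _ hξ, pderiv_const_mul _ _ hη,
      pderiv_const_mul _ _ (by fun_prop), pderiv_mul _ hξ hη, dm x hx]
    linear_combination pderiv j ξ x * hr x hx + pderiv j η x * hs x hx)
  refine ⟨c, r, s, b, fun x hx => ?_⟩
  have := hc x hx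
  simp only [momentCoord] at this
  linear_combination this

/-- Affine normalization of the bilinear coordinates. -/
theorem IsBilinear.exists_isCanonical {c r s b : Fin 2 → ℝ} (h : T.IsBilinear ξ η c r s b) :
    ∃ (k : SepClass) (C : SepConstants) (ξ' η' : (Fin 2 → ℝ) → ℝ),
      T.IsAffineChange ξ η ξ' η' ∧ T.IsCanonical k C ξ' η' := by
  obtain ⟨x₀, hx₀⟩ := T.connected.nonempty
  have hne : bracket (fun i => r i + b i * η x₀) (fun i => s i + b i * ξ x₀) ≠ 0 :=
    right_ne_zero_of_mul_eq_one (h.dualFrame hx₀).jac_mul_bracket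
  -- In the plane, zero bracket with `b ≠ 0` means being a multiple of `b`.
  have par : ∀ w : Fin 2 → ℝ, b ≠ 0 → bracket w b = 0 → ∃ t : ℝ, ∀ i, w i = t * b i := by
    intro w hb hw
    rw [bracket, sub_eq_zero] at hw
    by_cases h0 : b 0 = 0
    · have h1 : b 1 ≠ 0 := by
        intro h1
        apply hb
        ext i
        fin_cases i <;> simp [h0, h1]
      refine ⟨w 1 / b 1, fun i => ?_⟩
      rw [div_mul_eq_mul_div, eq_div_iff h1]
      fin_cases i
      · exact hw
      · rfl
    · refine ⟨w 0 / b 0, fun i => ?_⟩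
      rw [div_mul_eq_mul_div, eq_div_iff h0]
      fin_cases i
      · rfl
      · exact hw.symm
  by_cases hb : b = 0
  · refine ⟨.PT, ⟨c, fun i => r i - s i, s, 0⟩, ξ, η,
      ⟨1, 1, 0, 0, one_ne_zero, one_ne_zero, Or.inl fun x _ => by simp⟩, ⟨fun x hx i => ?_, rfl, ?_⟩⟩
    · rw [h.moment x hx i, hb]
      simp only [Pi.zero_apply]
      ring
    · simp only [hb, bracket, Pi.zero_apply] at hne ⊢
      intro h0
      apply hne
      linear_combination h0
  by_cases hr : bracket r b = 0
  · obtain ⟨t, ht⟩ := par r hb hr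
    -- With `r = t b` the moment map is `c + s η + b ξ (η + t)`, so `η + t` becomes the first
    -- coordinate and the two are exchanged.
    refine ⟨.CT, ⟨fun i => c i - t * s i, s, 0, b⟩, fun x => 1 * η x + t, fun x => 1 * ξ x + 0,
      ⟨1, 1, t, 0, one_ne_zero, one_ne_zero, Or.inr fun x _ => ⟨rfl, rfl⟩⟩,
      ⟨fun x hx i => ?_, rfl, ?_⟩⟩
    · simp only [Pi.zero_apply]
      linear_combination h.moment x hx i + ξ x * ht i
    · simp only [bracket, ht] at hne ⊢
      intro h0
      apply hne
      linear_combination -(t + η x₀) * h0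
  by_cases hs : bracket s b = 0
  · obtain ⟨t, ht⟩ := par s hb hs
    refine ⟨.CT, ⟨fun i => c i - t * r i, r, 0, b⟩, fun x => 1 * ξ x + t, fun x => 1 * η x + 0,
      ⟨1, 1, t, 0, one_ne_zero, one_ne_zero, Or.inl fun x _ => ⟨rfl, rfl⟩⟩,
      ⟨fun x hx i => ?_, rfl, hr⟩⟩
    simp only [Pi.zero_apply]
    linear_combination h.moment x hx i + η x * ht i
  -- The combination `⟨r, b⟩ s - ⟨s, b⟩ r` has zero bracket with `b`, so it equals `t b`. Scaling by
  -- `⟨r, b⟩` and `⟨s, b⟩` makes the linear coefficients of both coordinates agree modulo `b`, and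
  -- shifting `ξ` by `t` absorbs that remainder.
  obtain ⟨t, ht⟩ := par (fun i => s i * bracket r b - r i * bracket s b) hb (by
    simp only [bracket]
    ring)
  set ρ := bracket r b with hρ
  set σ := bracket s b with hσ
  refine ⟨.OT, ⟨fun i => c i - t * (r i / ρ), 0, fun i => r i / ρ, fun i => b i / (ρ * σ)⟩,
    fun x => ρ * ξ x + t, fun x => σ * η x + 0,
    ⟨ρ, σ, t, 0, hr, hs, Or.inl fun x _ => ⟨rfl, rfl⟩⟩, ⟨fun x hx i => ?_, rfl, ?_⟩⟩
  · have hsi : s i = (t * b i + r i * σ) / ρ := by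
      rw [eq_div_iff hr]
      linear_combination ht i
    rw [h.moment x hx i, hsi]
    simp only [Pi.zero_apply]
    field_simp
    ring
  · have e : bracket (fun i => r i / ρ) (fun i => b i / (ρ * σ)) = bracket r b / (ρ ^ 2 * σ) := by
      simp only [bracket]
      field_simp
    rw [e]
    exact div_ne_zero hr (mul_ne_zero (pow_ne_zero 2 hr) hs)

end Classification

end ToricKahlerSurface

end

theorem mainTheorem9 (T : ToricKahlerSurface) (ξ₀ η₀ : (Fin 2 → ℝ) → ℝ)
    (hsep : T.IsSeparable ξ₀ η₀) :
    (∃ (k : SepClass) (C : SepConstants) (ξ η : (Fin 2 → ℝ) → ℝ),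
      T.IsAffineChange ξ₀ η₀ ξ η ∧ T.IsCanonical k C ξ η) ∧
    ∀ (k : SepClass) (C : SepConstants) (ξ η : (Fin 2 → ℝ) → ℝ),
      T.IsAffineChange ξ₀ η₀ ξ η → T.IsCanonical k C ξ η →
        (T.IsSeparableTwoForm ξ₀ η₀ (psiStar k C ξ η) ∧ T.IsHamiltonian (psiStar k C ξ η)) ∧
        (¬ ∃ γ : ℝ, ∀ p ∈ T.carrier, psiStar k C ξ η p = γ • kahlerForm p) ∧
        ∀ Ψ : TwoForm,
          (T.IsSeparableTwoForm ξ₀ η₀ Ψ ∧ T.IsHamiltonian Ψ) ↔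
            ∃! q : ℝ × ℝ, ∀ p ∈ T.carrier,
              Ψ p = q.1 • kahlerForm p + q.2 • psiStar k C ξ η p := by
  obtain ⟨c, r, s, b, hb⟩ := hsep.exists_isBilinear
  refine ⟨hb.exists_isCanonical, fun k C ξ η hc hC => ?_⟩
  have ho := hsep.toIsOrthogonal.affineChange hc
  have hB := hC.isBilinear ho
  have hne : ∀ x ∈ T.U, k.alpha ξ η x - k.beta ξ η x ≠ 0 := fun x hx => (hC.coeff ho hx).1
  -- Separability is unaffected by the affine change, so the spanning result is applied in the
  -- canonical coordinates and transported back.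
  have hiff : ∀ Ψ, (T.IsSeparableTwoForm ξ₀ η₀ Ψ ∧ T.IsHamiltonian Ψ) ↔
      ∃ γ δ : ℝ, ∀ p ∈ T.carrier, Ψ p = γ • kahlerForm p + δ • psiStar k C ξ η p := by
    intro Ψ
    have e : T.IsSeparableTwoForm ξ₀ η₀ Ψ ↔ T.IsSeparableTwoForm ξ η Ψ :=
      ⟨fun h => ⟨h.toIsToricClosed, h.exists_moment.imp fun μ hμ => ⟨hμ.1,
          (hsep.toIsOrthogonal.isSeparableMoment_iff hc μ).2 hμ.2⟩⟩,
        fun h => ⟨h.toIsToricClosed, h.exists_moment.imp fun μ hμ => ⟨hμ.1,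
          (hsep.toIsOrthogonal.isSeparableMoment_iff hc μ).1 hμ.2⟩⟩⟩
    rw [e, hB.separable_hamiltonian_iff (ToricKahlerSurface.contDiffOn_starMoment ho) (ToricKahlerSurface.contDiffOn_alpha ho)
      (ToricKahlerSurface.contDiffOn_beta ho) (hC.hasEigenvalues ho) (hC.eigenvalueSystem ho) hne]
    refine exists_congr fun γ => exists_congr fun δ => forall₂_congr fun p hp => ?_
    rw [hC.psiStar_eq ho hp]
  have hnot : ¬ ∃ γ : ℝ, ∀ p ∈ T.carrier, psiStar k C ξ η p = γ • kahlerForm p := by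
    rintro ⟨γ, hγ⟩
    obtain ⟨x, hx⟩ := T.connected.nonempty
    exact hB.not_multiple (hC.hasEigenvalues ho) hx (hne x hx) γ fun p hp => by
      rw [← hC.psiStar_eq ho hp, hγ p hp]
  refine ⟨(hiff _).2 ⟨0, 1, fun p _ => by simp⟩, hnot, fun Ψ => (hiff Ψ).trans ⟨?_, ?_⟩⟩
  · rintro ⟨γ, δ, h⟩
    refine ⟨(γ, δ), h, ?_⟩
    rintro ⟨γ', δ'⟩ h'
    have hd : ∀ p ∈ T.carrier, (γ' - γ) • kahlerForm p = (δ - δ') • psiStar k C ξ η p := by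
      intro p hp
      have e := (h p hp).symm.trans (h' p hp)
      refine twoForm_ext fun a b => ?_
      have e' := congrArg (fun φ => φ ![coordVec a, coordVec b]) e
      simp only [ContinuousAlternatingMap.add_apply, ContinuousAlternatingMap.smul_apply,
        smul_eq_mul] at e' ⊢
      linear_combination -e'
    -- Different coefficients of `Ψ_*` would exhibit it as a multiple of `J`.
    have hδ : δ' = δ := by
      by_contra hn
      refine hnot ⟨(δ - δ')⁻¹ * (γ' - γ), fun p hp => ?_⟩
      rw [mul_smul, hd p hp, inv_smul_smul₀ (sub_ne_zero.2 (Ne.symm hn))]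
    obtain ⟨x, hx⟩ := T.connected.nonempty
    have hp : (Sum.elim x (0 : Fin 2 → ℝ) : SymplSpace) ∈ T.carrier := hx
    have h2 := formComp_kahlerForm_inl_inr 0 0 (Sum.elim x (0 : Fin 2 → ℝ))
    rw [if_pos rfl, formComp] at h2
    -- Evaluating on `∂/∂x₁, ∂/∂φ¹`, where `J` equals 1, compares the coefficients of `J`.
    have h3 := congrArg (fun φ => φ ![coordVec (Sum.inl 0), coordVec (Sum.inr 0)]) (hd _ hp)
    simp only [ContinuousAlternatingMap.smul_apply, h2, hδ, sub_self, smul_eq_mul, mul_one,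
      zero_mul] at h3
    rw [hδ, sub_eq_zero.1 h3]
  · rintro ⟨⟨γ, δ⟩, h, -⟩
    exact ⟨γ, δ, h⟩
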